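/- For a nonzero rational number $k$ let $E^k$ be the elliptic curve $Y^2=4X^3+k$ over $\mathbb{Q}$. Let $n$ be an integer with $3\nmid n$, put $D=-3n^2$, and let $$\phi_D:E^D\to E^{-27D},\qquad (x,y)\mapsto\left(\frac{x^3+D}{x^2},\frac{y(x^3-2D)}{x^3}\right),$$ a $3$-isogeny with kernel $\{\mathcal{O},\pm P_D\}$, where $P_D=(0,\sqrt{D})$. Let $\delta:E^{-27D}(\mathbb{Q})\to H^1(\mathbb{Q},E^D[\phi_D])$ be the connecting map $P\mapsto[\sigma\mapsto\sigma(Q)-Q]$, where $\phi_D(Q)=P$, $Q\in E^D(\overline{\mathbb{Q}})$. Let $p_0=3$, let $p_1,\dots,p_s$ be the distinct primes dividing $n$, let $\zeta_3$ be a primitive cube root of unity, and for $0\le j\le s$ put $f_j(\sigma)=\log_{\zeta_3}\left(\sigma(\sqrt[3]{p_j})/\sqrt[3]{p_j}\right)\in\mathbb{F}_3$ for $\sigma\in\mathrm{Gal}(\overline{\mathbb{Q}}/\mathbb{Q})$. Let $P_0=(0,\sqrt{-27D}),P_1,\dots,P_r$ be generators of $E^{-27D}(\mathbb{Q})$. A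 cubic number field $L$ with integral basis $\{1,\omega_2,\omega_3\}$ has index form $I_L(X,Y)$ given by $1\wedge\gamma\wedge\gamma^2=I_L(x,y)\,(1\wedge\omega_2\wedge\omega_3)$ for $\gamma=x\omega_2+y\omega_3$; $L$ is called quasi-monogenic if $I_L(x,y)=\pm1$ for some $x,y\in\mathbb{Q}$. **Theorem.** For each $i$ there is exactly one vector $\overline\lambda^i=(\overline\lambda^i_0,\dots,\overline\lambda^i_s)\in\mathbb{F}_3^{s+1}$ such that $\delta(P_i)$ is the class of the cocycle $\sigma\mapsto\left(\sum_j\overline\lambda^i_jf_j(\sigma)\right)P_D$. Let $\mathcal{M}$ be the $(r+1)\times(s+1)$ matrix over $\mathbb{F}_3$ with rows $\overline\lambda^0,\dots,\overline\lambda^r$, and let $V\subseteq\mathbb{F}_3^{s+1}$ be its row space. 1. $E^{-27D}(\mathbb{Q})/\phi_D(E^D(\mathbb{Q}))$ is an $\mathbb{F}_3$-vector space isomorphic to $V$. 2. Suppose moreover that $n$ is squarefree. For $\overline\lambda\in\mathbb{F}_3$ let $\lambda\in\{0,1,2\}$ be its lift. Then there is a bijection from the set of one-dimensional subspaces $\langle(\overline\lambda_0,\dots,\overline\lambda_s)\rangle\subseteq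 V$ with $\overline\lambda_0=0$, $\overline\lambda_i\neq0$ for $i=1,\dots,s$, and $p_1^{\lambda_1}\cdots p_s^{\lambda_s}\equiv\pm1\pmod 9$, to the set of isomorphism classes of quasi-monogenic cubic number fields of discriminant $D$, given by $$\langle(\overline\lambda_0,\dots,\overline\lambda_s)\rangle\longmapsto\mathbb{Q}\left(\sqrt[3]{p_1^{\lambda_1}\cdots p_s^{\lambda_s}}\right).$$ -/

import Mathlib

noncomputable section

open WeierstrassCurve NumberField IntermediateField

namespace PureCubic

/-! ### The curves `E^k : Y² = 4X³ + k` and the isogeny `φ_D : E^D → E^{-27D}` -/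

/-- The curve `E^k : Y² = 4X³ + k` over `ℚ`, in the Weierstrass coordinates `(X, Y/2)`,
in which its equation is `y² = x³ + k/4`. -/
def curve (k : ℚ) : WeierstrassCurve ℚ := ⟨0, 0, 0, 0, k / 4⟩

/-- The group `E^k(F)` of `F`-rational points. -/
abbrev Pts (k : ℚ) (F : Type) [Field F] [Algebra ℚ F] : Type :=
  ((curve k).baseChange F).toAffine.Point

section Points

variable {F : Type} [Field F] [Algebra ℚ F]

theorem equation_iff (k : ℚ) (x y : F) :
    ((curve k).baseChange F).toAffine.Equation x y ↔ y ^ 2 = x ^ 3 + algebraMap ℚ F k / 4 := by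
  rw [WeierstrassCurve.Affine.equation_iff]
  simp [curve, WeierstrassCurve.baseChange, WeierstrassCurve.map]

theorem nonsingular_iff (k : ℚ) (x y : F) :
    ((curve k).baseChange F).toAffine.Nonsingular x y ↔
      y ^ 2 = x ^ 3 + algebraMap ℚ F k / 4 ∧ (x ≠ 0 ∨ y ≠ 0) := by
  have : CharZero F := algebraRat.charZero F
  rw [WeierstrassCurve.Affine.nonsingular_iff, equation_iff]
  have h : y = -y ↔ y = 0 := by
    constructor
    · intro h
      have h2 : (2 : F) * y = 0 := by linear_combination h
      simpa using h2
    · rintro rfl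
      simp
  refine and_congr_right fun _ => or_congr ?_ ?_
  · simp [curve, WeierstrassCurve.baseChange, WeierstrassCurve.map, eq_comm (a := (0 : F))]
  · simp [curve, WeierstrassCurve.baseChange, WeierstrassCurve.map, h]

/-- The point `(X, Y) = (0, d)` of `E^k`, where `d² = k` and `d ≠ 0`. -/
def zeroPt (k : ℚ) (d : F) (hd : d ^ 2 = algebraMap ℚ F k) (h0 : d ≠ 0) : Pts k F :=
  .some 0 (d / 2) <| by
    have : CharZero F := algebraRat.charZero F
    rw [nonsingular_iff]
    refine ⟨?_, Or.inr (div_ne_zero h0 two_ne_zero)⟩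
    rw [← hd]
    ring

theorem nonsingular_isogeny (D : ℚ) {x y : F}
    (h : ((curve D).baseChange F).toAffine.Nonsingular x y) (hx : x ≠ 0) :
    ((curve (-27 * D)).baseChange F).toAffine.Nonsingular
      ((x ^ 3 + algebraMap ℚ F D) / x ^ 2)
      (y * (x ^ 3 - 2 * algebraMap ℚ F D) / x ^ 3) := by
  have : CharZero F := algebraRat.charZero F
  rw [nonsingular_iff] at h ⊢
  set d := algebraMap ℚ F D with hd
  have hd' : algebraMap ℚ F (-27 * D) = -27 * d := by simp [hd]
  have key : (y * (x ^ 3 - 2 * d) / x ^ 3) ^ 2 = ((x ^ 3 + d) / x ^ 2) ^ 3 + -27 * d / 4 := by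
    have h1 := h.1
    rw [div_pow, mul_pow, h1]
    field_simp
    ring
  rw [hd']
  refine ⟨key, ?_⟩
  by_contra! hc
  rw [hc.1, hc.2] at key
  have hd0 : d = 0 := by
    have h4 : (27 : F) * d = 0 := by linear_combination 4 * key
    simpa using h4
  have hx1 := hc.1
  rw [hd0] at hx1
  simp [hx] at hx1

/-- The isogeny `φ_D : E^D → E^{-27D}`,
`(X, Y) ↦ ((X³ + D)/X², Y(X³ - 2D)/X³)`, with the points where `X = 0` going to the origin.
The formula is the same in the coordinates `(X, Y/2)`, since it is linear in `Y`. -/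
def isogeny (D : ℚ) [DecidableEq F] : Pts D F → Pts (-27 * D) F
  | .zero => 0
  | .some x y h =>
    if hx : x = 0 then 0
    else .some ((x ^ 3 + algebraMap ℚ F D) / x ^ 2)
      (y * (x ^ 3 - 2 * algebraMap ℚ F D) / x ^ 3) (nonsingular_isogeny D h hx)

end Points

/-! ### Cocycles -/

/-- An algebraic closure of `ℚ`. -/
abbrev Qbar : Type := AlgebraicClosure ℚ

instance : DecidableEq Qbar := Classical.decEq _

/-- The absolute Galois group of `ℚ`. -/
abbrev GalQ : Type := Qbar ≃ₐ[ℚ] Qbar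

/-- The action of the Galois group on `E^k(ℚ̄)`. -/
def galAct {k : ℚ} (σ : GalQ) (Q : Pts k Qbar) : Pts k Qbar :=
  Affine.Point.map (W' := curve k) (σ : Qbar →ₐ[ℚ] Qbar) Q

/-- The cochain `ξ` with values in `E^D(ℚ̄)` represents `δ(P)`, the class in
`H¹(ℚ, E^D[φ_D])` of `σ ↦ σ(Q) - Q` for a `Q ∈ E^D(ℚ̄)` with `φ_D(Q) = P`: it differs from
this cocycle by the coboundary `σ ↦ σ(T) - T` of some `T ∈ E^D[φ_D]`. -/
def RepresentsKummerClass (D : ℚ) (P : Pts (-27 * D) ℚ) (ξ : GalQ → Pts D Qbar) : Prop :=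
  ∃ Q : Pts D Qbar,
    isogeny D Q = Affine.Point.baseChange (W' := curve (-27 * D)) ℚ Qbar P ∧
    ∃ T : Pts D Qbar, isogeny D T = 0 ∧
      ∀ σ : GalQ, ξ σ = (galAct σ Q - Q) + (galAct σ T - T)

/-- The logarithm to base `ζ` on the group `{1, ζ, ζ²}` of cube roots of unity. -/
def logMu3 (ζ u : Qbar) : ZMod 3 := if u = 1 then 0 else if u = ζ then 1 else 2

/-- The cochain `f : σ ↦ log_ζ (σ(c)/c)`, for `c` a cube root of a rational number. -/
def kummerLog (ζ c : Qbar) (σ : GalQ) : ZMod 3 := logMu3 ζ (σ c / c)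

/-- The cochain `(∑ j, lam j * f j) • T`, where `f j : σ ↦ log_ζ (σ(c j)/c j)` and `T` is a point
killed by `3`. -/
def cochain {D : ℚ} {m : ℕ} (ζ : Qbar) (c : Fin m → Qbar) (T : Pts D Qbar) (lam : Fin m → ZMod 3)
    (σ : GalQ) : Pts D Qbar :=
  (∑ j, lam j * kummerLog ζ (c j) σ).val • T

/-- The row space of a matrix over `𝔽₃`. -/
def rowSpace {a b : ℕ} (M : Matrix (Fin a) (Fin b) (ZMod 3)) :
    Submodule (ZMod 3) (Fin b → ZMod 3) :=
  Submodule.span (ZMod 3) (Set.range M.row)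

/-! ### Quasi-monogenic cubic number fields -/

/-- The value at `(x, y) ∈ ℚ²` of the index form of a cubic number field `L`, with respect to an
integral basis `b = {1, ω₂, ω₃}`: it is the number `I` such that
`1 ∧ γ ∧ γ² = I · (1 ∧ ω₂ ∧ ω₃)`, where `γ = x ω₂ + y ω₃`. -/
def indexForm {L : Type} [Field L] [NumberField L] (b : Module.Basis (Fin 3) ℤ (𝓞 L))
    (x y : ℚ) : ℚ :=
  let bL : Module.Basis (Fin 3) ℚ L := b.localizationLocalization ℚ (nonZeroDivisors ℤ) L
  let γ : L := x • bL 1 + y • bL 2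
  bL.det ![1, γ, γ ^ 2]

/-- `L` is a cubic number field whose index form represents a unit of `ℤ` over `ℚ`. -/
def IsQuasiMonogenicCubic (L : Type) [Field L] [NumberField L] : Prop :=
  ∃ b : Module.Basis (Fin 3) ℤ (𝓞 L), b 0 = 1 ∧
    ∃ (x y : ℚ) (u : ℤˣ), indexForm b x y = ((u : ℤ) : ℚ)

/-- A number field. -/
structure NumFld : Type 1 where
  carrier : Type
  [field : Field carrier]
  [numberField : NumberField carrier]

attribute [instance] NumFld.field NumFld.numberField

/-- Isomorphism of number fields. -/
instance numFldSetoid : Setoid NumFld where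
  r K L := Nonempty (K.carrier ≃+* L.carrier)
  iseqv :=
    { refl := fun K => ⟨RingEquiv.refl K.carrier⟩
      symm := fun ⟨e⟩ => ⟨e.symm⟩
      trans := fun ⟨e⟩ ⟨f⟩ => ⟨e.trans f⟩ }

/-- The isomorphism classes of number fields. -/
def NumFldClass : Type 1 := Quotient numFldSetoid

/-- The isomorphism class of a number field. -/
def classOf (L : Type) [Field L] [NumberField L] : NumFldClass :=
  Quotient.mk numFldSetoid ⟨L⟩

/-- The quasi-monogenic cubic number fields of discriminant `D`, up to isomorphism. -/
def quasiMonogenicCubicFields (D : ℤ) : Set NumFldClass :=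
  {C | ∃ L : NumFld, C = classOf L.carrier ∧ Module.finrank ℚ L.carrier = 3 ∧
    NumberField.discr L.carrier = D ∧ IsQuasiMonogenicCubic L.carrier}

/-- The field `ℚ(∛m)`, inside `ℝ`. -/
def cbrtField (m : ℕ) : IntermediateField ℚ ℝ := ℚ⟮(m : ℝ) ^ (1 / 3 : ℝ)⟯

instance (m : ℕ) : NumberField (cbrtField m) where
  to_finiteDimensional := by
    have hint : IsIntegral ℚ ((m : ℝ) ^ (1 / 3 : ℝ)) := by
      refine IsIntegral.of_pow (n := 3) (by norm_num) ?_
      have : ((m : ℝ) ^ (1 / 3 : ℝ)) ^ 3 = algebraMap ℚ ℝ (m : ℚ) := by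
        rw [← Real.rpow_natCast, ← Real.rpow_mul (Nat.cast_nonneg m)]
        norm_num
      rw [this]
      exact isIntegral_algebraMap
    exact IntermediateField.adjoin.finiteDimensional hint

/-! ### The lines in the row space -/

/-- The integer `∏ i, p_i ^ λ_i` (`i = 1, …, s`) attached to `λ = (λ_0, …, λ_s)`, where the
exponents are lifted to `{0, 1, 2}`. -/
def primeProduct {s : ℕ} (p : Fin s → ℕ) (lam : Fin (s + 1) → ZMod 3) : ℕ :=
  ∏ i : Fin s, p i ^ (lam i.succ).val

/-- The conditions `λ_0 = 0`, `λ_i ≠ 0` for `i = 1, …, s`, and `∏ p_i ^ λ_i ≡ ±1 mod 9`. -/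
def Admissible {s : ℕ} (p : Fin s → ℕ) (lam : Fin (s + 1) → ZMod 3) : Prop :=
  lam 0 = 0 ∧ (∀ i : Fin s, lam i.succ ≠ 0) ∧
    ((primeProduct p lam : ℤ) ≡ 1 [ZMOD 9] ∨ (primeProduct p lam : ℤ) ≡ -1 [ZMOD 9])

/-- The lines `⟨λ⟩ ⊆ V` spanned by an admissible `λ`. -/
def admissibleLines {s : ℕ} (p : Fin s → ℕ) (V : Submodule (ZMod 3) (Fin (s + 1) → ZMod 3)) :
    Set (Submodule (ZMod 3) (Fin (s + 1) → ZMod 3)) :=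
  {l | ∃ lam ∈ V, lam ≠ 0 ∧ Admissible p lam ∧ l = Submodule.span (ZMod 3) {lam}}

end PureCubic

end

open PureCubic

noncomputable section
open WeierstrassCurve NumberField IntermediateField
namespace PureCubic

/-! ### The chord-tangent law on `y² = x³ + k/4`, and additivity of the isogeny -/

section Points

variable {F : Type} [Field F] [Algebra ℚ F]

/-! Put `e = √(-27D) = 9|n|`, which is rational because `D = -3n²`. In the coordinates `(X, Y/2)` a
point `(x, y)` of `E^{-27D}` satisfies `(y + e/2)(y - e/2) = x³`. The curve `z³ - z'³ = e` maps to
`E^D` in such a way that the composite with `φ_D` is `(z, z') ↦ (zz', (z³ + z'³)/2)`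
(`isogeny_fermatPt`). A preimage of `(x, y)` is thus obtained from a cube root `z` of `y + e/2` and
`z' = x/z`. Multiplying `(z, z')` by `(w, w²)`, with `w` the cube root of unity determined by `9√D =
(1 + 2w)e`, is translation by `P_D` (`fermatPt_mul_root`). Hence `δ(x, y)` is the Kummer class of `y
+ e/2` in `ℚ*/ℚ*³`.

At a prime `l ∤ 3n` the factors `y ± e/2` differ by a unit and have a cube as product, so `l` occurs
in `y + e/2` with exponent divisible by 3 (`three_dvd_padicValRat`); the class is therefore a
product of powers of `3, p_1, …, p_s`. The exponents are unique because a rational cube has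
valuations divisible by 3 (`eq_zero_of_represents_zero`). They define a homomorphism `Λ` into
`𝔽₃^{s+1}` whose kernel is the image of `φ_D` by Galois descent (`exists_kummerHom`). Its image is
the row space, and part 1 is the first isomorphism theorem.

For part 2, Cardano's formula shows that a cubic field of discriminant `-3n²` is pure
(`exists_cube_root`), say `ℚ(∛(ab²))` with `a`, `b` squarefree and coprime. By Dedekind's
description of its integers, the discriminant is `-3(ab)²` if `ab² ≡ ±1 mod 9` and is `-27(ab)²`
times a square otherwise. As `3 ∤ n`, the first case holds and `ab = |n|`. So the admissible
vectors, up to sign, are exactly the pure cubic fields of discriminant `D`; a sign change exchanges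
`a` and `b`, that is, `∛(ab²)` and `∛(a²b)`.

In such a field the index form represents `±1` over `ℚ` iff `3(bX³ - aY³) = 1` has a rational
solution (`IsPureBasis.exists_indexForm_iff`). On the other side, substituting `y + e/2 = r³ab²` and
`e = 9ab` in the equation of `E^{-27D}` gives `br³ - at³ = 9`, the same equation rescaled by 3. So
being quasi-monogenic and lying in `V` are the same condition (`exists_kummerHom_eq_iff`). -/

theorem negY_eq (k : ℚ) (x y : F) :
    ((curve k).baseChange F).toAffine.negY x y = -y := by
  simp [curve, WeierstrassCurve.baseChange, WeierstrassCurve.map, Affine.negY]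

theorem nonsingular_neg_iff (k : ℚ) (x y : F) :
    ((curve k).baseChange F).toAffine.Nonsingular x (-y) ↔
      ((curve k).baseChange F).toAffine.Nonsingular x y := by
  rw [nonsingular_iff, nonsingular_iff, neg_sq, neg_ne_zero]

theorem neg_some_eq (k : ℚ) {x y : F} (h : ((curve k).baseChange F).toAffine.Nonsingular x y) :
    -(Affine.Point.some x y h : Pts k F) =
      .some x (-y) ((nonsingular_neg_iff k x y).mpr h) := by
  rw [Affine.Point.neg_some]
  simp only [negY_eq]

variable [DecidableEq F]

omit [DecidableEq F] in
theorem some_congr (k : ℚ) {x y x' y' : F}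
    (h : ((curve k).baseChange F).toAffine.Nonsingular x y)
    (h' : ((curve k).baseChange F).toAffine.Nonsingular x' y') (hx : x = x') (hy : y = y') :
    (Affine.Point.some x y h : Pts k F) = .some x' y' h' := by
  subst hx hy
  rfl

/-- Three points of a line, counted with multiplicity, add up to zero. -/
theorem add_add_eq_zero_of_line (k : ℚ) {x₁ y₁ x₂ y₂ x₃ y₃ l m : F}
    (h₁ : ((curve k).baseChange F).toAffine.Nonsingular x₁ y₁)
    (h₂ : ((curve k).baseChange F).toAffine.Nonsingular x₂ y₂)
    (h₃ : ((curve k).baseChange F).toAffine.Nonsingular x₃ y₃)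
    (e₁ : y₁ = l * x₁ + m) (e₂ : y₂ = l * x₂ + m) (e₃ : y₃ = l * x₃ + m)
    (s₁ : x₁ + x₂ + x₃ = l ^ 2) (s₂ : x₁ * x₂ + x₁ * x₃ + x₂ * x₃ = -2 * l * m) :
    (.some x₁ y₁ h₁ + .some x₂ y₂ h₂ + .some x₃ y₃ h₃ : Pts k F) = 0 := by
  have : CharZero F := algebraRat.charZero F
  rw [add_eq_zero_iff_eq_neg, neg_some_eq]
  have n₁ := (nonsingular_iff k _ _).1 h₁
  have hsl : ¬ (x₁ = x₂ ∧ y₁ = ((curve k).baseChange F).toAffine.negY x₂ y₂) ∧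
      ((curve k).baseChange F).toAffine.slope x₁ x₂ y₁ y₂ = l := by
    by_cases hx : x₁ = x₂
    · subst hx
      have hy : y₁ = y₂ := e₁.trans e₂.symm
      subst hy
      -- A double root of the cubic cut out by the line: the hypotheses on the symmetric functions
      -- say that `l` is the tangent slope.
      have key : 3 * x₁ ^ 2 = l * (2 * y₁) := by
        rw [e₁]; linear_combination (2 * x₁) * s₁ - s₂
      have hy0 : y₁ ≠ 0 := by
        rintro rfl
        have : x₁ = 0 := by simpa using key
        simp [this] at n₁
      have hne : y₁ ≠ ((curve k).baseChange F).toAffine.negY x₁ y₁ := by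
        rw [negY_eq]
        intro h
        apply hy0
        have : (2 : F) * y₁ = 0 := by linear_combination h
        simpa using this
      refine ⟨fun h => hne h.2, ?_⟩
      rw [Affine.slope_of_Y_ne rfl hne, negY_eq]
      have hd : y₁ - -y₁ ≠ 0 := by
        have : y₁ - -y₁ = 2 * y₁ := by ring
        rw [this]; exact mul_ne_zero two_ne_zero hy0
      rw [div_eq_iff hd]
      simp [curve, WeierstrassCurve.baseChange, WeierstrassCurve.map]
      linear_combination key
    · refine ⟨fun h => hx h.1, ?_⟩
      rw [Affine.slope_of_X_ne hx, div_eq_iff (sub_ne_zero.2 hx), e₁, e₂]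
      ring
  rw [Affine.Point.add_some hsl.1]
  have hX : ((curve k).baseChange F).toAffine.addX x₁ x₂
      (((curve k).baseChange F).toAffine.slope x₁ x₂ y₁ y₂) = x₃ := by
    rw [hsl.2, Affine.addX]
    simp [curve, WeierstrassCurve.baseChange, WeierstrassCurve.map]
    linear_combination -s₁
  refine some_congr k _ _ hX ?_
  rw [Affine.addY, negY_eq, Affine.negAddY, hX, hsl.2, e₃, e₁]
  ring

/-- Three affine points with sum zero lie on a line, counted with multiplicity. -/
theorem exists_line_of_add_ne_zero (k : ℚ) {x₁ y₁ x₂ y₂ : F}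
    (h₁ : ((curve k).baseChange F).toAffine.Nonsingular x₁ y₁)
    (h₂ : ((curve k).baseChange F).toAffine.Nonsingular x₂ y₂)
    (hne : (.some x₁ y₁ h₁ + .some x₂ y₂ h₂ : Pts k F) ≠ 0) :
    ∃ (l m x₃ : F) (h₃ : ((curve k).baseChange F).toAffine.Nonsingular x₃ (l * x₃ + m)),
      (.some x₁ y₁ h₁ + .some x₂ y₂ h₂ + .some x₃ (l * x₃ + m) h₃ : Pts k F) = 0 ∧
      y₁ = l * x₁ + m ∧ y₂ = l * x₂ + m ∧ x₁ + x₂ + x₃ = l ^ 2 ∧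
      x₁ * x₂ + x₁ * x₃ + x₂ * x₃ = -2 * l * m ∧
      x₁ * x₂ * x₃ = m ^ 2 - algebraMap ℚ F k / 4 := by
  have : CharZero F := algebraRat.charZero F
  have n₁ := (nonsingular_iff k _ _).1 h₁
  have n₂ := (nonsingular_iff k _ _).1 h₂
  suffices H : ∃ l m x₃ : F, y₁ = l * x₁ + m ∧ y₂ = l * x₂ + m ∧ x₁ + x₂ + x₃ = l ^ 2 ∧
      x₁ * x₂ + x₁ * x₃ + x₂ * x₃ = -2 * l * m by
    obtain ⟨l, m, x₃, e₁, e₂, s₁, s₂⟩ := H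
    have s₃ : x₁ * x₂ * x₃ = m ^ 2 - algebraMap ℚ F k / 4 := by
      have := n₁.1
      rw [e₁] at this
      linear_combination x₁ * s₂ - this - x₁ ^ 2 * s₁
    have h₃ : ((curve k).baseChange F).toAffine.Nonsingular x₃ (l * x₃ + m) := by
      rw [nonsingular_iff]
      refine ⟨by linear_combination x₃ * s₂ - x₃ ^ 2 * s₁ - s₃, ?_⟩
      by_contra! hc
      obtain ⟨rfl, hm⟩ := hc
      have hm : m = 0 := by simpa using hm
      subst hm
      have h12 : x₁ * x₂ = 0 := by simpa using s₂
      rcases mul_eq_zero.1 h12 with h | h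
      · subst h; simp [e₁] at n₁
      · subst h; simp [e₂] at n₂
    exact ⟨l, m, x₃, h₃, add_add_eq_zero_of_line k h₁ h₂ h₃ e₁ e₂ rfl s₁ s₂, e₁, e₂, s₁, s₂, s₃⟩
  by_cases hx : x₁ = x₂
  · subst hx
    have hyne : y₁ ≠ -y₂ := by
      intro h
      exact hne (Affine.Point.add_of_Y_eq rfl (by rw [negY_eq]; exact h))
    have hyy : y₁ = y₂ := by
      have : (y₁ - y₂) * (y₁ + y₂) = 0 := by linear_combination n₁.1 - n₂.1
      rcases mul_eq_zero.1 this with h | h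
      · exact sub_eq_zero.1 h
      · exact absurd (eq_neg_of_add_eq_zero_left h) hyne
    subst hyy
    have hy0 : y₁ ≠ 0 := by
      rintro rfl
      simp at hyne
    refine ⟨3 * x₁ ^ 2 / (2 * y₁), y₁ - 3 * x₁ ^ 2 / (2 * y₁) * x₁,
      (3 * x₁ ^ 2 / (2 * y₁)) ^ 2 - 2 * x₁, by ring, by ring, by ring, ?_⟩
    field_simp
    ring
  · have hx' := sub_ne_zero.2 hx
    refine ⟨(y₁ - y₂) / (x₁ - x₂), y₁ - (y₁ - y₂) / (x₁ - x₂) * x₁,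
      ((y₁ - y₂) / (x₁ - x₂)) ^ 2 - x₁ - x₂, by ring, by field_simp; ring, by ring, ?_⟩
    field_simp
    linear_combination (x₁ - x₂) * (n₁.1 - n₂.1)

theorem isogeny_zero (D : ℚ) : isogeny D (0 : Pts D F) = 0 := rfl

theorem isogeny_some_of_eq_zero (D : ℚ) {x y : F}
    (h : ((curve D).baseChange F).toAffine.Nonsingular x y) (hx : x = 0) :
    isogeny D (.some x y h : Pts D F) = 0 := by
  simp [isogeny, hx]

theorem isogeny_some_of_ne_zero (D : ℚ) {x y : F}
    (h : ((curve D).baseChange F).toAffine.Nonsingular x y) (hx : x ≠ 0) :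
    isogeny D (.some x y h : Pts D F) = .some ((x ^ 3 + algebraMap ℚ F D) / x ^ 2)
      (y * (x ^ 3 - 2 * algebraMap ℚ F D) / x ^ 3) (nonsingular_isogeny D h hx) := by
  simp [isogeny, hx]

theorem isogeny_some_eq_zero_iff (D : ℚ) {x y : F}
    (h : ((curve D).baseChange F).toAffine.Nonsingular x y) :
    isogeny D (.some x y h : Pts D F) = 0 ↔ x = 0 := by
  by_cases hx : x = 0
  · simp [isogeny_some_of_eq_zero, hx]
  · simp [isogeny_some_of_ne_zero D h hx, hx]

theorem isogeny_neg (D : ℚ) (Q : Pts D F) : isogeny D (-Q) = -isogeny D Q := by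
  rcases Q with _ | ⟨x, y, h⟩
  · rfl
  · rw [neg_some_eq]
    by_cases hx : x = 0
    · rw [isogeny_some_of_eq_zero _ _ hx, isogeny_some_of_eq_zero _ _ hx, neg_zero]
    · rw [isogeny_some_of_ne_zero _ _ hx, isogeny_some_of_ne_zero _ _ hx, neg_some_eq]
      exact some_congr _ _ _ rfl (by ring)

/-- The sum of an affine point with `X ≠ 0` and a point with `X = 0`. -/
theorem some_add_kernel (D : ℚ) {x y t : F}
    (h : ((curve D).baseChange F).toAffine.Nonsingular x y) (hx : x ≠ 0)
    (ht : ((curve D).baseChange F).toAffine.Nonsingular 0 t) :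
    ∃ h' : ((curve D).baseChange F).toAffine.Nonsingular (-2 * t * (y - t) / x ^ 2)
        (-((y - t) / x * (-2 * t * (y - t) / x ^ 2) + t)),
      (.some x y h + .some 0 t ht : Pts D F) = .some _ _ h' := by
  have : CharZero F := algebraRat.charZero F
  have n := ((nonsingular_iff D _ _).1 h).1
  have nt := ((nonsingular_iff D _ _).1 ht).1
  have e : x ^ 3 = (y - t) * (y + t) := by linear_combination nt - n
  have h₃ : ((curve D).baseChange F).toAffine.Nonsingular (-2 * t * (y - t) / x ^ 2)
      ((y - t) / x * (-2 * t * (y - t) / x ^ 2) + t) := by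
    have ht0 : t ≠ 0 := by
      have := ((nonsingular_iff D _ _).1 ht).2
      simpa using this
    have hyt : y - t ≠ 0 := by
      intro h0
      rw [h0, zero_mul] at e
      exact hx (by simpa using e)
    rw [nonsingular_iff]
    refine ⟨?_, Or.inl (div_ne_zero (mul_ne_zero (mul_ne_zero (by norm_num) ht0) hyt)
      (pow_ne_zero _ hx))⟩
    have hD : algebraMap ℚ F D / 4 = t ^ 2 := by linear_combination -nt
    rw [hD]
    have e2 : y + t = x ^ 3 / (y - t) := by field_simp; linear_combination -e
    field_simp
    linear_combination (-4 * (y - t) ^ 2) * e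
  refine ⟨(nonsingular_neg_iff _ _ _).2 h₃, ?_⟩
  rw [← neg_some_eq D h₃, ← add_eq_zero_iff_eq_neg]
  refine add_add_eq_zero_of_line D h ht h₃ (l := (y - t) / x) (m := t) ?_ ?_ rfl ?_ ?_
  · field_simp; ring
  · ring
  · field_simp
    linear_combination e
  · field_simp; ring

/-- Kernel points have abscissa 0, and the invariance of the formulas under translation by `(0, t)`
can be checked directly. This disposes of the degenerate cases of `isogeny_add`. -/
theorem isogeny_add_of_isogeny_eq_zero (D : ℚ) (P Q : Pts D F) (hP : isogeny D P = 0) :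
    isogeny D (Q + P) = isogeny D Q := by
  have : CharZero F := algebraRat.charZero F
  rcases P with _ | ⟨x, t, ht⟩
  · exact congrArg _ (add_zero Q)
  rw [isogeny_some_eq_zero_iff] at hP
  subst hP
  have nt := ((nonsingular_iff D _ _).1 ht)
  rcases Q with _ | ⟨x, y, h⟩
  · change isogeny D (0 + _) = isogeny D 0
    rw [zero_add, isogeny_some_of_eq_zero _ _ rfl, isogeny_zero]
  have n := (nonsingular_iff D _ _).1 h
  by_cases hx : x = 0
  · subst hx
    rw [isogeny_some_of_eq_zero _ _ rfl]
    by_cases hy : y = -t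
    · rw [Affine.Point.add_of_Y_eq rfl (by rw [negY_eq]; exact hy), isogeny_zero]
    · have hyt : y = t := by
        have : (y - t) * (y + t) = 0 := by linear_combination n.1 - nt.1
        rcases mul_eq_zero.1 this with h | h
        · exact sub_eq_zero.1 h
        · exact absurd (eq_neg_of_add_eq_zero_left h) hy
      subst hyt
      have := add_add_eq_zero_of_line D ht ht ht (l := 0) (m := y) (by ring) (by ring) (by ring)
        (by ring) (by ring)
      rw [add_eq_zero_iff_eq_neg] at this
      rw [this, isogeny_neg, isogeny_some_of_eq_zero _ _ rfl, neg_zero]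
  · obtain ⟨h', e⟩ := some_add_kernel D h hx ht
    have ht0 : t ≠ 0 := by simpa using nt.2
    have e3 : x ^ 3 = (y - t) * (y + t) := by linear_combination nt.1 - n.1
    have hyt : y - t ≠ 0 := by
      intro h0
      rw [h0, zero_mul] at e3
      exact hx (by simpa using e3)
    have hx' : -2 * t * (y - t) / x ^ 2 ≠ 0 :=
      div_ne_zero (mul_ne_zero (mul_ne_zero (by norm_num) ht0) hyt) (pow_ne_zero _ hx)
    rw [e, isogeny_some_of_ne_zero _ _ hx', isogeny_some_of_ne_zero _ _ hx]
    have hD : algebraMap ℚ F D = 4 * t ^ 2 := by linear_combination -4 * nt.1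
    simp only [hD]
    apply some_congr
    · field_simp
      linear_combination (4 * x ^ 3 + 8 * (y - t) * t) * e3
    · field_simp
      linear_combination (-4 * x ^ 6 + (8 * (y - t) ^ 2 - 4 * (y - t) * (y + t)) * x ^ 3
        - 8 * t * (y - t) ^ 2 * (y + t)) * e3

/-- The image of a line under the isogeny. -/
theorem isogeny_line {k x l m : F} (hx : x ≠ 0) (hk : 4 * m ^ 2 - k ≠ 0) [CharZero F]
    (h : (l * x + m) ^ 2 = x ^ 3 + k / 4) :
    (l * x + m) * (x ^ 3 - 2 * k) / x ^ 3 =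
      l * (4 * m ^ 2 + 3 * k) / (4 * m ^ 2 - k) * ((x ^ 3 + k) / x ^ 2) +
        (m - 4 * k * (2 * m + l ^ 3) / (4 * m ^ 2 - k)) := by
  obtain ⟨q, rfl⟩ : ∃ q, k = 4 * m ^ 2 - q := ⟨4 * m ^ 2 - k, by ring⟩
  rw [sub_sub_cancel] at hk ⊢
  linear_combination (norm := skip)
    (4 * (4 * m ^ 2 - q) * (l * x - 2 * m) / (q * x ^ 3)) * h
  field_simp
  ring

/-- Three collinear points outside the kernel have collinear images, on the line written down in
`isogeny_line`. That the images are the full intersection with this line is an identity in the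
elementary symmetric functions of the abscissae, which are `l²`, `-2lm` and `m² - k/4`. -/
theorem isogeny_add (D : ℚ) (hD : D ≠ 0) (P Q : Pts D F) :
    isogeny D (P + Q) = isogeny D P + isogeny D Q := by
  have : CharZero F := algebraRat.charZero F
  by_cases hP : isogeny D P = 0
  · rw [hP, zero_add, add_comm, isogeny_add_of_isogeny_eq_zero D P Q hP]
  by_cases hQ : isogeny D Q = 0
  · rw [hQ, add_zero, isogeny_add_of_isogeny_eq_zero D Q P hQ]
  by_cases hPQ : isogeny D (P + Q) = 0
  · have := isogeny_add_of_isogeny_eq_zero D (P + Q) (-P) hPQ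
    rw [neg_add_cancel_left, isogeny_neg] at this
    rw [hPQ, this, add_neg_cancel]
  rcases P with _ | ⟨x₁, y₁, h₁⟩
  · exact absurd rfl hP
  rcases Q with _ | ⟨x₂, y₂, h₂⟩
  · exact absurd rfl hQ
  have hne : (.some x₁ y₁ h₁ + .some x₂ y₂ h₂ : Pts D F) ≠ 0 := by
    intro h
    rw [h] at hPQ
    exact hPQ rfl
  obtain ⟨l, m, x₃, h₃, hs, e₁, e₂, s₁, s₂, s₃⟩ := exists_line_of_add_ne_zero D h₁ h₂ hne
  rw [eq_neg_of_add_eq_zero_left hs, isogeny_neg, neg_eq_zero] at hPQ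
  rw [eq_neg_of_add_eq_zero_left hs, isogeny_neg, eq_comm, ← add_eq_zero_iff_eq_neg]
  rw [isogeny_some_eq_zero_iff] at hP hQ hPQ
  have n₁ := ((nonsingular_iff D _ _).1 h₁).1
  have n₂ := ((nonsingular_iff D _ _).1 h₂).1
  have n₃ := ((nonsingular_iff D _ _).1 h₃).1
  subst e₁ e₂
  rw [isogeny_some_of_ne_zero _ _ hP, isogeny_some_of_ne_zero _ _ hQ,
    isogeny_some_of_ne_zero _ _ hPQ]
  set k := algebraMap ℚ F D with hk
  have hk' : k = 4 * (m ^ 2 - x₁ * x₂ * x₃) := by linear_combination 4 * s₃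
  -- The denominator of the image line vanishes only when one of the three points lies in the
  -- kernel.
  have hmk : 4 * m ^ 2 - k = 4 * (x₁ * x₂ * x₃) := by rw [hk']; ring
  have hmk0 : 4 * m ^ 2 - k ≠ 0 := by
    rw [hmk]
    exact mul_ne_zero (by norm_num) (mul_ne_zero (mul_ne_zero hP hQ) hPQ)
  refine add_add_eq_zero_of_line _ _ _ _ (isogeny_line (k := k) hP hmk0 n₁)
    (isogeny_line (k := k) hQ hmk0 n₂)
    (isogeny_line (k := k) hPQ hmk0 n₃) ?_ ?_
  · have e : (x₁ ^ 3 + k) / x₁ ^ 2 + (x₂ ^ 3 + k) / x₂ ^ 2 + (x₃ ^ 3 + k) / x₃ ^ 2 =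
        (x₁ + x₂ + x₃) + k * ((x₁ * x₂ + x₁ * x₃ + x₂ * x₃) ^ 2 -
          2 * (x₁ + x₂ + x₃) * (x₁ * x₂ * x₃)) / (x₁ * x₂ * x₃) ^ 2 := by
      field_simp
      ring
    rw [e, s₁, s₂, hmk, hk']
    have hs0 : x₁ * x₂ * x₃ ≠ 0 := mul_ne_zero (mul_ne_zero hP hQ) hPQ
    generalize x₁ * x₂ * x₃ = s at hs0
    field_simp
    ring
  · have e : (x₁ ^ 3 + k) / x₁ ^ 2 * ((x₂ ^ 3 + k) / x₂ ^ 2) +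
        (x₁ ^ 3 + k) / x₁ ^ 2 * ((x₃ ^ 3 + k) / x₃ ^ 2) +
        (x₂ ^ 3 + k) / x₂ ^ 2 * ((x₃ ^ 3 + k) / x₃ ^ 2) =
        (x₁ * x₂ + x₁ * x₃ + x₂ * x₃) +
        k * ((x₁ + x₂ + x₃) * ((x₁ * x₂ + x₁ * x₃ + x₂ * x₃) ^ 2 -
          2 * (x₁ + x₂ + x₃) * (x₁ * x₂ * x₃)) / (x₁ * x₂ * x₃) ^ 2 -
          (x₁ * x₂ + x₁ * x₃ + x₂ * x₃) / (x₁ * x₂ * x₃)) +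
        k ^ 2 * ((x₁ + x₂ + x₃) ^ 2 - 2 * (x₁ * x₂ + x₁ * x₃ + x₂ * x₃)) /
          (x₁ * x₂ * x₃) ^ 2 := by
      field_simp
      ring
    rw [e, s₁, s₂, hmk, hk']
    have hs0 : x₁ * x₂ * x₃ ≠ 0 := mul_ne_zero (mul_ne_zero hP hQ) hPQ
    generalize x₁ * x₂ * x₃ = s at hs0
    field_simp
    ring

end Points
end PureCubic

end

noncomputable section
open WeierstrassCurve NumberField IntermediateField
namespace PureCubic

/-! ### The model `z³ - z'³ = e` of `E^D`, where the isogeny becomes extraction of a cube root -/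

section Fermat

variable {F : Type} [Field F] [Algebra ℚ F]

theorem nonsingular_fermat {D : ℚ} {e z z' : F} (he : e ^ 2 = algebraMap ℚ F (-27 * D))
    (he0 : e ≠ 0) (h : z ^ 3 - z' ^ 3 = e) :
    ((curve D).baseChange F).toAffine.Nonsingular ((z ^ 2 + z * z' + z' ^ 2) / 3)
      ((z + z') * (z ^ 2 + z * z' + z' ^ 2) / 6) := by
  have : CharZero F := algebraRat.charZero F
  rw [nonsingular_iff]
  constructor
  · have hD : algebraMap ℚ F D = -(e ^ 2) / 27 := by rw [he]; simp
    rw [hD, ← h]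
    ring
  · left
    intro h0
    apply he0
    rw [← h]
    linear_combination 3 * (z - z') * h0

/-- The point of `E^D` attached to a point of the curve `z³ - z'³ = e`, where `e² = -27 D`. -/
def fermatPt (D : ℚ) {e : F} (he : e ^ 2 = algebraMap ℚ F (-27 * D)) (he0 : e ≠ 0) (z z' : F)
    (h : z ^ 3 - z' ^ 3 = e) : Pts D F :=
  .some _ _ (nonsingular_fermat he he0 h)

theorem nonsingular_fermat_isogeny {D : ℚ} {e z z' : F} (he : e ^ 2 = algebraMap ℚ F (-27 * D))
    (he0 : e ≠ 0) (h : z ^ 3 - z' ^ 3 = e) :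
    ((curve (-27 * D)).baseChange F).toAffine.Nonsingular (z * z') ((z ^ 3 + z' ^ 3) / 2) := by
  have : CharZero F := algebraRat.charZero F
  rw [nonsingular_iff, ← he, ← h]
  refine ⟨by ring, ?_⟩
  by_contra! hc
  apply he0
  have h1 : z ^ 3 * 2 = e := by linear_combination 2 * hc.2 + h
  have h2 : z' ^ 3 * 2 = -e := by linear_combination 2 * hc.2 - h
  have h3 : e ^ 2 = 0 := by
    linear_combination -e * h1 + 2 * z ^ 3 * h2 - 4 * z ^ 2 * z' ^ 2 * hc.1
  simpa using h3

/-- This makes preimages explicit: the image `(X, Y)` satisfies `z³ = Y + e/2`, `z'³ = Y - e/2` and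
`zz' = X`. -/
theorem isogeny_fermatPt [DecidableEq F] {D : ℚ} {e z z' : F}
    (he : e ^ 2 = algebraMap ℚ F (-27 * D)) (he0 : e ≠ 0) (h : z ^ 3 - z' ^ 3 = e) :
    isogeny D (fermatPt D he he0 z z' h) = .some _ _ (nonsingular_fermat_isogeny he he0 h) := by
  have : CharZero F := algebraRat.charZero F
  have hS : z ^ 2 + z * z' + z' ^ 2 ≠ 0 := by
    intro h0
    apply he0
    rw [← h]
    linear_combination (z - z') * h0
  have hD : algebraMap ℚ F D = -(e ^ 2) / 27 := by rw [he]; simp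
  rw [fermatPt, isogeny_some_of_ne_zero _ _ (div_ne_zero hS three_ne_zero)]
  have he' : e = (z - z') * (z ^ 2 + z * z' + z' ^ 2) := by rw [← h]; ring
  apply some_congr
  · rw [hD, he']
    generalize hs : z ^ 2 + z * z' + z' ^ 2 = s at hS
    field_simp
    rw [← hs]; ring
  · have e3 : (z ^ 3 + z' ^ 3) = (z + z') * (z ^ 2 - z * z' + z' ^ 2) := by ring
    rw [hD, he', e3]
    generalize hs : z ^ 2 + z * z' + z' ^ 2 = s at hS
    field_simp
    rw [← hs]; ring

/-- Translation by `P_D` corresponds to the multiplication of `(z, z')` by `(w, w²)`, for a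
cube root of unity `w`. -/
theorem fermatPt_mul_root [DecidableEq F] {D : ℚ} {e d w z z' : F}
    (he : e ^ 2 = algebraMap ℚ F (-27 * D)) (he0 : e ≠ 0) (h : z ^ 3 - z' ^ 3 = e)
    (hd : d ^ 2 = algebraMap ℚ F D) (hd0 : d ≠ 0)
    (hw : w ^ 2 + w + 1 = 0) (hwd : 9 * d = (1 + 2 * w) * e)
    (h' : (w * z) ^ 3 - (w ^ 2 * z') ^ 3 = e) :
    fermatPt D he he0 (w * z) (w ^ 2 * z') h' = fermatPt D he he0 z z' h + zeroPt D d hd hd0 := by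
  have : CharZero F := algebraRat.charZero F
  have hd2 : d / 2 = (1 + 2 * w) * (z ^ 3 - z' ^ 3) / 18 := by
    rw [h]; linear_combination hwd / 18
  rw [eq_comm, ← sub_eq_zero, sub_eq_add_neg]
  unfold fermatPt zeroPt
  rw [neg_some_eq]
  -- The line through the given point, `P_D` and the negative of the translated point; its intercept
  -- is the ordinate `d/2` of `P_D`.
  refine add_add_eq_zero_of_line D _ _ _ (l := ((1 - w) * z + (1 - w ^ 2) * z') / 3)
    (m := d / 2) ?_ ?_ ?_ ?_ ?_
  · rw [hd2]; grind
  · ring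
  · rw [hd2]; grind
  · grind
  · rw [hd2]; grind

/-- The exponent `2N` makes `w^(2N)` the inverse of `w^N`, so the product `zz'`, which is the
abscissa of the image, is unchanged. -/
theorem fermatPt_mul_pow_root [DecidableEq F] {D : ℚ} {e d w z z' : F}
    (he : e ^ 2 = algebraMap ℚ F (-27 * D)) (he0 : e ≠ 0) (h : z ^ 3 - z' ^ 3 = e)
    (hd : d ^ 2 = algebraMap ℚ F D) (hd0 : d ≠ 0)
    (hw : w ^ 2 + w + 1 = 0) (hwd : 9 * d = (1 + 2 * w) * e) (N : ℕ)
    (h' : (w ^ N * z) ^ 3 - (w ^ (2 * N) * z') ^ 3 = e) :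
    fermatPt D he he0 (w ^ N * z) (w ^ (2 * N) * z') h' =
      fermatPt D he he0 z z' h + N • zeroPt D d hd hd0 := by
  have hw3 : w ^ 3 = 1 := by linear_combination (w - 1) * hw
  induction N with
  | zero => simp
  | succ N ih =>
    have h'' : (w ^ N * z) ^ 3 - (w ^ (2 * N) * z') ^ 3 = e := by
      rw [mul_pow, mul_pow, ← pow_mul, ← pow_mul, mul_comm N, mul_comm (2 * N), pow_mul w 3,
        pow_mul w 3, hw3, one_pow, one_pow, one_mul, one_mul, h]
    rw [succ_nsmul, ← add_assoc, ← ih h'']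
    have h3 : (w * (w ^ N * z)) ^ 3 - (w ^ 2 * (w ^ (2 * N) * z')) ^ 3 = e := by
      rw [← h']; ring
    rw [← fermatPt_mul_root he he0 h'' hd hd0 hw hwd h3]
    congr 1 <;> ring

/-- The point `P_D` is killed by `3`. -/
theorem three_nsmul_zeroPt [DecidableEq F] {D : ℚ} {d : F} (hd : d ^ 2 = algebraMap ℚ F D)
    (hd0 : d ≠ 0) : 3 • zeroPt D d hd hd0 = 0 := by
  have h := nonsingular_iff D (0 : F) (d / 2)
  have : ((curve D).baseChange F).toAffine.Nonsingular 0 (d / 2) := by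
    have : CharZero F := algebraRat.charZero F
    rw [h, ← hd]
    exact ⟨by ring, Or.inr (div_ne_zero hd0 two_ne_zero)⟩
  have := add_add_eq_zero_of_line D this this this (l := 0) (m := d / 2) (by ring) (by ring)
    (by ring) (by ring) (by ring)
  rw [succ_nsmul, two_nsmul]
  exact this

/-- The kernel of the isogeny. -/
theorem exists_nsmul_of_isogeny_eq_zero [DecidableEq F] {D : ℚ} {d : F}
    (hd : d ^ 2 = algebraMap ℚ F D) (hd0 : d ≠ 0) (Q : Pts D F) (hQ : isogeny D Q = 0) :
    ∃ m : ℕ, Q = m • zeroPt D d hd hd0 := by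
  have : CharZero F := algebraRat.charZero F
  rcases Q with _ | ⟨x, y, h⟩
  · exact ⟨0, by rw [zero_nsmul]; rfl⟩
  rw [isogeny_some_eq_zero_iff] at hQ
  subst hQ
  have n := ((nonsingular_iff D _ _).1 h).1
  have : (y - d / 2) * (y + d / 2) = 0 := by
    rw [← hd] at n
    linear_combination n
  rcases mul_eq_zero.1 this with h | h
  · refine ⟨1, ?_⟩
    rw [one_nsmul]
    exact some_congr _ _ _ rfl (sub_eq_zero.1 h)
  · refine ⟨2, ?_⟩
    have h3 := three_nsmul_zeroPt hd hd0
    rw [succ_nsmul] at h3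
    rw [eq_neg_of_add_eq_zero_left h3, zeroPt, neg_some_eq]
    exact some_congr _ _ _ rfl (eq_neg_of_add_eq_zero_left h)

end Fermat
end PureCubic

end

noncomputable section
open WeierstrassCurve NumberField IntermediateField
namespace PureCubic

/-! ### Galois action, descent of points, and removal of the coboundary from Kummer classes -/

section Galois

theorem exists_rat_of_fixed (z : Qbar) (hz : ∀ σ : GalQ, σ z = z) :
    ∃ r : ℚ, algebraMap ℚ Qbar r = z := by
  have : IsAlgClosure ℚ Qbar := by
    -- The instance is known for the algebra structure that comes with `AlgebraicClosure`; it
    -- transfers because `ℚ`-algebra structures are unique.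
    have h : @IsAlgClosure ℚ Qbar _ _ (AlgebraicClosure.instAlgebra ℚ) _ := inferInstance
    convert h
    exact Subsingleton.elim _ _
  have : IsGalois ℚ Qbar := IsAlgClosure.isGalois ℚ Qbar
  exact (InfiniteGalois.mem_range_algebraMap_iff_fixed z).2 hz

theorem galAct_zero {k : ℚ} (σ : GalQ) : galAct σ (0 : Pts k Qbar) = 0 := rfl

theorem galAct_add {k : ℚ} (σ : GalQ) (P Q : Pts k Qbar) :
    galAct σ (P + Q) = galAct σ P + galAct σ Q := map_add _ _ _

theorem galAct_nsmul {k : ℚ} (σ : GalQ) (N : ℕ) (P : Pts k Qbar) :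
    galAct σ (N • P) = N • galAct σ P := map_nsmul _ _ _

theorem nonsingular_galois {k : ℚ} (σ : GalQ) {x y : Qbar}
    (h : ((curve k).baseChange Qbar).toAffine.Nonsingular x y) :
    ((curve k).baseChange Qbar).toAffine.Nonsingular (σ x) (σ y) :=
  ((curve k).toAffine.baseChange_nonsingular
    (f := (σ : Qbar →ₐ[ℚ] Qbar)) σ.injective ..).mpr h

theorem galAct_some {k : ℚ} (σ : GalQ) {x y : Qbar}
    (h : ((curve k).baseChange Qbar).toAffine.Nonsingular x y) :
    galAct σ (.some x y h : Pts k Qbar) = .some (σ x) (σ y) (nonsingular_galois σ h) := rfl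

theorem nonsingular_algebraMap_iff {k : ℚ} {x y : ℚ} :
    ((curve k).baseChange Qbar).toAffine.Nonsingular
      (algebraMap ℚ Qbar x) (algebraMap ℚ Qbar y) ↔
      ((curve k).baseChange ℚ).toAffine.Nonsingular x y :=
  (curve k).toAffine.baseChange_nonsingular
    (f := Algebra.ofId ℚ Qbar) (algebraMap ℚ Qbar).injective ..

theorem baseChange_some {k : ℚ} {x y : ℚ}
    (h : ((curve k).baseChange ℚ).toAffine.Nonsingular x y) :
    Affine.Point.baseChange (W' := curve k) ℚ Qbar (.some x y h) =
      .some (algebraMap ℚ Qbar x) (algebraMap ℚ Qbar y) (nonsingular_algebraMap_iff.2 h) := rfl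

theorem isogeny_baseChange (D : ℚ) (Q : Pts D ℚ) :
    isogeny D (Affine.Point.baseChange (W' := curve D) ℚ Qbar Q) =
      Affine.Point.baseChange (W' := curve (-27 * D)) ℚ Qbar (isogeny D Q) := by
  rcases Q with _ | ⟨x, y, h⟩
  · rfl
  rw [baseChange_some]
  by_cases hx : x = 0
  · rw [isogeny_some_of_eq_zero _ _ hx, isogeny_some_of_eq_zero _ _ (by rw [hx, _root_.map_zero]),
      map_zero]
  · rw [isogeny_some_of_ne_zero _ _ hx, isogeny_some_of_ne_zero _ _
      (by rwa [_root_.map_ne_zero]), baseChange_some]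
    apply some_congr <;> simp

/-- Galois descent for points. -/
theorem exists_baseChange_of_fixed {k : ℚ} (Q : Pts k Qbar) (hQ : ∀ σ, galAct σ Q = Q) :
    ∃ Q₀ : Pts k ℚ, Affine.Point.baseChange (W' := curve k) ℚ Qbar Q₀ = Q := by
  rcases Q with _ | ⟨x, y, h⟩
  · exact ⟨0, rfl⟩
  · have hσ : ∀ σ : GalQ, σ x = x ∧ σ y = y := by
      intro σ
      have := hQ σ
      rw [galAct_some] at this
      injection this with h1 h2
      exact ⟨h1, h2⟩
    obtain ⟨a, rfl⟩ := exists_rat_of_fixed x fun σ => (hσ σ).1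
    obtain ⟨b, rfl⟩ := exists_rat_of_fixed y fun σ => (hσ σ).2
    exact ⟨.some a b (nonsingular_algebraMap_iff.1 h), rfl⟩

theorem galAct_fermatPt {D : ℚ} {e z z' : Qbar} (σ : GalQ)
    (he : e ^ 2 = algebraMap ℚ Qbar (-27 * D)) (he0 : e ≠ 0) (h : z ^ 3 - z' ^ 3 = e)
    (h' : (σ z) ^ 3 - (σ z') ^ 3 = e) :
    galAct σ (fermatPt D he he0 z z' h) = fermatPt D he he0 (σ z) (σ z') h' := by
  unfold fermatPt
  rw [galAct_some]
  apply some_congr <;> simp [map_ofNat σ]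

/-- A cochain represents the Kummer class of `P` iff it is `σ ↦ σ(Q) - Q` for some `Q` over `P`. -/
theorem representsKummerClass_iff (D : ℚ) (P : Pts (-27 * D) ℚ) (ξ : GalQ → Pts D Qbar) :
    RepresentsKummerClass D P ξ ↔ ∃ Q : Pts D Qbar,
      isogeny D Q = Affine.Point.baseChange (W' := curve (-27 * D)) ℚ Qbar P ∧
      ∀ σ : GalQ, ξ σ = galAct σ Q - Q := by
  constructor
  · rintro ⟨Q, hQ, T, hT, h⟩
    refine ⟨Q + T, by rw [isogeny_add_of_isogeny_eq_zero D T Q hT, hQ], fun σ => ?_⟩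
    rw [h, galAct_add]
    abel
  · rintro ⟨Q, hQ, h⟩
    refine ⟨Q, hQ, 0, rfl, fun σ => ?_⟩
    rw [h, galAct_zero, sub_zero, add_zero]

end Galois

/-! ### Powers with exponents in `ZMod 3`, and the logarithm on cube roots of unity -/

section Exponents

variable {K : Type*} [CommMonoid K]

theorem pow_val_natCast {u : K} (hu : u ^ 3 = 1) (a : ℕ) : u ^ ((a : ZMod 3)).val = u ^ a := by
  rw [ZMod.val_natCast]
  conv_rhs => rw [← Nat.mod_add_div a 3, pow_add, pow_mul, hu, one_pow, mul_one]

theorem pow_val_add {u : K} (hu : u ^ 3 = 1) (a b : ZMod 3) :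
    u ^ (a + b).val = u ^ a.val * u ^ b.val := by
  rw [← pow_add, ← pow_val_natCast hu (a.val + b.val), Nat.cast_add, ZMod.natCast_zmod_val,
    ZMod.natCast_zmod_val]

theorem pow_val_mul {u : K} (hu : u ^ 3 = 1) (a b : ZMod 3) :
    u ^ (a * b).val = (u ^ a.val) ^ b.val := by
  rw [← pow_mul, ← pow_val_natCast hu (a.val * b.val), Nat.cast_mul, ZMod.natCast_zmod_val,
    ZMod.natCast_zmod_val]

theorem pow_val_sum {u : K} (hu : u ^ 3 = 1) {ι : Type*} (s : Finset ι) (f : ι → ZMod 3) :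
    u ^ (∑ i ∈ s, f i).val = ∏ i ∈ s, u ^ (f i).val := by
  classical
  induction s using Finset.induction_on with
  | empty => simp
  | insert i s hi ih => rw [Finset.sum_insert hi, Finset.prod_insert hi, pow_val_add hu, ih]

theorem nsmul_val_add {G : Type*} [AddCommMonoid G] {T : G} (hT : 3 • T = 0) (a b : ZMod 3) :
    (a + b).val • T = a.val • T + b.val • T :=
  pow_val_add (K := Multiplicative G) (u := Multiplicative.ofAdd T) hT a b

end Exponents

section Log

variable {ζ : Qbar} (hζ : IsPrimitiveRoot ζ 3)
include hζ

theorem pow_logMu3 {u : Qbar} (hu : u ^ 3 = 1) : ζ ^ (logMu3 ζ u).val = u := by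
  obtain ⟨i, hi, rfl⟩ := hζ.eq_pow_of_pow_eq_one hu
  have h1 : ζ ≠ 1 := hζ.ne_one (by norm_num)
  have h2 : ζ ^ 2 ≠ 1 := fun h => by
    have := hζ.dvd_of_pow_eq_one 2 h
    omega
  unfold logMu3
  interval_cases i
  · simp
  · rw [if_neg (by simpa using h1), if_pos (pow_one ζ)]
    rfl
  · rw [if_neg h2, if_neg]
    · rfl
    · intro h
      apply h1
      have h0 := hζ.ne_zero (by norm_num)
      have : ζ * ζ = ζ * 1 := by rw [mul_one, ← sq, h]
      exact mul_left_cancel₀ h0 this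

theorem galois_eq_pow_kummerLog_mul {c : Qbar} {a : ℚ} (ha : a ≠ 0)
    (hc : c ^ 3 = algebraMap ℚ Qbar a) (σ : GalQ) :
    σ c = ζ ^ (kummerLog ζ c σ).val * c := by
  have hc3 : c ^ 3 ≠ 0 := by rw [hc]; exact (_root_.map_ne_zero _).2 ha
  have hc0 : c ≠ 0 := by
    rintro rfl
    simp at hc3
  have hu : (σ c / c) ^ 3 = 1 := by
    rw [div_pow, ← map_pow, hc, AlgEquiv.commutes, ← hc, div_self hc3]
  rw [kummerLog, pow_logMu3 hζ hu, div_mul_cancel₀ _ hc0]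

/-- The logarithms are taken to base `ζ`, whereas translation by `P_D` corresponds to `w`. Writing
`ζ = w^η` converts one base to the other at the cost of the factor `η` in the exponents. -/
theorem galois_prod_eq {ι : Type*} [Fintype ι] {c : ι → Qbar} {q : ι → ℚ} (hq : ∀ j, q j ≠ 0)
    (hc : ∀ j, c j ^ 3 = algebraMap ℚ Qbar (q j)) {w : Qbar} {η : ZMod 3} (hw : w ^ 3 = 1)
    (hwζ : ζ = w ^ η.val) (k : ι → ZMod 3) (σ : GalQ) :
    σ (∏ j, c j ^ (k j).val) =
      w ^ (∑ j, (η * k j) * kummerLog ζ (c j) σ).val * ∏ j, c j ^ (k j).val := by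
  rw [map_prod, pow_val_sum hw, ← Finset.prod_mul_distrib]
  refine Finset.prod_congr rfl fun j _ => ?_
  rw [map_pow, galois_eq_pow_kummerLog_mul hζ (hq j) (hc j), mul_pow]
  congr 1
  have : η * k j * kummerLog ζ (c j) σ = η * (kummerLog ζ (c j) σ * k j) := by ring
  rw [this, pow_val_mul hw, ← hwζ, pow_val_mul hζ.pow_eq_one]

end Log

end PureCubic

end

noncomputable section
open WeierstrassCurve NumberField IntermediateField
namespace PureCubic

/-! ### Kummer classes as cube classes of `Y + e/2`, and uniqueness of the coefficients -/

section Kummer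

theorem cochain_add {D : ℚ} {m : ℕ} {ζ : Qbar} {c : Fin m → Qbar} {T : Pts D Qbar}
    (hT : 3 • T = 0) (k l : Fin m → ZMod 3) (σ : GalQ) :
    cochain ζ c T (k + l) σ = cochain ζ c T k σ + cochain ζ c T l σ := by
  unfold cochain
  rw [← nsmul_val_add hT, ← Finset.sum_add_distrib]
  simp only [Pi.add_apply, add_mul]

theorem cochain_zero {D : ℚ} {m : ℕ} {ζ : Qbar} {c : Fin m → Qbar} {T : Pts D Qbar} (σ : GalQ) :
    cochain ζ c T 0 σ = 0 := by
  simp [cochain]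

variable {D : ℚ} {d : Qbar} {hd : d ^ 2 = algebraMap ℚ Qbar D} {hd0 : d ≠ 0} {m : ℕ}
  {c : Fin m → Qbar} {ζ : Qbar}

theorem represents_zero :
    RepresentsKummerClass D 0 (cochain ζ c (zeroPt D d hd hd0) 0) := by
  rw [representsKummerClass_iff]
  exact ⟨0, rfl, fun σ => by rw [cochain_zero, galAct_zero, sub_zero]⟩

theorem represents_add (hD : D ≠ 0) {P P' : Pts (-27 * D) ℚ} {k k' : Fin m → ZMod 3}
    (h : RepresentsKummerClass D P (cochain ζ c (zeroPt D d hd hd0) k))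
    (h' : RepresentsKummerClass D P' (cochain ζ c (zeroPt D d hd hd0) k')) :
    RepresentsKummerClass D (P + P') (cochain ζ c (zeroPt D d hd hd0) (k + k')) := by
  rw [representsKummerClass_iff] at *
  obtain ⟨Q, hQ, h⟩ := h
  obtain ⟨Q', hQ', h'⟩ := h'
  refine ⟨Q + Q', by rw [isogeny_add D hD, hQ, hQ', map_add], fun σ => ?_⟩
  rw [cochain_add (three_nsmul_zeroPt hd hd0), h, h', galAct_add]
  abel

theorem represents_neg {P : Pts (-27 * D) ℚ} {k : Fin m → ZMod 3}
    (h : RepresentsKummerClass D P (cochain ζ c (zeroPt D d hd hd0) k)) :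
    RepresentsKummerClass D (-P) (cochain ζ c (zeroPt D d hd hd0) (-k)) := by
  rw [representsKummerClass_iff] at *
  obtain ⟨Q, hQ, h⟩ := h
  refine ⟨-Q, by rw [isogeny_neg, hQ, map_neg], fun σ => ?_⟩
  have hn : galAct σ (-Q) = -galAct σ Q := map_neg _ _
  have := cochain_add (ζ := ζ) (c := c) (three_nsmul_zeroPt hd hd0) (-k) k σ
  rw [neg_add_cancel, cochain_zero] at this
  rw [eq_neg_of_add_eq_zero_left this.symm, h, hn]
  abel

/-- The cube root of unity attached to `P_D`, and its relation to `ζ`. -/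
theorem exists_root_of_unity (hζ : IsPrimitiveRoot ζ 3) (hd : d ^ 2 = algebraMap ℚ Qbar D)
    {e : ℚ} (he : e ^ 2 = -27 * D) (he0 : e ≠ 0) :
    ∃ (w : Qbar) (η : ZMod 3), w ^ 2 + w + 1 = 0 ∧
      9 * d = (1 + 2 * w) * algebraMap ℚ Qbar e ∧ ζ = w ^ η.val ∧ η * η = 1 := by
  have hE : algebraMap ℚ Qbar e ≠ 0 := (_root_.map_ne_zero _).2 he0
  have hE2 : (algebraMap ℚ Qbar e) ^ 2 = -27 * d ^ 2 := by
    rw [hd, ← map_pow, he, _root_.map_mul]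
    simp
  have hw : ((9 * d / algebraMap ℚ Qbar e - 1) / 2) ^ 2 +
      (9 * d / algebraMap ℚ Qbar e - 1) / 2 + 1 = 0 := by
    field_simp
    linear_combination 3 * hE2
  -- Obtained by solving `9d = (1 + 2w)e` for `w`; since `e² = -27d²`, the square of `1 + 2w` is
  -- `-3`.
  refine ⟨(9 * d / algebraMap ℚ Qbar e - 1) / 2, ?_⟩
  have h9 : 9 * d = (1 + 2 * ((9 * d / algebraMap ℚ Qbar e - 1) / 2)) * algebraMap ℚ Qbar e := by
    field_simp
    ring
  generalize (9 * d / algebraMap ℚ Qbar e - 1) / 2 = w at hw h9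
  have hz : ζ ^ 2 + ζ + 1 = 0 := by
    have h1 : ζ - 1 ≠ 0 := sub_ne_zero.2 (hζ.ne_one (by norm_num))
    have h3 := hζ.pow_eq_one
    apply mul_left_cancel₀ h1
    linear_combination h3
  -- There are only two primitive cube roots of unity, so `η` is `1` or `2 = -1`.
  have : (ζ - w) * (ζ - w ^ 2) = 0 := by
    linear_combination hz - (ζ - w + 1) * hw
  rcases mul_eq_zero.1 this with h | h
  · refine ⟨1, hw, h9, ?_, by decide⟩
    rw [show ZMod.val (1 : ZMod 3) = 1 from rfl, pow_one]
    exact sub_eq_zero.1 h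
  · exact ⟨2, hw, h9, sub_eq_zero.1 h, by decide⟩

variable {q : Fin m → ℕ} {w : Qbar} {η : ZMod 3} {e : ℚ}

/-- If `Y + e/2` is the product of a cube and of `∏ q_j ^ k_j`, then `η k` is the coefficient vector
of the Kummer class. -/
theorem represents_of_eq_cube_mul (hζ : IsPrimitiveRoot ζ 3)
    (he : e ^ 2 = -27 * D) (he0 : e ≠ 0) (hw : w ^ 2 + w + 1 = 0)
    (hwd : 9 * d = (1 + 2 * w) * algebraMap ℚ Qbar e) (hwζ : ζ = w ^ η.val)
    (hq : ∀ j, q j ≠ 0) (hc : ∀ j, c j ^ 3 = algebraMap ℚ Qbar (q j))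
    {X Y : ℚ} (h : ((curve (-27 * D)).baseChange ℚ).toAffine.Nonsingular X Y)
    (k : Fin m → ZMod 3) {r : ℚ} (hr : r ≠ 0)
    (hY : Y + e / 2 = r ^ 3 * ∏ j, (q j : ℚ) ^ (k j).val) :
    RepresentsKummerClass D (.some X Y h) (cochain ζ c (zeroPt D d hd hd0) fun j => η * k j) := by
  have hw3 : w ^ 3 = 1 := by linear_combination (w - 1) * hw
  have hw0 : w ≠ 0 := by
    rintro rfl
    simp at hw
  have heQ : (algebraMap ℚ Qbar e) ^ 2 = algebraMap ℚ Qbar (-27 * D) := by rw [← map_pow, he]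
  have heQ0 : algebraMap ℚ Qbar e ≠ 0 := (_root_.map_ne_zero _).2 he0
  have hXY := ((nonsingular_iff _ _ _).1 h).1
  have hXY' : X ^ 3 = (Y + e / 2) * (Y - e / 2) := by
    have h27 : algebraMap ℚ ℚ (-27 * D) = e ^ 2 := he.symm
    rw [h27] at hXY
    linear_combination -hXY
  have hY0 : Y + e / 2 ≠ 0 := by
    rw [hY]
    exact mul_ne_zero (pow_ne_zero _ hr) (Finset.prod_ne_zero_iff.2 fun j _ =>
      pow_ne_zero _ (Nat.cast_ne_zero.2 (hq j)))
  -- A cube root of `Y + e/2` built from the fixed cube roots `c j`, so that the Galois action on it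
  -- is given by the `kummerLog`s.
  obtain ⟨z, hz⟩ : ∃ z, z = algebraMap ℚ Qbar r * ∏ j, c j ^ (k j).val := ⟨_, rfl⟩
  have hz3 : z ^ 3 = algebraMap ℚ Qbar (Y + e / 2) := by
    rw [hY, hz, mul_pow, _root_.map_mul, map_pow, map_prod, ← Finset.prod_pow]
    congr 1
    refine Finset.prod_congr rfl fun j _ => ?_
    rw [map_pow, ← hc j, ← pow_mul, ← pow_mul, mul_comm]
  have hz0 : z ≠ 0 := by
    rintro rfl
    rw [zero_pow three_ne_zero, eq_comm, _root_.map_eq_zero] at hz3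
    exact hY0 hz3
  -- The condition `zz' = X` selects the right cube root of `Y - e/2`, and forces `σ` to scale `z'`
  -- by the inverse of the factor of `z`.
  obtain ⟨z', hz'⟩ : ∃ z', z' = algebraMap ℚ Qbar X / z := ⟨_, rfl⟩
  have hzz : z * z' = algebraMap ℚ Qbar X := by rw [hz']; field_simp
  have hz3' : z' ^ 3 = algebraMap ℚ Qbar (Y - e / 2) := by
    rw [hz', div_pow, hz3, ← map_pow, ← map_div₀, hXY', mul_div_cancel_left₀ _ hY0]
  have hzz' : z ^ 3 - z' ^ 3 = algebraMap ℚ Qbar e := by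
    rw [hz3, hz3', ← map_sub]
    congr 1
    ring
  rw [representsKummerClass_iff]
  refine ⟨fermatPt D heQ heQ0 z z' hzz', ?_, fun σ => ?_⟩
  · rw [isogeny_fermatPt, baseChange_some]
    apply some_congr _ _ _ hzz
    rw [hz3, hz3', ← _root_.map_add]
    have : algebraMap ℚ Qbar Y = algebraMap ℚ Qbar (2 * Y) / 2 := by simp
    rw [this]
    congr 2
    ring
  · have hq' : ∀ j, (q j : ℚ) ≠ 0 := fun j => Nat.cast_ne_zero.2 (hq j)
    have h1 := galois_prod_eq hζ hq' hc hw3 hwζ k σ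
    unfold cochain
    set N := (∑ j, (η * k j) * kummerLog ζ (c j) σ).val
    have hσz : σ z = w ^ N * z := by
      rw [hz, _root_.map_mul, h1, AlgEquiv.commutes]
      ring
    have hwN : w ^ N * w ^ (2 * N) = 1 := by
      rw [← pow_add, show N + 2 * N = 3 * N by ring, pow_mul, hw3, one_pow]
    have hσz' : σ z' = w ^ (2 * N) * z' := by
      rw [hz', map_div₀, AlgEquiv.commutes, hσz]
      have := pow_ne_zero N hw0
      field_simp
      rw [mul_assoc, hwN, mul_one]
    have h3 : (σ z) ^ 3 - (σ z') ^ 3 = algebraMap ℚ Qbar e := by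
      rw [← map_pow, ← map_pow, ← map_sub, hzz', AlgEquiv.commutes]
    rw [galAct_fermatPt σ heQ heQ0 hzz' h3, eq_sub_iff_add_eq', eq_comm]
    have h4 := h3
    rw [hσz, hσz'] at h4
    rw [← fermatPt_mul_pow_root heQ heQ0 hzz' hd hd0 hw hwd N h4]
    congr 1

/-- The valuation at `q i` equates `(k i).val`, which is less than 3, with a multiple of 3. -/
theorem exponents_eq_zero_of_cube (hq : ∀ j, (q j).Prime) (hqi : Function.Injective q)
    (k : Fin m → ZMod 3) (r : ℚ) (h : r ^ 3 = ∏ j, (q j : ℚ) ^ (k j).val) : k = 0 := by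
  funext i
  have : Fact (q i).Prime := ⟨hq i⟩
  have h1 := congrArg (padicValRat (q i)) h
  have hq0 : ∀ j, (q j : ℚ) ≠ 0 := fun j => Nat.cast_ne_zero.2 (hq j).ne_zero
  rw [padicValRat.pow, ← Finset.mul_prod_erase _ _ (Finset.mem_univ i), padicValRat.mul
    (pow_ne_zero _ (hq0 i)) (Finset.prod_ne_zero_iff.2 fun j _ => pow_ne_zero _ (hq0 j)),
    padicValRat.pow, padicValRat.self (hq i).one_lt] at h1
  have h2 : padicValRat (q i) (∏ j ∈ Finset.univ.erase i, (q j : ℚ) ^ (k j).val) = 0 := by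
    have e : (∏ j ∈ Finset.univ.erase i, (q j : ℚ) ^ (k j).val) =
        ((∏ j ∈ Finset.univ.erase i, q j ^ (k j).val : ℕ) : ℚ) := by push_cast; rfl
    rw [e, padicValRat.of_nat, Nat.cast_eq_zero]
    apply padicValNat.eq_zero_of_not_dvd
    rw [Prime.dvd_finsetProd_iff (hq i).prime]
    rintro ⟨j, hj, hd⟩
    have := (Nat.prime_dvd_prime_iff_eq (hq i) (hq j)).1 ((hq i).dvd_of_dvd_pow hd)
    exact (Finset.mem_erase.1 hj).1 (hqi this.symm)
  rw [h2] at h1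
  have hlt := ZMod.val_lt (k i)
  have : (k i).val = 0 := by omega
  exact (ZMod.val_eq_zero _).1 this

theorem addOrderOf_zeroPt : addOrderOf (zeroPt D d hd hd0) = 3 := by
  have : Fact (Nat.Prime 3) := ⟨Nat.prime_three⟩
  exact addOrderOf_eq_prime (three_nsmul_zeroPt hd hd0) (Affine.Point.some_ne_zero _)

theorem galAct_zeroPt (σ : GalQ) : galAct σ (zeroPt D d hd hd0) =
    zeroPt D (σ d) (by rw [← map_pow, hd, AlgEquiv.commutes])
      ((_root_.map_ne_zero σ).2 hd0) := by
  unfold zeroPt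
  rw [galAct_some]
  exact some_congr _ _ _ (_root_.map_zero σ) (by simp [map_ofNat σ])

/-- The cocycles are not coboundaries. -/
theorem eq_zero_of_represents_zero (hζ : IsPrimitiveRoot ζ 3)
    (he0 : e ≠ 0) (hw : w ^ 2 + w + 1 = 0)
    (hwd : 9 * d = (1 + 2 * w) * algebraMap ℚ Qbar e) (hwζ : ζ = w ^ η.val) (hη : η * η = 1)
    (hq : ∀ j, (q j).Prime) (hqi : Function.Injective q)
    (hc : ∀ j, c j ^ 3 = algebraMap ℚ Qbar (q j)) (k : Fin m → ZMod 3)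
    (h : RepresentsKummerClass D 0 (cochain ζ c (zeroPt D d hd hd0) k)) : k = 0 := by
  have hw3 : w ^ 3 = 1 := by linear_combination (w - 1) * hw
  have hw0 : w ≠ 0 := by
    rintro rfl
    simp at hw
  rw [representsKummerClass_iff] at h
  obtain ⟨Q, hQ, h⟩ := h
  rw [map_zero] at hQ
  obtain ⟨a, rfl⟩ := exists_nsmul_of_isogeny_eq_zero hd hd0 Q hQ
  have hq' : ∀ j, (q j : ℚ) ≠ 0 := fun j => Nat.cast_ne_zero.2 (hq j).ne_zero
  -- Since `Q = a • P_D`, the cochain is a coboundary. Its multiplicative counterpart is that `σ`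
  -- multiplies the product of cube roots by `σ(w^a)/w^a`; dividing by `w^a` leaves a rational
  -- number, whose cube is the product of prime powers.
  have hfix : ∀ σ : GalQ, σ ((∏ j, c j ^ (η * k j).val) / w ^ a) =
      (∏ j, c j ^ (η * k j).val) / w ^ a := by
    intro σ
    have h1 := galois_prod_eq hζ hq' hc hw3 hwζ (fun j => η * k j) σ
    simp only [← mul_assoc, hη, one_mul] at h1
    have h2 := h σ
    unfold cochain at h2
    set N := (∑ j, k j * kummerLog ζ (c j) σ).val
    rw [map_div₀, h1, map_pow]
    have hpow : ∀ M : ℕ, N • zeroPt D d hd hd0 = M • zeroPt D d hd hd0 → w ^ N = w ^ M := by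
      intro M hM
      rw [nsmul_eq_nsmul_iff_modEq, addOrderOf_zeroPt] at hM
      rw [← Nat.mod_add_div N 3, ← Nat.mod_add_div M 3, pow_add, pow_add, pow_mul, pow_mul w 3,
        hw3, one_pow, one_pow, hM]
    have hwd' := congrArg σ hwd
    simp only [_root_.map_mul, _root_.map_add, map_ofNat, map_one, AlgEquiv.commutes] at hwd'
    have hE : algebraMap ℚ Qbar e ≠ 0 := (_root_.map_ne_zero _).2 he0
    rw [galAct_nsmul] at h2
    have hσd : (σ d - d) * (σ d + d) = 0 := by
      have := congrArg σ hd
      rw [AlgEquiv.commutes, map_pow] at this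
      linear_combination this - hd
    rcases mul_eq_zero.1 hσd with hσ | hσ
    -- If `σ` fixes `√D`, it fixes both `w` and `P_D`, and the coboundary vanishes at `σ`.
    · have hσ' : σ d = d := sub_eq_zero.1 hσ
      have hσw : σ w = w := by
        have : (2 * algebraMap ℚ Qbar e) * (σ w - w) = 0 := by
          linear_combination hwd - hwd' + 9 * hσ'
        exact sub_eq_zero.1 ((mul_eq_zero.1 this).resolve_left (mul_ne_zero two_ne_zero hE))
      have hT : galAct σ (zeroPt D d hd hd0) = zeroPt D d hd hd0 := by
        rw [galAct_zeroPt]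
        exact some_congr _ _ _ rfl (by rw [hσ'])
      rw [hT, sub_self, ← zero_nsmul (zeroPt D d hd hd0)] at h2
      rw [hpow 0 h2, hσw, pow_zero, one_mul]
    -- Otherwise `σ` inverts `w` and negates `P_D`, so the coboundary at `σ` is `2a • P_D - a • P_D
    -- = a • P_D`.
    · have hσ' : σ d = -d := eq_neg_of_add_eq_zero_left hσ
      have hσw : σ w = w ^ 2 := by
        have : (2 * algebraMap ℚ Qbar e) * (σ w - w ^ 2) = 0 := by
          linear_combination - hwd - hwd' + 9 * hσ' - 2 * algebraMap ℚ Qbar e * hw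
        exact sub_eq_zero.1 ((mul_eq_zero.1 this).resolve_left (mul_ne_zero two_ne_zero hE))
      have hT : galAct σ (zeroPt D d hd hd0) = 2 • zeroPt D d hd hd0 := by
        have h3 := three_nsmul_zeroPt hd hd0
        rw [succ_nsmul] at h3
        rw [galAct_zeroPt, eq_neg_of_add_eq_zero_left h3]
        unfold zeroPt
        rw [neg_some_eq]
        exact some_congr _ _ _ rfl (by rw [hσ', neg_div])
      rw [hT, two_nsmul, nsmul_add, add_sub_cancel_right] at h2
      rw [hpow a h2, hσw, ← pow_mul, two_mul, pow_add, mul_div_mul_left _ _ (pow_ne_zero _ hw0)]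
  obtain ⟨r, hr⟩ := exists_rat_of_fixed _ hfix
  have hr3 : r ^ 3 = ∏ j, (q j : ℚ) ^ (η * k j).val := by
    apply (algebraMap ℚ Qbar).injective
    rw [map_pow, hr, div_pow, ← pow_mul, mul_comm a, pow_mul, hw3, one_pow, div_one, map_prod,
      ← Finset.prod_pow]
    refine Finset.prod_congr rfl fun j _ => ?_
    rw [map_pow, ← hc j, ← pow_mul, ← pow_mul, mul_comm]
  have := exponents_eq_zero_of_cube hq hqi _ r hr3
  funext j
  have hj := congrFun this j
  simp only [Pi.zero_apply] at hj
  calc k j = η * (η * k j) := by rw [← mul_assoc, hη, one_mul]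
    _ = 0 := by rw [hj, mul_zero]

end Kummer
end PureCubic

end

noncomputable section
open WeierstrassCurve NumberField IntermediateField
namespace PureCubic

/-! ### Rational numbers modulo cubes -/

section Cubes

theorem nat_exists_pow_three_eq {n : ℕ} (hn : n ≠ 0) (h : ∀ l : ℕ, l.Prime → 3 ∣ n.factorization l) :
    ∃ r : ℕ, r ^ 3 = n := by
  refine ⟨n.factorization.prod fun l a => l ^ (a / 3), ?_⟩
  conv_rhs => rw [← Nat.prod_factorization_pow_eq_self hn]
  rw [Finsupp.prod, Finsupp.prod, ← Finset.prod_pow]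
  refine Finset.prod_congr rfl fun l hl => ?_
  rw [← pow_mul, Nat.div_mul_cancel (h l (Nat.prime_of_mem_primeFactors (by simpa using hl)))]

theorem rat_exists_pow_three_eq {a : ℚ} (ha : a ≠ 0)
    (h : ∀ l : ℕ, l.Prime → (3 : ℤ) ∣ padicValRat l a) : ∃ r : ℚ, r ^ 3 = a := by
  have hd : (a.den : ℚ) ≠ 0 := Nat.cast_ne_zero.2 a.den_ne_zero
  have hnum : a.num ≠ 0 := Rat.num_ne_zero.2 ha
  have hN : a.num.natAbs * a.den ^ 2 ≠ 0 :=
    mul_ne_zero (Int.natAbs_ne_zero.2 hnum) (pow_ne_zero _ a.den_ne_zero)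
  -- Multiplying by the cube of the denominator reduces the claim to integers; the sign is harmless
  -- because `-1` is a cube.
  have hcube : ((a.num * (a.den : ℤ) ^ 2 : ℤ) : ℚ) = a * (a.den : ℚ) ^ 3 := by
    push_cast
    linear_combination -(a.den : ℚ) ^ 2 * Rat.mul_den_eq_num a
  obtain ⟨r, hr⟩ := nat_exists_pow_three_eq hN (by
    intro l hl
    have : Fact l.Prime := ⟨hl⟩
    have h1 := congrArg (padicValRat l) hcube
    rw [padicValRat.mul ha (pow_ne_zero _ hd), padicValRat.pow, padicValRat.of_int] at h1
    have h2 : padicValInt l (a.num * (a.den : ℤ) ^ 2) =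
        (a.num.natAbs * a.den ^ 2).factorization l := by
      rw [padicValInt, Int.natAbs_mul, Int.natAbs_pow, Int.natAbs_natCast,
        Nat.factorization_def _ hl]
    rw [h2] at h1
    have := h l hl
    omega)
  have hr' : ((r : ℚ)) ^ 3 = |a * (a.den : ℚ) ^ 3| := by
    rw [← hcube, ← Nat.cast_pow, hr]
    have : a.num.natAbs * a.den ^ 2 = (a.num * (a.den : ℤ) ^ 2).natAbs := by
      rw [Int.natAbs_mul, Int.natAbs_pow, Int.natAbs_natCast]
    rw [this, Nat.cast_natAbs, Int.cast_abs]
  rcases abs_choice (a * (a.den : ℚ) ^ 3) with h | h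
  · refine ⟨r / a.den, ?_⟩
    rw [div_pow, hr', h]
    field_simp
  · refine ⟨-r / a.den, ?_⟩
    rw [div_pow, neg_pow, hr', h]
    field_simp

/-- A rational number is a cube times a product of powers of the primes at which its valuation is
not divisible by `3`. -/
theorem rat_exists_eq_cube_mul_prod {m : ℕ} {q : Fin m → ℕ} (hq : ∀ j, (q j).Prime)
    (hqi : Function.Injective q) {a : ℚ} (ha : a ≠ 0)
    (h : ∀ l : ℕ, l.Prime → (∀ j, q j ≠ l) → (3 : ℤ) ∣ padicValRat l a) :
    ∃ (k : Fin m → ZMod 3) (r : ℚ), r ≠ 0 ∧ a = r ^ 3 * ∏ j, (q j : ℚ) ^ (k j).val := by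
  obtain ⟨k, hk⟩ : ∃ k : Fin m → ZMod 3, ∀ j, k j = (padicValRat (q j) a : ZMod 3) :=
    ⟨_, fun j => rfl⟩
  have hq0 : ∀ j, (q j : ℚ) ≠ 0 := fun j => Nat.cast_ne_zero.2 (hq j).ne_zero
  have hprod0 : ∏ j, (q j : ℚ) ^ (k j).val ≠ 0 :=
    Finset.prod_ne_zero_iff.2 fun j _ => pow_ne_zero _ (hq0 j)
  have hval : ∀ l : ℕ, l.Prime → ∀ s : Finset (Fin m),
      padicValRat l (∏ j ∈ s, (q j : ℚ) ^ (k j).val) =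
        ∑ j ∈ s, if q j = l then ((k j).val : ℤ) else 0 := by
    intro l hl s
    have : Fact l.Prime := ⟨hl⟩
    induction s using Finset.induction_on with
    | empty => simp
    | insert i s hi ih =>
      rw [Finset.prod_insert hi, Finset.sum_insert hi, padicValRat.mul (pow_ne_zero _ (hq0 i))
        (Finset.prod_ne_zero_iff.2 fun j _ => pow_ne_zero _ (hq0 j)), ih, padicValRat.pow]
      congr 1
      split_ifs with h
      · rw [h, padicValRat.self hl.one_lt, mul_one]
      · rw [padicValRat.of_nat, padicValNat.eq_zero_of_not_dvd, Nat.cast_zero, mul_zero]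
        rw [Nat.prime_dvd_prime_iff_eq hl (hq i)]
        exact fun h' => h h'.symm
  obtain ⟨r, hr⟩ := rat_exists_pow_three_eq (div_ne_zero ha hprod0) (by
    intro l hl
    have : Fact l.Prime := ⟨hl⟩
    rw [padicValRat.div ha hprod0, hval l hl]
    by_cases hex : ∃ j, q j = l
    · obtain ⟨i, rfl⟩ := hex
      rw [Finset.sum_eq_single i (fun j _ hj => if_neg fun h => hj (hqi h)) (by simp), if_pos rfl]
      have := (ZMod.intCast_eq_intCast_iff_dvd_sub ((k i).val : ℤ) (padicValRat (q i) a) 3).1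
        (by simp [hk])
      exact_mod_cast this
    · push Not at hex
      rw [Finset.sum_eq_zero fun j _ => if_neg (hex j), sub_zero]
      exact h l hl hex)
  refine ⟨k, r, ?_, ?_⟩
  · rintro rfl
    rw [zero_pow three_ne_zero, eq_comm, div_eq_zero_iff] at hr
    exact hr.elim ha hprod0
  · rw [hr, div_mul_cancel₀ _ hprod0]

end Cubes

/-! ### The homomorphism of coefficient vectors and its kernel -/

section Kummer

variable {D : ℚ} {d : Qbar} {hd : d ^ 2 = algebraMap ℚ Qbar D} {hd0 : d ≠ 0} {m : ℕ}
  {c : Fin m → Qbar} {ζ : Qbar} {q : Fin m → ℕ} {w : Qbar} {η : ZMod 3} {e : ℚ}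

/-- Compare `v(B)` with `v(e) = 0`. If `v(B) < 0` then `v(A) = v(B)`, so `2v(A)` is divisible by 3;
if `v(B) = 0` then `v(A) = 3v(X)`; if `v(B) > 0` then `v(A) = 0`. -/
theorem three_dvd_padicValRat {A B X : ℚ} (hA : A ≠ 0) (hAB : A * B = X ^ 3) (hs : A = B + e)
    (l : ℕ) (hl : l.Prime) (he0 : e ≠ 0) (he : padicValRat l e = 0) :
    (3 : ℤ) ∣ padicValRat l A := by
  have : Fact l.Prime := ⟨hl⟩
  by_cases hB : B = 0
  · rw [hs, hB, zero_add, he]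
    exact dvd_zero _
  have hX : X ≠ 0 := by
    rintro rfl
    rw [zero_pow three_ne_zero] at hAB
    exact (mul_ne_zero hA hB) hAB
  have h1 := congrArg (padicValRat l) hAB
  rw [padicValRat.mul hA hB, padicValRat.pow] at h1
  have hBe : B + e ≠ 0 := hs ▸ hA
  rcases lt_trichotomy (padicValRat l B) 0 with h | h | h
  · have := padicValRat.add_eq_of_lt hBe hB he0 (by rw [he]; exact h)
    rw [← hs] at this
    omega
  · omega
  · have := padicValRat.add_eq_of_lt (p := l) (q := e) (r := B) (by rwa [add_comm]) he0 hB
      (by rw [he]; exact h)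
    rw [add_comm, ← hs] at this
    omega

/-- Every rational point has a coefficient vector. -/
theorem exists_eq_cube_mul (he : e ^ 2 = -27 * D) (he0 : e ≠ 0)
    (hq : ∀ j, (q j).Prime) (hqi : Function.Injective q)
    (hqe : ∀ l : ℕ, l.Prime → (∀ j, q j ≠ l) → padicValRat l e = 0)
    {X Y : ℚ} (h : ((curve (-27 * D)).baseChange ℚ).toAffine.Nonsingular X Y)
    (hY : Y + e / 2 ≠ 0) :
    ∃ (k : Fin m → ZMod 3) (r : ℚ), r ≠ 0 ∧ Y + e / 2 = r ^ 3 * ∏ j, (q j : ℚ) ^ (k j).val := by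
  have hXY := ((nonsingular_iff _ _ _).1 h).1
  have hXY' : (Y + e / 2) * (Y - e / 2) = X ^ 3 := by
    have h27 : algebraMap ℚ ℚ (-27 * D) = e ^ 2 := he.symm
    rw [h27] at hXY
    linear_combination hXY
  exact rat_exists_eq_cube_mul_prod hq hqi hY fun l hl hlq =>
    three_dvd_padicValRat hY hXY' (by ring) l hl he0 (hqe l hl hlq)

/-- The coefficient vectors of the Kummer classes form a homomorphism with kernel
`φ_D(E^D(ℚ))`. -/
theorem exists_kummerHom (hζ : IsPrimitiveRoot ζ 3) (hD : D ≠ 0)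
    (he : e ^ 2 = -27 * D) (he0 : e ≠ 0) (hw : w ^ 2 + w + 1 = 0)
    (hwd : 9 * d = (1 + 2 * w) * algebraMap ℚ Qbar e) (hwζ : ζ = w ^ η.val) (hη : η * η = 1)
    (hq : ∀ j, (q j).Prime) (hqi : Function.Injective q)
    (hc : ∀ j, c j ^ 3 = algebraMap ℚ Qbar (q j))
    (hqe : ∀ l : ℕ, l.Prime → (∀ j, q j ≠ l) → padicValRat l e = 0) :
    ∃ Λ : Pts (-27 * D) ℚ →+ (Fin m → ZMod 3),
      (∀ P lam, RepresentsKummerClass D P (cochain ζ c (zeroPt D d hd hd0) lam) ↔ lam = Λ P) ∧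
      (∀ P, Λ P = 0 ↔ ∃ Q : Pts D ℚ, isogeny D Q = P) ∧
      (∀ X Y h (k : Fin m → ZMod 3) (r : ℚ), r ≠ 0 →
        Y + e / 2 = r ^ 3 * ∏ j, (q j : ℚ) ^ (k j).val →
        Λ (.some X Y h) = fun j => η * k j) := by
  have hrep := @represents_of_eq_cube_mul D d hd hd0 m c ζ q w η e hζ he he0 hw hwd hwζ
    (fun j => (hq j).ne_zero) hc
  have hex : ∀ P : Pts (-27 * D) ℚ, ∃ lam,
      RepresentsKummerClass D P (cochain ζ c (zeroPt D d hd hd0) lam) := by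
    rintro (_ | ⟨X, Y, h⟩)
    · exact ⟨0, represents_zero⟩
    -- At this one point `Y + e/2` is not a usable cube class; the class of the negative point,
    -- where the value is `e`, is negated instead.
    by_cases hY : Y + e / 2 = 0
    · have h' := (nonsingular_neg_iff _ _ _).2 h
      have hY' : -Y + e / 2 ≠ 0 := by
        intro h0
        apply he0
        linear_combination hY + h0
      obtain ⟨k, r, hr, hk⟩ := exists_eq_cube_mul he he0 hq hqi hqe h' hY'
      have := represents_neg (hrep h' k hr hk)
      rw [neg_some_eq] at this
      simp only [neg_neg] at this
      exact ⟨_, this⟩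
    · obtain ⟨k, r, hr, hk⟩ := exists_eq_cube_mul he he0 hq hqi hqe h hY
      exact ⟨_, hrep h k hr hk⟩
  have huniq : ∀ (P : Pts (-27 * D) ℚ) (k k' : Fin m → ZMod 3),
      RepresentsKummerClass D P (cochain ζ c (zeroPt D d hd hd0) k) →
      RepresentsKummerClass D P (cochain ζ c (zeroPt D d hd hd0) k') → k = k' := by
    intro P k k' h h'
    have := represents_add hD h (represents_neg h')
    rw [add_neg_cancel] at this
    have := eq_zero_of_represents_zero hζ he0 hw hwd hwζ hη hq hqi hc _ this
    rwa [← sub_eq_add_neg, sub_eq_zero] at this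
  choose Λ hΛ using hex
  have hiff : ∀ P lam,
      RepresentsKummerClass D P (cochain ζ c (zeroPt D d hd hd0) lam) ↔ lam = Λ P := fun P lam =>
    ⟨fun h => huniq P _ _ h (hΛ P), fun h => h ▸ hΛ P⟩
  refine ⟨⟨⟨Λ, ((hiff 0 0).1 represents_zero).symm⟩, fun P P' =>
    ((hiff _ _).1 (represents_add hD (hΛ P) (hΛ P'))).symm⟩, hiff, fun P => ?_, ?_⟩
  · change Λ P = 0 ↔ _
    rw [eq_comm, ← hiff, representsKummerClass_iff]
    constructor
    · rintro ⟨Q, hQ, hσ⟩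
      -- A zero cocycle means that the chosen preimage is fixed by Galois, hence rational.
      obtain ⟨Q₀, rfl⟩ := exists_baseChange_of_fixed Q fun σ => by
        have := hσ σ
        rw [cochain_zero] at this
        exact (sub_eq_zero.1 this.symm)
      rw [isogeny_baseChange] at hQ
      exact ⟨Q₀, Affine.Point.map_injective _ hQ⟩
    · rintro ⟨Q, rfl⟩
      refine ⟨Affine.Point.baseChange (W' := curve D) ℚ Qbar Q, isogeny_baseChange D Q,
        fun σ => ?_⟩
      rw [cochain_zero, eq_comm, sub_eq_zero]
      exact Affine.Point.map_baseChange _ Q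
  · intro X Y h k r hr hk
    exact ((hiff _ _).1 (hrep h k hr hk)).symm

/-- The isogeny as a homomorphism. -/
def isogenyHom (hD : D ≠ 0) : Pts D ℚ →+ Pts (-27 * D) ℚ where
  toFun := isogeny D
  map_zero' := isogeny_zero D
  map_add' := isogeny_add D hD

/-- The first isomorphism theorem; the quotient is killed by 3 because it embeds in an `𝔽₃`-space,
and this supplies its module structure. -/
theorem exists_zmodModule_linearEquiv {G H W : Type*} [AddCommGroup G] [AddCommGroup H]
    [AddCommGroup W] [Module (ZMod 3) W] (φ : H →+ G) (Λ : G →+ W)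
    (hker : Λ.ker = φ.range) (V : Submodule (ZMod 3) W) (hV : ∀ v, v ∈ V ↔ ∃ g, Λ g = v) :
    ∃ _ : Module (ZMod 3) (G ⧸ φ.range), Nonempty ((G ⧸ φ.range) ≃ₗ[ZMod 3] V) := by
  let f : (G ⧸ φ.range) →+ V := QuotientAddGroup.lift φ.range
    (Λ.codRestrict V fun g => (hV _).2 ⟨g, rfl⟩) (by
      intro g hg
      rw [← hker, AddMonoidHom.mem_ker] at hg
      exact Subtype.ext hg)
  have hinj : Function.Injective f := by
    rw [injective_iff_map_eq_zero]
    intro x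
    induction x using QuotientAddGroup.induction_on with
    | H g =>
      intro hg
      rw [QuotientAddGroup.eq_zero_iff, ← hker, AddMonoidHom.mem_ker]
      exact congrArg Subtype.val hg
  have hsurj : Function.Surjective f := by
    rintro ⟨v, hv⟩
    obtain ⟨g, rfl⟩ := (hV v).1 hv
    exact ⟨QuotientAddGroup.mk g, rfl⟩
  have h3 : ∀ x : G ⧸ φ.range, 3 • x = 0 := by
    intro x
    apply hinj
    rw [map_nsmul, map_zero]
    exact ZModModule.char_nsmul_eq_zero 3 _
  letI := AddCommGroup.zmodModule h3
  exact ⟨this, ⟨LinearEquiv.ofBijective (f.toZModLinearMap 3) ⟨hinj, hsurj⟩⟩⟩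

end Kummer
end PureCubic

end

noncomputable section
open NumberField IntermediateField
namespace PureCubic

/-! ### Bases `1, ∛(ab²), ∛(a²b)` of pure cubic fields: trace, norm, discriminant -/

section Cubic

variable {L : Type} [Field L] [NumberField L]

theorem leftMulMatrix_eq {B : Module.Basis (Fin 3) ℚ L} {α : L} {M : Matrix (Fin 3) (Fin 3) ℚ}
    (h : ∀ j, α * B j = ∑ i, M i j • B i) : Algebra.leftMulMatrix B α = M := by
  ext i j
  rw [Algebra.leftMulMatrix_eq_repr_mul, h, Module.Basis.repr_sum_self]

/-- In a cubic field, `1, θ, θ²` is a basis for every irrational `θ`. -/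
theorem exists_basis_pow (h3 : Module.finrank ℚ L = 3) {θ : L}
    (hθ : ∀ r : ℚ, θ ≠ r) : ∃ B : Module.Basis (Fin 3) ℚ L, ∀ i, B i = θ ^ (i : ℕ) := by
  have hdeg : (minpoly ℚ θ).natDegree = 3 := by
    have hint : IsIntegral ℚ θ := .of_finite ℚ θ
    have hdvd : (minpoly ℚ θ).natDegree ∣ 3 := h3 ▸ minpoly.degree_dvd hint
    rcases (Nat.dvd_prime Nat.prime_three).1 hdvd with h | h
    · exfalso
      obtain ⟨r, hr⟩ := minpoly.natDegree_eq_one_iff.1 h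
      exact hθ r (by rw [← hr, eq_ratCast])
    · exact h
  have hli : LinearIndependent ℚ fun i : Fin 3 => θ ^ (i : ℕ) := by
    have := linearIndependent_pow (K := ℚ) θ
    rw [hdeg] at this
    exact this
  exact ⟨basisOfLinearIndependentOfCardEqFinrank hli (by simp [h3]), fun i => by simp⟩

/-- The comparison of the discriminants of two bases. -/
theorem discr_basis_eq (B : Module.Basis (Fin 3) ℚ L) (v : Fin 3 → L) :
    Algebra.discr ℚ v = (B.det v) ^ 2 * Algebra.discr ℚ B := by
  rw [Module.Basis.det_apply, ← Algebra.discr_of_matrix_vecMul]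
  congr 1
  funext j
  conv_lhs => rw [← B.sum_toMatrix_smul_self v j]
  simp [Matrix.vecMul, dotProduct, Algebra.smul_def, mul_comm]

theorem discr_localization (b : Module.Basis (Fin 3) ℤ (𝓞 L)) :
    Algebra.discr ℚ (b.localizationLocalization ℚ (nonZeroDivisors ℤ) L) =
      (NumberField.discr L : ℚ) := by
  rw [Algebra.discr_localizationLocalization, NumberField.discr_eq_discr]
  simp

theorem exists_int_trace {α : L} (h : IsIntegral ℤ α) : ∃ t : ℤ, Algebra.trace ℚ L α = t := by
  obtain ⟨t, ht⟩ := IsIntegrallyClosed.isIntegral_iff.1 (Algebra.isIntegral_trace (L := ℚ) h)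
  exact ⟨t, by rw [← ht]; simp⟩

theorem exists_int_norm {α : L} (h : IsIntegral ℤ α) : ∃ t : ℤ, Algebra.norm ℚ α = t := by
  obtain ⟨t, ht⟩ := IsIntegrallyClosed.isIntegral_iff.1 (Algebra.isIntegral_norm ℚ h)
  exact ⟨t, by rw [← ht]; simp⟩

/-- A basis of the form `1, ∛(ab²), ∛(a²b)`. -/
structure IsPureBasis (a b : ℕ) (B : Module.Basis (Fin 3) ℚ L) : Prop where
  zero : B 0 = 1
  sq_one : B 1 ^ 2 = b * B 2
  sq_two : B 2 ^ 2 = a * B 1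
  one_mul_two : B 1 * B 2 = a * b

theorem exists_isPureBasis (h3 : Module.finrank ℚ L = 3) {a b : ℕ} (hb : b ≠ 0) {θ : L}
    (hθ : ∀ r : ℚ, θ ≠ r) (h : θ ^ 3 = a * b ^ 2) :
    ∃ B : Module.Basis (Fin 3) ℚ L, IsPureBasis a b B ∧ B 1 = θ := by
  obtain ⟨B, hB⟩ := exists_basis_pow h3 hθ
  have hb' : (b : ℚ) ≠ 0 := Nat.cast_ne_zero.2 hb
  have hbL : (b : L) ≠ 0 := Nat.cast_ne_zero.2 hb
  -- If `θ = ∛(ab²)`, then `θ²/b` is `∛(a²b)`.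
  let u : Fin 3 → ℚˣ := ![1, 1, (Units.mk0 (b : ℚ) hb')⁻¹]
  have e0 : B.unitsSMul u 0 = 1 := by rw [Module.Basis.unitsSMul_apply]; simp [u, hB]
  have e1 : B.unitsSMul u 1 = θ := by rw [Module.Basis.unitsSMul_apply]; simp [u, hB]
  have e2 : B.unitsSMul u 2 = θ ^ 2 / b := by
    rw [Module.Basis.unitsSMul_apply]
    simp [u, hB, Units.smul_def, Rat.smul_def]
    field_simp
  refine ⟨B.unitsSMul u, ⟨e0, ?_, ?_, ?_⟩, e1⟩
  · rw [e1, e2]; field_simp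
  · rw [e1, e2]; field_simp; linear_combination θ * h
  · rw [e1, e2]; field_simp; linear_combination h

theorem Module.Basis.eq_sum_three (B : Module.Basis (Fin 3) ℚ L) (α : L) :
    α = B.repr α 0 • B 0 + B.repr α 1 • B 1 + B.repr α 2 • B 2 := by
  conv_lhs => rw [← B.sum_repr α, Fin.sum_univ_three]

theorem repr_three (B : Module.Basis (Fin 3) ℚ L) (x y z : ℚ) (i : Fin 3) :
    B.repr (x • B 0 + y • B 1 + z • B 2) i = ![x, y, z] i := by
  have : x • B 0 + y • B 1 + z • B 2 = ∑ i, ![x, y, z] i • B i := by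
    rw [Fin.sum_univ_three]; rfl
  rw [this, Module.Basis.repr_sum_self]

variable {a b : ℕ} {B : Module.Basis (Fin 3) ℚ L} (hB : IsPureBasis a b B)
include hB

theorem IsPureBasis.coe_smul (x y z : ℚ) :
    x • B 0 + y • B 1 + z • B 2 = x + y * B 1 + z * B 2 := by
  rw [Rat.smul_def, Rat.smul_def, Rat.smul_def, hB.zero, mul_one]

theorem IsPureBasis.leftMulMatrix (x y z : ℚ) :
    Algebra.leftMulMatrix B (x • B 0 + y • B 1 + z • B 2) =
      !![x, a * b * z, a * b * y; y, x, a * z; z, b * y, x] := by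
  apply leftMulMatrix_eq
  intro j
  rw [hB.coe_smul, Fin.sum_univ_three]
  have h1 := hB.sq_one
  have h2 := hB.sq_two
  have h3 := hB.one_mul_two
  fin_cases j <;> simp [Rat.smul_def, hB.zero]
  · linear_combination (y : L) * h1 + z * h3
  · linear_combination (y : L) * h3 + z * h2

theorem IsPureBasis.trace (x y z : ℚ) :
    Algebra.trace ℚ L (x • B 0 + y • B 1 + z • B 2) = 3 * x := by
  rw [Algebra.trace_eq_matrix_trace B, hB.leftMulMatrix, Matrix.trace_fin_three]
  simp
  ring

theorem IsPureBasis.norm (x y z : ℚ) :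
    Algebra.norm ℚ (x • B 0 + y • B 1 + z • B 2) =
      x ^ 3 + a * b ^ 2 * y ^ 3 + a ^ 2 * b * z ^ 3 - 3 * a * b * x * y * z := by
  rw [Algebra.norm_eq_matrix_det B, hB.leftMulMatrix, Matrix.det_fin_three]
  simp
  ring

theorem IsPureBasis.mul (x y z x' y' z' : ℚ) :
    (x • B 0 + y • B 1 + z • B 2) * (x' • B 0 + y' • B 1 + z' • B 2) =
      (x * x' + a * b * (y * z' + z * y')) • B 0 + (x * y' + y * x' + a * z * z') • B 1 +
        (x * z' + z * x' + b * y * y') • B 2 := by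
  rw [hB.coe_smul, hB.coe_smul, hB.coe_smul]
  push_cast
  linear_combination (y * y' : L) * hB.sq_one + z * z' * hB.sq_two +
    (y * z' + z * y') * hB.one_mul_two

theorem IsPureBasis.discr : Algebra.discr ℚ B = -27 * (a * b) ^ 2 := by
  have htr : ∀ i j, Algebra.traceMatrix ℚ B i j =
      !![3, 0, 0; 0, 0, 3 * (a * b : ℚ); 0, 3 * (a * b : ℚ), 0] i j := by
    have e : ∀ i, B i = (![1, 0, 0] i : ℚ) • B 0 + (![0, 1, 0] i : ℚ) • B 1 +
        (![0, 0, 1] i : ℚ) • B 2 := by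
      intro i; fin_cases i <;> simp
    intro i j
    rw [Algebra.traceMatrix_apply, Algebra.traceForm_apply, e i, e j, hB.mul, hB.trace]
    fin_cases i <;> fin_cases j <;> simp
  rw [Algebra.discr_def, Matrix.det_fin_three]
  simp only [htr]
  simp
  ring

/-- The symmetry behind the fact that `λ` and `-λ` give the same field. -/
theorem IsPureBasis.swap : IsPureBasis b a (B.reindex (Equiv.swap 1 2)) where
  zero := by simpa [Equiv.swap_apply_of_ne_of_ne] using hB.zero
  sq_one := by simpa using hB.sq_two
  sq_two := by simpa using hB.sq_one
  one_mul_two := by simpa [mul_comm] using hB.one_mul_two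

theorem IsPureBasis.isIntegral (i : Fin 3) : IsIntegral ℤ (B i) := by
  have h1 := hB.sq_one
  have h2 := hB.sq_two
  have h3 := hB.one_mul_two
  fin_cases i
  · simpa [hB.zero] using isIntegral_one
  · refine IsIntegral.of_pow (n := 3) (by norm_num) ?_
    have : B 1 ^ 3 = ((a * b ^ 2 : ℤ) : L) := by
      push_cast
      linear_combination B 1 * h1 + b * h3
    change IsIntegral ℤ (B 1 ^ 3)
    rw [this]
    exact isIntegral_algebraMap (R := ℤ) (x := (a * b ^ 2 : ℤ))
  · refine IsIntegral.of_pow (n := 3) (by norm_num) ?_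
    have : B 2 ^ 3 = ((a ^ 2 * b : ℤ) : L) := by
      push_cast
      linear_combination B 2 * h2 + a * h3
    change IsIntegral ℤ (B 2 ^ 3)
    rw [this]
    exact isIntegral_algebraMap (R := ℤ) (x := (a ^ 2 * b : ℤ))

end Cubic

end PureCubic

end

noncomputable section
open NumberField IntermediateField
namespace PureCubic

/-! ### Congruences satisfied by the coordinates of an algebraic integer -/

section Congruences

/-- The equation is integrality of the norm when the traces alone allow the denominator `3ab`. It
gives `a ∣ bY³` and `b ∣ aZ³`; squarefreeness and coprimality remove the cubes and cofactors, and a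
second round, after division by `ab`, gives the remaining divisibilities. So the denominator drops
to 3. -/
theorem mul_dvd_of_cubic_eq {a b x Y Z N : ℤ} (ha : Squarefree a) (hb : Squarefree b)
    (hab : IsCoprime a b)
    (h : a ^ 2 * b ^ 2 * x ^ 3 + b * Y ^ 3 + a * Z ^ 3 - 3 * a * b * x * Y * Z =
      27 * N * a ^ 2 * b ^ 2) : a * b ∣ Y ∧ a * b ∣ Z := by
  have hY : a ∣ Y := by
    rw [← ha.dvd_pow_iff_dvd three_ne_zero]
    refine hab.dvd_of_dvd_mul_left ?_
    exact ⟨27 * N * a * b ^ 2 - a * b ^ 2 * x ^ 3 - Z ^ 3 + 3 * b * x * Y * Z,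
      by linear_combination h⟩
  have hZ : b ∣ Z := by
    rw [← hb.dvd_pow_iff_dvd three_ne_zero]
    refine hab.symm.dvd_of_dvd_mul_left ?_
    exact ⟨27 * N * a ^ 2 * b - a ^ 2 * b * x ^ 3 - Y ^ 3 + 3 * a * x * Y * Z,
      by linear_combination h⟩
  obtain ⟨y, rfl⟩ := hY
  obtain ⟨z, rfl⟩ := hZ
  have h2 : a * b * x ^ 3 + a ^ 2 * y ^ 3 + b ^ 2 * z ^ 3 - 3 * a * b * x * y * z =
      27 * N * a * b := by
    apply mul_left_cancel₀ (mul_ne_zero ha.ne_zero hb.ne_zero)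
    linear_combination h
  have hy : b ∣ y := by
    rw [← hb.dvd_pow_iff_dvd three_ne_zero]
    refine (hab.symm.pow_right (n := 2)).dvd_of_dvd_mul_left ?_
    exact ⟨27 * N * a - a * x ^ 3 - b * z ^ 3 + 3 * a * x * y * z, by linear_combination h2⟩
  have hz : a ∣ z := by
    rw [← ha.dvd_pow_iff_dvd three_ne_zero]
    refine (hab.pow_right (n := 2)).dvd_of_dvd_mul_left ?_
    exact ⟨27 * N * b - b * x ^ 3 - a * y ^ 3 + 3 * b * x * y * z, by linear_combination h2⟩
  obtain ⟨y', rfl⟩ := hy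
  obtain ⟨z', rfl⟩ := hz
  exact ⟨⟨y', by ring⟩, ⟨z', by ring⟩⟩

theorem three_dvd_of_three_dvd_left {a b x y z N S : ℤ} (ha : Squarefree a)
    (hab : IsCoprime a b) (h3 : 3 ∣ a)
    (hE : x ^ 3 + a * b ^ 2 * y ^ 3 + a ^ 2 * b * z ^ 3 - 3 * a * b * x * y * z = 27 * N)
    (hT : x ^ 2 + 2 * a * b * y * z = 3 * S) : 3 ∣ x ∧ 3 ∣ y ∧ 3 ∣ z := by
  have p3 : Prime (3 : ℤ) := Int.prime_three
  obtain ⟨a', rfl⟩ := h3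
  have ha' : ¬ (3 : ℤ) ∣ a' := by
    intro h
    have := ha 3 (mul_dvd_mul_left 3 h)
    exact p3.not_isUnit this
  have hb' : ¬ (3 : ℤ) ∣ b := by
    intro h
    exact p3.not_isUnit (hab.isUnit_of_dvd' (dvd_mul_right 3 a') h)
  have hx : 3 ∣ x := p3.dvd_of_dvd_pow (n := 2) ⟨S - 2 * a' * b * y * z, by linear_combination hT⟩
  obtain ⟨x', rfl⟩ := hx
  have hy : 3 ∣ y := by
    have : (3 : ℤ) ∣ a' * b ^ 2 * y ^ 3 :=
      ⟨3 * N - 3 * x' ^ 3 - a' ^ 2 * b * z ^ 3 + 3 * a' * b * x' * y * z, by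
        have := mul_left_cancel₀ (a := (3 : ℤ)) (b := a' * b ^ 2 * y ^ 3)
          (c := 9 * N - 9 * x' ^ 3 - 3 * a' ^ 2 * b * z ^ 3 + 9 * a' * b * x' * y * z)
          (by norm_num) (by linear_combination hE)
        linear_combination this⟩
    exact p3.dvd_of_dvd_pow ((p3.dvd_or_dvd this).resolve_left fun h =>
      (p3.dvd_or_dvd h).elim ha' fun h => hb' (p3.dvd_of_dvd_pow h))
  obtain ⟨y', rfl⟩ := hy
  refine ⟨dvd_mul_right _ _, dvd_mul_right _ _, ?_⟩
  have : (3 : ℤ) ∣ a' ^ 2 * b * z ^ 3 :=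
    ⟨N - x' ^ 3 - 3 * a' * b ^ 2 * y' ^ 3 + 3 * a' * b * x' * y' * z, by
      apply mul_left_cancel₀ (a := (9 : ℤ)) (by norm_num)
      linear_combination hE⟩
  exact p3.dvd_of_dvd_pow ((p3.dvd_or_dvd this).resolve_left fun h =>
    (p3.dvd_or_dvd h).elim (fun h => ha' (p3.dvd_of_dvd_pow h)) hb')

theorem int_cube_emod_nine {x : ℤ} (hx : ¬ (3 : ℤ) ∣ x) : x ^ 3 % 9 = 1 ∨ x ^ 3 % 9 = 8 := by
  have h : x % 9 = 1 ∨ x % 9 = 2 ∨ x % 9 = 4 ∨ x % 9 = 5 ∨ x % 9 = 7 ∨ x % 9 = 8 := by omega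
  rcases h with h | h | h | h | h | h <;> simp [pow_succ, Int.mul_emod, h]

/-- The congruence `m ≡ ±1 mod 9`. -/
def IsPmOneModNine (m : ℤ) : Prop := m ≡ 1 [ZMOD 9] ∨ m ≡ -1 [ZMOD 9]

/-- Set `U = ab²y³` and `V = a²bz³`, so that `x³UV = (abxyz)³`. The two equations force `U ≡ x³ mod
3`, and expanding the product modulo 27 improves this to `U ≡ x³ mod 9`. Cubes prime to 3 are `±1
mod 9`, hence so is `ab²`. -/
theorem isPmOneModNine_of_cubic_eq {a b x y z N S : ℤ} (ha : ¬ (3 : ℤ) ∣ a)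
    (hb : ¬ (3 : ℤ) ∣ b) (hx : ¬ (3 : ℤ) ∣ x)
    (hE : x ^ 3 + a * b ^ 2 * y ^ 3 + a ^ 2 * b * z ^ 3 - 3 * a * b * x * y * z = 27 * N)
    (hT : x ^ 2 + 2 * a * b * y * z = 3 * S) : IsPmOneModNine (a * b ^ 2) := by
  have p3 : Prime (3 : ℤ) := Int.prime_three
  have hy : ¬ (3 : ℤ) ∣ y := by
    rintro ⟨y', rfl⟩
    exact hx (p3.dvd_of_dvd_pow (n := 2) ⟨S - 2 * a * b * y' * z, by linear_combination hT⟩)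
  have hδ : ∃ δ, a * b ^ 2 * y ^ 3 = x ^ 3 + 3 * δ := by
    -- `U` and `V` are the roots of `T² + XT + X²`, which is `(T - X)²` in characteristic 3.
    have key : ∀ X U V : ZMod 3, X ≠ 0 → X + U + V = 0 → U * V * X = X ^ 3 → X = U := by decide
    have hX : ((x ^ 3 : ℤ) : ZMod 3) ≠ 0 := by
      rw [Ne, ZMod.intCast_zmod_eq_zero_iff_dvd]
      exact fun h => hx (p3.dvd_of_dvd_pow h)
    have h1 : ((x ^ 3 + a * b ^ 2 * y ^ 3 + a ^ 2 * b * z ^ 3 : ℤ) : ZMod 3) = 0 := by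
      rw [ZMod.intCast_zmod_eq_zero_iff_dvd]
      exact ⟨9 * N + a * b * x * y * z, by push_cast; linear_combination hE⟩
    have h2 : (((a * b ^ 2 * y ^ 3) * (a ^ 2 * b * z ^ 3) * x ^ 3 : ℤ) : ZMod 3) =
        (((x ^ 3) ^ 3 : ℤ) : ZMod 3) := by
      rw [ZMod.intCast_eq_intCast_iff_dvd_sub]
      have : (x ^ 3) ^ 3 - (a * b ^ 2 * y ^ 3) * (a ^ 2 * b * z ^ 3) * x ^ 3 =
          (x ^ 3) ^ 3 - (a * b * x * y * z) ^ 3 := by ring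
      rw [this]
      refine dvd_trans ?_ (sub_dvd_pow_sub_pow _ _ 3)
      exact ⟨(S - a * b * y * z) * x, by push_cast; linear_combination x * hT⟩
    have := key ((x ^ 3 : ℤ) : ZMod 3) ((a * b ^ 2 * y ^ 3 : ℤ) : ZMod 3)
      ((a ^ 2 * b * z ^ 3 : ℤ) : ZMod 3) hX (by exact_mod_cast h1) (by exact_mod_cast h2)
    rw [ZMod.intCast_eq_intCast_iff_dvd_sub] at this
    obtain ⟨δ, h⟩ := this
    exact ⟨δ, by linear_combination h⟩
  have hω : ∃ ω, a * b * x * y * z = x ^ 3 + 3 * ω :=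
    ⟨(a * b * y * z - S) * x, by linear_combination -x * hT⟩
  obtain ⟨δ, hδ⟩ := hδ
  obtain ⟨ω, hω⟩ := hω
  have hV : a ^ 2 * b * z ^ 3 = 27 * N + x ^ 3 + 9 * ω - 3 * δ := by
    linear_combination hE - hδ + 3 * hω
  have hmul : (a * b ^ 2 * y ^ 3) * (a ^ 2 * b * z ^ 3) * x ^ 3 = (a * b * x * y * z) ^ 3 := by ring
  rw [hδ, hω, hV] at hmul
  -- Modulo 27 everything in the product relation cancels except `9δ²x³`.
  have h3 : (3 : ℤ) ∣ δ ^ 2 * x ^ 3 := by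
    refine ⟨N * (x ^ 3 + 3 * δ) * x ^ 3 + δ * ω * x ^ 3 - ω ^ 2 * x ^ 3 - ω ^ 3, ?_⟩
    apply mul_left_cancel₀ (a := (9 : ℤ)) (by norm_num)
    linear_combination -hmul
  have h3 : (3 : ℤ) ∣ δ := by
    exact p3.dvd_of_dvd_pow ((p3.dvd_or_dvd h3).resolve_right fun h => hx (p3.dvd_of_dvd_pow h))
  obtain ⟨δ', rfl⟩ := h3
  have hx9 := int_cube_emod_nine hx
  have hy9 := int_cube_emod_nine hy
  have hm : (a * b ^ 2 * y ^ 3) % 9 = x ^ 3 % 9 := by rw [hδ]; omega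
  rw [Int.mul_emod] at hm
  have hlt : 0 ≤ (a * b ^ 2) % 9 ∧ (a * b ^ 2) % 9 < 9 := by omega
  unfold IsPmOneModNine Int.ModEq
  generalize a * b ^ 2 = m at *
  rcases hx9 with hx9 | hx9 <;> rcases hy9 with hy9 | hy9 <;> rw [hx9, hy9] at hm <;> omega

theorem three_dvd_of_not_isPmOneModNine {a b x y z N S : ℤ} (ha : Squarefree a) (hb : Squarefree b)
    (hab : IsCoprime a b) (hm : ¬ IsPmOneModNine (a * b ^ 2))
    (hE : x ^ 3 + a * b ^ 2 * y ^ 3 + a ^ 2 * b * z ^ 3 - 3 * a * b * x * y * z = 27 * N)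
    (hT : x ^ 2 + 2 * a * b * y * z = 3 * S) : 3 ∣ x ∧ 3 ∣ y ∧ 3 ∣ z := by
  have p3 : Prime (3 : ℤ) := Int.prime_three
  by_cases h3a : 3 ∣ a
  · exact three_dvd_of_three_dvd_left ha hab h3a hE hT
  by_cases h3b : 3 ∣ b
  · have := three_dvd_of_three_dvd_left (x := x) (y := z) (z := y) (N := N) (S := S) hb hab.symm
      h3b (by linear_combination hE) (by linear_combination hT)
    exact ⟨this.1, this.2.2, this.2.1⟩
  by_cases hx : 3 ∣ x
  · refine ⟨hx, ?_⟩
    obtain ⟨x', rfl⟩ := hx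
    have hyz : (3 : ℤ) ∣ y ∨ 3 ∣ z := by
      have h2 : (3 : ℤ) ∣ 2 * a * b * (y * z) := ⟨S - 3 * x' ^ 2, by linear_combination hT⟩
      rcases p3.dvd_or_dvd h2 with h | h
      · rcases p3.dvd_or_dvd h with h | h
        · rcases p3.dvd_or_dvd h with h | h
          · omega
          · exact absurd h h3a
        · exact absurd h h3b
      · exact p3.dvd_or_dvd h
    rcases hyz with hy | hz
    · refine ⟨hy, ?_⟩
      obtain ⟨y', rfl⟩ := hy
      have : (3 : ℤ) ∣ a ^ 2 * b * z ^ 3 :=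
        ⟨9 * N - 9 * x' ^ 3 - 9 * a * b ^ 2 * y' ^ 3 + 9 * a * b * x' * y' * z,
          by linear_combination hE⟩
      exact p3.dvd_of_dvd_pow ((p3.dvd_or_dvd this).resolve_left fun h =>
        (p3.dvd_or_dvd h).elim (fun h => h3a (p3.dvd_of_dvd_pow h)) h3b)
    · refine ⟨?_, hz⟩
      obtain ⟨z', rfl⟩ := hz
      have : (3 : ℤ) ∣ a * b ^ 2 * y ^ 3 :=
        ⟨9 * N - 9 * x' ^ 3 - 9 * a ^ 2 * b * z' ^ 3 + 9 * a * b * x' * y * z',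
          by linear_combination hE⟩
      exact p3.dvd_of_dvd_pow ((p3.dvd_or_dvd this).resolve_left fun h =>
        (p3.dvd_or_dvd h).elim h3a fun h => h3b (p3.dvd_of_dvd_pow h))
  · exact absurd (isPmOneModNine_of_cubic_eq h3a h3b hx hE hT) hm

end Congruences

/-! ### Denominators of algebraic integers, and the discriminant when `ab² ≢ ±1 mod 9` -/

section Integers

variable {L : Type} [Field L] [NumberField L] {a b : ℕ} {B : Module.Basis (Fin 3) ℚ L}

/-- The coordinates of an algebraic integer. -/
theorem IsPureBasis.exists_int_coords (hB : IsPureBasis a b B) (ha : Squarefree (a : ℤ))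
    (hb : Squarefree (b : ℤ)) (hab : IsCoprime (a : ℤ) b) {x y z : ℚ}
    (h : IsIntegral ℤ (x • B 0 + y • B 1 + z • B 2)) :
    ∃ x₀ y₀ z₀ N S : ℤ, x = x₀ / 3 ∧ y = y₀ / 3 ∧ z = z₀ / 3 ∧
      x₀ ^ 3 + a * b ^ 2 * y₀ ^ 3 + a ^ 2 * b * z₀ ^ 3 - 3 * a * b * x₀ * y₀ * z₀ = 27 * N ∧
      x₀ ^ 2 + 2 * a * b * y₀ * z₀ = 3 * S := by
  obtain ⟨α, hα⟩ : ∃ α, α = x • B 0 + y • B 1 + z • B 2 := ⟨_, rfl⟩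
  rw [← hα] at h
  have eα1 : α * B 1 = (a * b * z) • B 0 + x • B 1 + (b * y) • B 2 := by
    have := hB.mul x y z 0 1 0
    simp only [zero_smul, zero_add, add_zero, one_smul, mul_zero, mul_one] at this
    rw [hα, this]
  have eα2 : α * B 2 = (a * b * y) • B 0 + (a * z) • B 1 + x • B 2 := by
    have := hB.mul x y z 0 0 1
    simp only [zero_smul, zero_add, add_zero, one_smul, mul_zero, mul_one] at this
    rw [hα, this]
  -- The traces of `α` and of its products with the two cube roots bound the denominators by `3ab`;
  -- the norm and the trace of `α²` provide the two equations on the numerators.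
  obtain ⟨x₀, hx⟩ := exists_int_trace h
  obtain ⟨z₁, hz⟩ := exists_int_trace (h.mul (hB.isIntegral 1))
  obtain ⟨y₁, hy⟩ := exists_int_trace (h.mul (hB.isIntegral 2))
  obtain ⟨S, hS⟩ := exists_int_trace (h.mul h)
  obtain ⟨N, hN⟩ := exists_int_norm h
  rw [eα1, hB.trace] at hz
  rw [eα2, hB.trace] at hy
  rw [hα, hB.mul, hB.trace] at hS
  rw [hα, hB.trace] at hx
  rw [hα, hB.norm] at hN
  have ha0 : (a : ℚ) ≠ 0 := by exact_mod_cast ha.ne_zero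
  have hb0 : (b : ℚ) ≠ 0 := by exact_mod_cast hb.ne_zero
  have hx' : x = x₀ / 3 := by linear_combination hx / 3
  have hy' : y = y₁ / (3 * a * b) := by field_simp; linear_combination hy
  have hz' : z = z₁ / (3 * a * b) := by field_simp; linear_combination hz
  have hdvd := mul_dvd_of_cubic_eq (x := x₀) (Y := y₁) (Z := z₁) (N := N) ha hb hab (by
    rw [hx', hy', hz'] at hN
    field_simp at hN
    have : ((a ^ 2 * b ^ 2 * x₀ ^ 3 + b * y₁ ^ 3 + a * z₁ ^ 3 - 3 * a * b * x₀ * y₁ * z₁ : ℤ) : ℚ)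
        = ((27 * N * a ^ 2 * b ^ 2 : ℤ) : ℚ) := by
      push_cast
      linear_combination hN
    exact_mod_cast this)
  obtain ⟨⟨y₀, rfl⟩, ⟨z₀, rfl⟩⟩ := hdvd
  have hy' : y = y₀ / 3 := by rw [hy']; push_cast; field_simp
  have hz' : z = z₀ / 3 := by rw [hz']; push_cast; field_simp
  refine ⟨x₀, y₀, z₀, N, S, hx', hy', hz', ?_, ?_⟩
  · rw [hx', hy', hz'] at hN
    have : ((x₀ ^ 3 + a * b ^ 2 * y₀ ^ 3 + a ^ 2 * b * z₀ ^ 3 - 3 * a * b * x₀ * y₀ * z₀ : ℤ) : ℚ)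
        = ((27 * N : ℤ) : ℚ) := by
      push_cast
      linear_combination 27 * hN
    exact_mod_cast this
  · rw [hx', hy', hz'] at hS
    have : ((x₀ ^ 2 + 2 * a * b * y₀ * z₀ : ℤ) : ℚ) = ((3 * S : ℤ) : ℚ) := by
      push_cast
      linear_combination 3 * hS
    exact_mod_cast this

theorem IsPureBasis.exists_int_repr (hB : IsPureBasis a b B) (ha : Squarefree (a : ℤ))
    (hb : Squarefree (b : ℤ)) (hab : IsCoprime (a : ℤ) b)
    (hm : ¬ IsPmOneModNine (a * b ^ 2)) {α : L} (h : IsIntegral ℤ α) (i : Fin 3) :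
    ∃ t : ℤ, B.repr α i = t := by
  rw [Module.Basis.eq_sum_three B α] at h
  obtain ⟨x, y, z, N, S, hx, hy, hz, hE, hT⟩ := hB.exists_int_coords ha hb hab h
  obtain ⟨⟨x, rfl⟩, ⟨y, rfl⟩, ⟨z, rfl⟩⟩ := three_dvd_of_not_isPmOneModNine ha hb hab hm hE hT
  fin_cases i
  · exact ⟨x, by simp [hx]⟩
  · exact ⟨y, by simp [hy]⟩
  · exact ⟨z, by simp [hz]⟩

/-- The basis of `L` over `ℚ` attached to an integral basis. -/
abbrev locBasis (b : Module.Basis (Fin 3) ℤ (𝓞 L)) : Module.Basis (Fin 3) ℚ L :=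
  b.localizationLocalization ℚ (nonZeroDivisors ℤ) L

theorem exists_basis_ringOfIntegers (h3 : Module.finrank ℚ L = 3) :
    Nonempty (Module.Basis (Fin 3) ℤ (𝓞 L)) := by
  have := RingOfIntegers.rank L
  rw [h3] at this
  exact ⟨Module.finBasisOfFinrankEq ℤ (𝓞 L) this⟩

/-- The discriminant of a pure cubic field is `-27a²b²` up to squares of integers, unless
`ab² ≡ ±1 mod 9`. -/
theorem IsPureBasis.exists_discr_eq (hB : IsPureBasis a b B) (h3 : Module.finrank ℚ L = 3)
    (ha : Squarefree (a : ℤ)) (hb : Squarefree (b : ℤ)) (hab : IsCoprime (a : ℤ) b)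
    (hm : ¬ IsPmOneModNine (a * b ^ 2)) :
    ∃ t : ℤ, NumberField.discr L = -27 * (a * b * t) ^ 2 := by
  obtain ⟨β⟩ := exists_basis_ringOfIntegers h3
  have hβ : ∀ i j, ∃ t : ℤ, B.toMatrix (locBasis β) i j = t := by
    intro i j
    refine hB.exists_int_repr ha hb hab hm ?_ i
    rw [Module.Basis.localizationLocalization_apply]
    exact RingOfIntegers.isIntegral_coe (β j)
  choose M hM using hβ
  have hdet : B.det (locBasis β) = (Matrix.det (Matrix.of M) : ℤ) := by
    rw [Module.Basis.det_apply, Int.cast_det]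
    congr 1
    ext i j
    rw [hM]
    rfl
  refine ⟨Matrix.det (Matrix.of M), ?_⟩
  have := discr_basis_eq B (locBasis β)
  rw [discr_localization, hB.discr, hdet] at this
  have h2 : (NumberField.discr L : ℚ) =
      ((-27 * (a * b * Matrix.det (Matrix.of M)) ^ 2 : ℤ) : ℚ) := by
    rw [this]; push_cast; ring
  exact_mod_cast h2

end Integers
end PureCubic

end

noncomputable section
open NumberField IntermediateField
namespace PureCubic

/-! ### The case `ab² ≡ ±1 mod 9`: integral basis, discriminant, index form -/

section Integers

variable {L : Type} [Field L] [NumberField L] {a b : ℕ} {B : Module.Basis (Fin 3) ℚ L}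

theorem IsPmOneModNine.not_three_dvd {m : ℤ} (hm : IsPmOneModNine m) : ¬ (3 : ℤ) ∣ m := by
  unfold IsPmOneModNine Int.ModEq at hm
  omega

/-- With `s = ε∛(ab²)` one has `s³ = 1 + 9t`, and the element is `ω = (1 + s + s²)/3`, so `ω(s - 1)
= 3t`. Eliminating `s` yields the monic integral equation `ω³ = ω² + 3tω + 3t²`. -/
theorem IsPureBasis.isIntegral_third (hB : IsPureBasis a b B) {ε t : ℤ} (hε : ε ^ 2 = 1)
    (hm : ε * (a * b ^ 2) = 1 + 9 * t) :
    IsIntegral ℤ ((1 / 3 : ℚ) • B 0 + (ε / 3 : ℚ) • B 1 + (b / 3 : ℚ) • B 2) := by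
  rw [hB.coe_smul]
  have hm' : (ε : L) * (a * b ^ 2) = 1 + 9 * t := by exact_mod_cast congrArg (Int.cast (R := L)) hm
  have hε' : (ε : L) ^ 2 = 1 := by exact_mod_cast congrArg (Int.cast (R := L)) hε
  have h1 := hB.sq_one
  push_cast
  set θ := B 1
  have hθ : θ ^ 3 = a * b ^ 2 := by linear_combination θ * h1 + b * hB.one_mul_two
  have e : (1 / 3 : L) + ε / 3 * θ + b / 3 * B 2 = (1 + ε * θ + θ ^ 2) / 3 := by
    linear_combination -h1 / 3
  rw [e]
  set ω := (1 + ε * θ + θ ^ 2) / 3 with hω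
  have hpoly : ω ^ 3 = ω ^ 2 + (3 * t : ℤ) * ω + (3 * t ^ 2 : ℤ) := by
    push_cast
    obtain ⟨s, hs⟩ : ∃ s, s = ε * θ := ⟨_, rfl⟩
    have hs2 : θ ^ 2 = s ^ 2 := by rw [hs]; linear_combination -θ ^ 2 * hε'
    have ht : (t : L) = (s ^ 3 - 1) / 9 := by
      rw [hs]; linear_combination -hm' / 9 - ε * hθ / 9 - ε * θ ^ 3 * hε' / 9
    rw [ht, hω, hs2, ← hs]
    ring
  refine ⟨.X ^ 3 - .X ^ 2 - .C (3 * t) * .X - .C (3 * t ^ 2), by monicity!, ?_⟩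
  have h3 : (algebraMap ℤ L) = Int.castRingHom L := rfl
  simp only [Polynomial.eval₂_sub, Polynomial.eval₂_mul, Polynomial.eval₂_C, Polynomial.eval₂_X,
    Polynomial.eval₂_X_pow, h3, Int.coe_castRingHom]
  linear_combination hpoly

/-- The integral basis of a pure cubic field with `ab² ≡ ±1 mod 9`. -/
theorem IsPureBasis.exists_integralBasis (hB : IsPureBasis a b B) (ha : Squarefree (a : ℤ))
    (hb : Squarefree (b : ℤ)) (hab : IsCoprime (a : ℤ) b) (hm : IsPmOneModNine (a * b ^ 2)) :
    ∃ β : Module.Basis (Fin 3) ℤ (𝓞 L), β 0 = 1 ∧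
      NumberField.discr L = -3 * (a * b) ^ 2 := by
  obtain ⟨ε, t, hε, hεt⟩ : ∃ ε t : ℤ, ε ^ 2 = 1 ∧ ε * (a * b ^ 2) = 1 + 9 * t := by
    rcases hm with h | h
    · obtain ⟨t, ht⟩ := h.symm.dvd
      exact ⟨1, t, by norm_num, by linear_combination ht⟩
    · obtain ⟨t, ht⟩ := h.symm.dvd
      exact ⟨-1, -t, by norm_num, by linear_combination -ht⟩
  have h3 := hm.not_three_dvd
  have p3 : Prime (3 : ℤ) := Int.prime_three
  have h3b : ¬ (3 : ℤ) ∣ a ^ 2 * b := by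
    intro h
    rcases p3.dvd_or_dvd h with h | h
    · exact h3 (Dvd.dvd.mul_right (p3.dvd_of_dvd_pow h) _)
    · exact h3 (Dvd.dvd.mul_left (dvd_pow h two_ne_zero) _)
  have hω := hB.isIntegral_third hε hεt
  let v : Fin 3 → 𝓞 L := ![1, ⟨B 2, hB.isIntegral 2⟩, ⟨_, hω⟩]
  have hv : ∀ c : Fin 3 → ℤ, ((∑ i, c i • v i : 𝓞 L) : L) =
      (c 0 + c 2 / 3 : ℚ) • B 0 + (c 2 * ε / 3 : ℚ) • B 1 + (c 1 + c 2 * b / 3 : ℚ) • B 2 := by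
    intro c
    have e : ((c 0 • v 0 + c 1 • v 1 + c 2 • v 2 : 𝓞 L) : L) =
        c 0 * (v 0 : L) + c 1 * (v 1 : L) + c 2 * (v 2 : L) := by
      simp only [zsmul_eq_mul, map_add, map_mul, map_intCast]
    have e2 : (v 2 : L) = (1 / 3 : ℚ) • B 0 + (ε / 3 : ℚ) • B 1 + (b / 3 : ℚ) • B 2 := rfl
    have e1 : (v 1 : L) = B 2 := rfl
    have e0 : (v 0 : L) = 1 := map_one _
    rw [Fin.sum_univ_three, e, e0, e1, e2, hB.coe_smul, hB.coe_smul]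
    push_cast
    ring
  have hε0 : (ε : ℚ) ≠ 0 := by
    rintro h
    have : ε = 0 := by exact_mod_cast h
    simp [this] at hε
  have hli : LinearIndependent ℤ v := by
    rw [Fintype.linearIndependent_iff]
    intro c hc
    have h0 := hv c
    rw [hc] at h0
    have hr : ∀ i, ![(c 0 + c 2 / 3 : ℚ), (c 2 * ε / 3 : ℚ), (c 1 + c 2 * b / 3 : ℚ)] i = 0 := by
      intro i
      rw [← repr_three B, ← h0]
      simp
    have hr0 := hr 0
    have hr1 := hr 1
    have hr2 := hr 2
    simp at hr0 hr1 hr2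
    have c2 : c 2 = 0 := by
      rcases hr1 with h | h
      · exact h
      · exact absurd h (by exact_mod_cast hε0)
    simp [c2] at hr0 hr2
    intro i
    fin_cases i
    · exact hr0
    · exact hr2
    · exact c2
  have hsp : ⊤ ≤ Submodule.span ℤ (Set.range v) := by
    intro α _
    have hα : IsIntegral ℤ (α : L) := RingOfIntegers.isIntegral_coe α
    rw [Module.Basis.eq_sum_three B (α : L)] at hα
    obtain ⟨x, y, z, -, -, hx, hy, hz, -, -⟩ := hB.exists_int_coords ha hb hab hα
    -- The coefficient of `B 1` in the new integer is `ε/3`, and `ε² = 1`, so this multiple cancels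
    -- the `B 1`-coordinate of `α`. With that coordinate zero, the two equations make the other
    -- numerators divisible by 3.
    have hsub : IsIntegral ℤ ((α : L) -
        (ε * y : ℤ) • ((1 / 3 : ℚ) • B 0 + (ε / 3 : ℚ) • B 1 + (b / 3 : ℚ) • B 2)) := by
      refine IsIntegral.sub (RingOfIntegers.isIntegral_coe α) ?_
      exact hω.smul _
    have e : ((α : L) -
        (ε * y : ℤ) • ((1 / 3 : ℚ) • B 0 + (ε / 3 : ℚ) • B 1 + (b / 3 : ℚ) • B 2)) =
        ((x - ε * y) / 3 : ℚ) • B 0 + (0 : ℚ) • B 1 + ((z - ε * y * b) / 3 : ℚ) • B 2 := by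
      rw [Module.Basis.eq_sum_three B (α : L), hx, hy, hz, hB.coe_smul, hB.coe_smul, hB.coe_smul]
      have hε' : (ε : L) ^ 2 = 1 := by exact_mod_cast congrArg (Int.cast (R := L)) hε
      rw [zsmul_eq_mul]
      push_cast
      linear_combination -(y * B 1 / 3 : L) * hε'
    rw [e] at hsub
    obtain ⟨x', y', z', N, S, hx', hy', hz', hE, hT⟩ := hB.exists_int_coords ha hb hab hsub
    have hy0 : y' = 0 := by
      have : (y' : ℚ) = 0 := by linear_combination -3 * hy'
      exact_mod_cast this
    subst hy0
    have hx3 : 3 ∣ x' := p3.dvd_of_dvd_pow (n := 2) ⟨S, by linear_combination hT⟩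
    obtain ⟨x'', rfl⟩ := hx3
    have hz3 : 3 ∣ z' := by
      have : (3 : ℤ) ∣ a ^ 2 * b * z' ^ 3 := ⟨9 * N - 9 * x'' ^ 3, by linear_combination hE⟩
      exact p3.dvd_of_dvd_pow ((p3.dvd_or_dvd this).resolve_left h3b)
    obtain ⟨z'', rfl⟩ := hz3
    rw [Submodule.mem_span_range_iff_exists_fun]
    refine ⟨![x'', z'', ε * y], ?_⟩
    refine RingOfIntegers.coe_injective ((hv _).trans ?_)
    change _ = (α : L)
    rw [hx', hz', hB.coe_smul, hB.coe_smul, zsmul_eq_mul] at e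
    rw [hB.coe_smul]
    simp only [Matrix.cons_val_zero, Matrix.cons_val_one, Matrix.cons_val]
    push_cast at e ⊢
    linear_combination -e
  refine ⟨Module.Basis.mk hli hsp, by simp [v], ?_⟩
  have := discr_basis_eq B (locBasis (Module.Basis.mk hli hsp))
  rw [discr_localization, hB.discr] at this
  -- Its square `1/9` turns the discriminant `-27(ab)²` of the pure basis into `-3(ab)²`.
  have hdet : B.det (locBasis (Module.Basis.mk hli hsp)) = -ε / 3 := by
    have hM : B.toMatrix (locBasis (Module.Basis.mk hli hsp)) =
        !![1, 0, 1 / 3; 0, 0, (ε / 3 : ℚ); 0, 1, (b / 3 : ℚ)] := by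
      ext i j
      rw [Module.Basis.toMatrix_apply, Module.Basis.localizationLocalization_apply]
      have h0 := repr_three B 1 0 0 i
      have h1 := repr_three B 0 0 1 i
      have h2 := repr_three B (1 / 3) (ε / 3) (b / 3) i
      rw [one_smul, zero_smul, zero_smul, add_zero, add_zero, hB.zero] at h0
      rw [one_smul, zero_smul, zero_smul, zero_add, zero_add] at h1
      fin_cases j
      · have e : ((Module.Basis.mk hli hsp 0 : 𝓞 L) : L) = 1 := by simp [v]
        exact (congrArg (fun w => B.repr w i) e).trans (h0.trans (by fin_cases i <;> rfl))
      · have e : ((Module.Basis.mk hli hsp 1 : 𝓞 L) : L) = B 2 := by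
          rw [Module.Basis.mk_apply]; rfl
        exact (congrArg (fun w => B.repr w i) e).trans (h1.trans (by fin_cases i <;> rfl))
      · have e : ((Module.Basis.mk hli hsp 2 : 𝓞 L) : L) =
            (1 / 3 : ℚ) • B 0 + (ε / 3 : ℚ) • B 1 + (b / 3 : ℚ) • B 2 := by
          rw [Module.Basis.mk_apply]; rfl
        exact (congrArg (fun w => B.repr w i) e).trans (h2.trans (by fin_cases i <;> rfl))
    rw [Module.Basis.det_apply, hM, Matrix.det_fin_three]
    simp
    ring
  have h2 : (NumberField.discr L : ℚ) = ((-3 * (a * b) ^ 2 : ℤ) : ℚ) := by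
    have hε' : (ε : ℚ) ^ 2 = 1 := by exact_mod_cast congrArg (Int.cast (R := ℚ)) hε
    rw [this, hdet]; push_cast; linear_combination (-3 * (a * b) ^ 2) * hε'
  exact_mod_cast h2

/-- In the other residue classes the discriminant is `-27` times a square, which would make `n`
divisible by 3. -/
theorem IsPureBasis.of_discr_eq (hB : IsPureBasis a b B) (h3 : Module.finrank ℚ L = 3)
    (ha : Squarefree (a : ℤ)) (hb : Squarefree (b : ℤ)) (hab : IsCoprime (a : ℤ) b) {n : ℤ}
    (hn : ¬ (3 : ℤ) ∣ n) (hd : NumberField.discr L = -3 * n ^ 2) :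
    IsPmOneModNine (a * b ^ 2) ∧ a * b = n.natAbs := by
  have hm : IsPmOneModNine (a * b ^ 2) := by
    by_contra hm
    obtain ⟨t, ht⟩ := hB.exists_discr_eq h3 ha hb hab hm
    apply hn
    refine Int.prime_three.dvd_of_dvd_pow (n := 2) ⟨3 * (a * b * t) ^ 2, ?_⟩
    rw [hd] at ht
    linarith
  refine ⟨hm, ?_⟩
  obtain ⟨β, -, hβ⟩ := hB.exists_integralBasis ha hb hab hm
  rw [hd] at hβ
  have : n ^ 2 = (a * b : ℕ) ^ 2 := by push_cast; linarith
  rw [← Int.natAbs_eq_iff_sq_eq, Int.natAbs_natCast] at this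
  exact this.symm

/-- The index form in terms of the pure basis. -/
theorem IsPureBasis.exists_indexForm_iff (hB : IsPureBasis a b B)
    (hd : NumberField.discr L = -3 * (a * b) ^ 2) (hab : (a * b : ℚ) ≠ 0)
    (β : Module.Basis (Fin 3) ℤ (𝓞 L)) (hβ : β 0 = 1) :
    (∃ (x y : ℚ) (u : ℤˣ), indexForm β x y = ((u : ℤ) : ℚ)) ↔
      ∃ X Y : ℚ, 3 * (b * X ^ 3 - a * Y ^ 3) = 1 := by
  -- The ratio of the discriminants `-27(ab)²` and `-3(ab)²` is the square of this determinant.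
  have hdet : (locBasis β).det B = 3 ∨ (locBasis β).det B = -3 := by
    have := discr_basis_eq (locBasis β) B
    rw [discr_localization, hB.discr, hd] at this
    push_cast at this
    have h9 : ((locBasis β).det B - 3) * ((locBasis β).det B + 3) = 0 := by
      apply mul_left_cancel₀ (pow_ne_zero 2 hab)
      linear_combination this / 3
    rcases mul_eq_zero.1 h9 with h | h
    · exact Or.inl (sub_eq_zero.1 h)
    · exact Or.inr (eq_neg_of_add_eq_zero_left h)
  -- The value does not involve `r`: translating `γ` by a rational does not change `1 ∧ γ ∧ γ²`.
  -- This allows passage between the complements of `ℚ` spanned by the two bases.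
  have hform : ∀ r X Y : ℚ, (locBasis β).det ![1, r • B 0 + X • B 1 + Y • B 2,
      (r • B 0 + X • B 1 + Y • B 2) ^ 2] =
      (locBasis β).det B * (b * X ^ 3 - a * Y ^ 3) := by
    intro r X Y
    have hs : (locBasis β).det = (locBasis β).det B • B.det :=
      AlternatingMap.eq_smul_basis_det B _
    rw [hs, AlternatingMap.smul_apply, smul_eq_mul, AlternatingMap.smul_apply, B.det_self,
      smul_eq_mul, mul_one]
    congr 1
    have hM : B.toMatrix ![1, r • B 0 + X • B 1 + Y • B 2,
        (r • B 0 + X • B 1 + Y • B 2) ^ 2] =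
        !![1, r, r * r + a * b * (X * Y + Y * X); 0, X, r * X + X * r + a * Y * Y;
          0, Y, r * Y + Y * r + b * X * X] := by
      ext i j
      rw [Module.Basis.toMatrix_apply]
      have h0 := repr_three B 1 0 0 i
      have h1 := repr_three B r X Y i
      have h2 := repr_three B (r * r + a * b * (X * Y + Y * X)) (r * X + X * r + a * Y * Y)
          (r * Y + Y * r + b * X * X) i
      rw [← hB.mul, ← sq] at h2
      rw [one_smul, zero_smul, zero_smul, add_zero, add_zero, hB.zero] at h0
      fin_cases j
      · exact h0.trans (by fin_cases i <;> rfl)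
      · exact h1.trans (by fin_cases i <;> rfl)
      · exact h2.trans (by fin_cases i <;> rfl)
    rw [Module.Basis.det_apply, hM, Matrix.det_fin_three]
    simp
    ring
  have hb0 : locBasis β 0 = 1 := by
    rw [Module.Basis.localizationLocalization_apply, hβ, map_one]
  constructor
  · rintro ⟨x, y, u, h⟩
    change (locBasis β).det ![1, x • locBasis β 1 + y • locBasis β 2,
      (x • locBasis β 1 + y • locBasis β 2) ^ 2] = _ at h
    rw [Module.Basis.eq_sum_three B (x • locBasis β 1 + y • locBasis β 2), hform] at h
    generalize B.repr (x • locBasis β 1 + y • locBasis β 2) 1 = X at h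
    generalize B.repr (x • locBasis β 1 + y • locBasis β 2) 2 = Y at h
    have hcases : 3 * (b * X ^ 3 - a * Y ^ 3) = 1 ∨ 3 * (b * X ^ 3 - a * Y ^ 3) = -1 := by
      rcases Int.units_eq_one_or u with rfl | rfl <;> rcases hdet with h' | h' <;>
        rw [h'] at h <;> push_cast at h
      · exact Or.inl h
      · exact Or.inr (by linear_combination -h)
      · exact Or.inr (by linear_combination h)
      · exact Or.inl (by linear_combination -h)
    rcases hcases with h | h
    · exact ⟨X, Y, h⟩
    · exact ⟨-X, -Y, by linear_combination -h⟩
  · rintro ⟨X, Y, h⟩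
    obtain ⟨γ, hγ⟩ : ∃ γ, γ = (0 : ℚ) • B 0 + X • B 1 + Y • B 2 := ⟨_, rfl⟩
    have hγ2 := Module.Basis.eq_sum_three (locBasis β) γ
    rw [hb0] at hγ2
    generalize (locBasis β).repr γ 0 = r at hγ2
    generalize (locBasis β).repr γ 1 = x at hγ2
    generalize (locBasis β).repr γ 2 = y at hγ2
    have e : x • locBasis β 1 + y • locBasis β 2 = (-r) • B 0 + X • B 1 + Y • B 2 := by
      rw [hB.zero, neg_smul, add_assoc, ← neg_add_eq_iff_eq_add.2 (hγ2.trans (add_assoc _ _ _)),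
        hγ, zero_smul, zero_add]
    have hI : indexForm β x y = (locBasis β).det B * (b * X ^ 3 - a * Y ^ 3) := by
      rw [← hform (-r), ← e]
      rfl
    rcases hdet with h' | h'
    · exact ⟨x, y, 1, by rw [hI, h', h]; simp⟩
    · exact ⟨x, y, -1, by rw [hI, h']; push_cast; linear_combination -h⟩

end Integers
end PureCubic

end

noncomputable section
open NumberField IntermediateField
namespace PureCubic

/-! ### Cubic fields of discriminant `-3n²` are pure -/

section Classification

variable {L : Type} [Field L] [NumberField L]

theorem exists_irrational (h3 : Module.finrank ℚ L = 3) : ∃ θ : L, ∀ r : ℚ, θ ≠ r := by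
  by_contra! h
  have : (⊥ : Subalgebra ℚ L) = ⊤ := by
    rw [eq_top_iff]
    intro x _
    obtain ⟨r, hr⟩ := h x
    exact ⟨r, by rw [hr]; exact eq_ratCast (algebraMap ℚ L) r⟩
  rw [Subalgebra.bot_eq_top_iff_finrank_eq_one, h3] at this
  omega

/-- A generator satisfying a depressed cubic equation. -/
theorem exists_depressed (h3 : Module.finrank ℚ L = 3) :
    ∃ (B : Module.Basis (Fin 3) ℚ L) (θ : L) (p q : ℚ), (∀ i, B i = θ ^ (i : ℕ)) ∧
      θ ^ 3 + p * θ + q = 0 ∧ Algebra.discr ℚ B = -4 * p ^ 3 - 27 * q ^ 2 := by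
  obtain ⟨θ₀, hθ₀⟩ := exists_irrational h3
  -- Making the trace zero removes the quadratic term of the cubic equation.
  obtain ⟨θ, hθ⟩ : ∃ θ, θ = θ₀ - ((Algebra.trace ℚ L θ₀ / 3 : ℚ) : L) := ⟨_, rfl⟩
  have hirr : ∀ r : ℚ, θ ≠ r := fun r h =>
    hθ₀ (r + Algebra.trace ℚ L θ₀ / 3) (by push_cast; rw [← h, hθ]; push_cast; ring)
  have htr : Algebra.trace ℚ L θ = 0 := by
    rw [hθ, map_sub, ← eq_ratCast (algebraMap ℚ L), Algebra.trace_algebraMap, h3]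
    simp
    ring
  obtain ⟨B, hB⟩ := exists_basis_pow h3 hirr
  have h0 : B 0 = 1 := by rw [hB]; simp
  have h1 : B 1 = θ := by rw [hB]; simp
  have h2 : B 2 = θ ^ 2 := by rw [hB]; simp
  obtain ⟨c, hc⟩ : ∃ c : Fin 3 → ℚ, θ ^ 3 = c 0 • B 0 + c 1 • B 1 + c 2 • B 2 :=
    ⟨B.repr (θ ^ 3), Module.Basis.eq_sum_three B _⟩
  have hmul : Algebra.leftMulMatrix B θ = !![0, 0, c 0; 1, 0, c 1; 0, 1, c 2] := by
    apply leftMulMatrix_eq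
    intro j
    rw [Fin.sum_univ_three]
    fin_cases j
    · simp [h0, h1]
    · simp [h1, h2, sq]
    · have e : θ * B 2 = θ ^ 3 := by rw [h2]; ring
      simp [e, hc]
  have hc2 : c 2 = 0 := by
    rw [Algebra.trace_eq_matrix_trace B, hmul, Matrix.trace_fin_three] at htr
    simpa using htr
  have hrel : θ ^ 3 = c 0 + c 1 * θ := by
    rw [hc, hc2, h0, h1]; simp [Rat.smul_def]
  have hpow : ∀ k, Algebra.trace ℚ L (θ ^ k) =
      (!![0, 0, c 0; 1, 0, c 1; 0, 1, c 2] ^ k).trace := by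
    intro k
    rw [Algebra.trace_eq_matrix_trace B, map_pow, hmul]
  refine ⟨B, θ, -c 1, -c 0, hB, by push_cast; linear_combination hrel, ?_⟩
  have htm : ∀ i j, Algebra.traceMatrix ℚ B i j =
      !![3, 0, 2 * c 1; 0, 2 * c 1, 3 * c 0; 2 * c 1, 3 * c 0, 2 * c 1 ^ 2] i j := by
    intro i j
    rw [Algebra.traceMatrix_apply, Algebra.traceForm_apply, hB, hB, ← pow_add, hpow, hc2]
    fin_cases i <;> fin_cases j <;>
      simp [pow_succ, Matrix.trace_fin_three, Matrix.one_fin_three] <;> ring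
  rw [Algebra.discr_def, Matrix.det_fin_three]
  simp only [htm]
  simp
  ring

/-- A cubic field whose discriminant is `-3` times a square contains an irrational cube root. -/
theorem exists_cube_root (h3 : Module.finrank ℚ L = 3) {n : ℤ} (hn : n ≠ 0)
    (hd : NumberField.discr L = -3 * n ^ 2) :
    ∃ (u : L) (r : ℚ), r ≠ 0 ∧ u ^ 3 = r ∧ ∀ s : ℚ, u ≠ s := by
  obtain ⟨B, θ, p, q, hB, hθ, hdisc⟩ := exists_depressed h3
  obtain ⟨β⟩ := exists_basis_ringOfIntegers h3
  have hdet := discr_basis_eq (locBasis β) B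
  rw [hdisc, discr_localization, hd] at hdet
  have hdet0 : (locBasis β).det B ≠ 0 := ((locBasis β).isUnit_det B).ne_zero
  obtain ⟨t, ht⟩ : ∃ t : ℚ, t = n * (locBasis β).det B := ⟨_, rfl⟩
  have ht0 : t ≠ 0 := ht ▸ mul_ne_zero (Int.cast_ne_zero.2 hn) hdet0
  have hpqt : 4 * p ^ 3 + 27 * q ^ 2 = 3 * t ^ 2 := by
    rw [ht]; push_cast at hdet; linear_combination -hdet
  -- Cardano's quadratic resolvent: its discriminant is `(t/3)²`, so its roots `-q/2 ± t/6` are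
  -- rational and distinct, and at least one is nonzero.
  obtain ⟨r, hr0, hr⟩ : ∃ r : ℚ, r ≠ 0 ∧ r ^ 2 + q * r = p ^ 3 / 27 := by
    by_cases h : -q / 2 + t / 6 = 0
    · refine ⟨-q / 2 - t / 6, fun h' => ht0 (by linear_combination 3 * h - 3 * h'), ?_⟩
      linear_combination -hpqt / 108
    · exact ⟨-q / 2 + t / 6, h, by linear_combination -hpqt / 108⟩
  have hr' : (r : L) ^ 2 + q * r = p ^ 3 / 27 := by exact_mod_cast congrArg (Rat.cast (K := L)) hr
  have h0 : B 0 = 1 := by rw [hB]; simp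
  have h1 : B 1 = θ := by rw [hB]; simp
  have h2 : B 2 = θ ^ 2 := by rw [hB]; simp
  have hE : θ ^ 2 + (p : L) / 3 ≠ 0 := by
    intro h
    have := repr_three B (p / 3) 0 1 2
    have e : (p / 3) • B 0 + (0 : ℚ) • B 1 + (1 : ℚ) • B 2 = 0 := by
      rw [h0, h2, Rat.smul_def]
      push_cast
      simp
      linear_combination h
    rw [e] at this
    simp at this
  have hirr : ∀ s : ℚ, θ ≠ s := by
    intro s h
    have := repr_three B (-s) 1 0 1
    have e : (-s) • B 0 + (1 : ℚ) • B 1 + (0 : ℚ) • B 2 = 0 := by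
      rw [h0, h1, Rat.smul_def]
      push_cast
      simp [h]
    rw [e] at this
    simp at this
  -- Cardano's `u` satisfies `θ = u - p/(3u)` and `u³ = r`; reducing `u³` by `u² = θu + p/3` gives a
  -- linear equation for `u`, which places it in `L`.
  obtain ⟨u, hu⟩ : ∃ u, u = ((r : L) - p * θ / 3) / (θ ^ 2 + (p : L) / 3) := ⟨_, rfl⟩
  have huE : u * (θ ^ 2 + (p : L) / 3) = r - p * θ / 3 := by
    rw [hu, div_mul_cancel₀ _ hE]
  have hu2 : u ^ 2 = θ * u + p / 3 := by
    apply mul_right_cancel₀ (pow_ne_zero 2 hE)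
    have e1 : u ^ 2 * (θ ^ 2 + (p : L) / 3) ^ 2 = (r - p * θ / 3) ^ 2 := by rw [← huE]; ring
    have e2 : (θ * u + p / 3) * (θ ^ 2 + (p : L) / 3) ^ 2 =
        θ * (r - p * θ / 3) * (θ ^ 2 + (p : L) / 3) + p / 3 * (θ ^ 2 + (p : L) / 3) ^ 2 := by
      rw [← huE]; ring
    rw [e1, e2]
    linear_combination hr' - r * hθ
  have hu3 : u ^ 3 = r := by linear_combination (u + θ) * hu2 + huE
  refine ⟨u, r, hr0, hu3, fun s hs => ?_⟩
  have hs0 : (s : L) ≠ 0 := by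
    intro h
    rw [hs, h, zero_pow three_ne_zero] at hu3
    exact hr0 (by exact_mod_cast hu3.symm)
  refine hirr ((s ^ 2 - p / 3) / s) ?_
  push_cast
  rw [hs] at hu2
  field_simp
  linear_combination -3 * hu2

/-- Prime cubes are split off by induction. For a cube-free `N = ab²` with `a` squarefree, a
repeated prime of `b` or a common prime of `a` and `b` would have its cube dividing `N`. -/
theorem nat_exists_eq_mul_sq_mul_cube (N : ℕ) (hN : N ≠ 0) :
    ∃ a b c : ℕ, N = a * b ^ 2 * c ^ 3 ∧ Squarefree a ∧ Squarefree b ∧ a.Coprime b := by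
  induction N using Nat.strong_induction_on with
  | _ N ih =>
    by_cases h : ∃ l : ℕ, l.Prime ∧ l ^ 3 ∣ N
    · obtain ⟨l, hl, M, rfl⟩ := h
      have hM : M ≠ 0 := right_ne_zero_of_mul hN
      have hlt : M < l ^ 3 * M :=
        lt_mul_of_one_lt_left (Nat.pos_of_ne_zero hM) (Nat.one_lt_pow three_ne_zero hl.one_lt)
      obtain ⟨a, b, c, hM', ha, hb, hab⟩ := ih M hlt hM
      exact ⟨a, b, l * c, by rw [hM']; ring, ha, hb, hab⟩
    · push Not at h
      obtain ⟨a, b, hab, ha⟩ := Nat.sq_mul_squarefree N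
      refine ⟨a, b, 1, by rw [← hab]; ring, ha, ?_, ?_⟩
      · rw [Nat.squarefree_iff_prime_squarefree]
        intro l hl hlb
        refine h l hl (dvd_trans (pow_dvd_pow l (by norm_num : 3 ≤ 4)) ?_)
        rw [← hab]
        refine Dvd.dvd.mul_right ?_ _
        have := pow_dvd_pow_of_dvd hlb 2
        rwa [show (l * l) ^ 2 = l ^ 4 by ring] at this
      · refine Nat.Coprime.symm (Nat.coprime_of_dvd fun l hl hlb hla => h l hl ?_)
        rw [← hab, pow_succ]
        exact mul_dvd_mul (pow_dvd_pow_of_dvd hlb 2) hla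

/-- A cubic field whose discriminant is `-3` times a square is pure. -/
theorem exists_pureBasis_of_discr (h3 : Module.finrank ℚ L = 3) {n : ℤ} (hn : n ≠ 0)
    (hd : NumberField.discr L = -3 * n ^ 2) :
    ∃ (a b : ℕ) (B : Module.Basis (Fin 3) ℚ L), Squarefree a ∧ Squarefree b ∧ a.Coprime b ∧
      IsPureBasis a b B := by
  obtain ⟨u, r, hr0, hu, hirr⟩ := exists_cube_root h3 hn hd
  obtain ⟨a, b, c, hN, ha, hb, hab⟩ := nat_exists_eq_mul_sq_mul_cube (r.num.natAbs * r.den ^ 2)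
    (mul_ne_zero (Int.natAbs_ne_zero.2 (Rat.num_ne_zero.2 hr0)) (pow_ne_zero _ r.den_ne_zero))
  have hc0 : c ≠ 0 := by
    rintro rfl
    rw [zero_pow three_ne_zero, mul_zero] at hN
    exact mul_ne_zero (Int.natAbs_ne_zero.2 (Rat.num_ne_zero.2 hr0))
      (pow_ne_zero _ r.den_ne_zero) hN
  have hcQ : (c : ℚ) ≠ 0 := Nat.cast_ne_zero.2 hc0
  have hdQ : (r.den : ℚ) ≠ 0 := Nat.cast_ne_zero.2 r.den_ne_zero
  -- The sign of `r` is absorbed in the cube root, so the rescaled generator has cube exactly `ab²`.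
  obtain ⟨ε, hε, hεN⟩ : ∃ ε : ℚ, ε ^ 2 = 1 ∧ ε * (r * r.den ^ 3) = a * b ^ 2 * c ^ 3 := by
    have h1 : ((r.num.natAbs : ℚ)) * r.den ^ 2 = a * b ^ 2 * c ^ 3 := by exact_mod_cast hN
    have h2 := Rat.mul_den_eq_num r
    rcases Int.natAbs_eq r.num with h | h
    · have h4 := congrArg (Int.cast (R := ℚ)) h
      rw [Int.cast_natCast] at h4
      exact ⟨1, by norm_num, by linear_combination r.den ^ 2 * h2 + r.den ^ 2 * h4 + h1⟩
    · have h4 := congrArg (Int.cast (R := ℚ)) h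
      rw [Int.cast_neg, Int.cast_natCast] at h4
      exact ⟨-1, by norm_num, by linear_combination -r.den ^ 2 * h2 - r.den ^ 2 * h4 + h1⟩
  have hε0 : ε ≠ 0 := by
    rintro rfl
    norm_num at hε
  have hκ : ε * r.den / c ≠ 0 := div_ne_zero (mul_ne_zero hε0 hdQ) hcQ
  have hκL : ((ε * r.den / c : ℚ) : L) ≠ 0 := Rat.cast_ne_zero.2 hκ
  obtain ⟨B, hB, -⟩ := exists_isPureBasis (a := a) h3 hb.ne_zero
    (θ := ((ε * r.den / c : ℚ) : L) * u) (by
      intro s hs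
      refine hirr (s / (ε * r.den / c)) ?_
      rw [Rat.cast_div, ← hs, mul_div_cancel_left₀ _ hκL]) (by
      rw [mul_pow, hu]
      have : (ε * r.den / c) ^ 3 * r = a * b ^ 2 := by
        field_simp
        linear_combination ε ^ 2 * hεN + a * b ^ 2 * c ^ 3 * hε
      exact_mod_cast congrArg (Rat.cast (K := L)) this)
  exact ⟨a, b, B, ha, hb, hab, hB⟩

end Classification

/-! ### Isomorphisms of pure cubic fields, and their realisation in `ℝ` -/

section Isomorphism

variable {L K : Type} [Field L] [NumberField L] [Field K] [NumberField K]

/-- The multiplication table of a pure basis depends only on `a` and `b`. -/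
theorem IsPureBasis.nonempty_ringEquiv {a b : ℕ} {B : Module.Basis (Fin 3) ℚ L}
    {C : Module.Basis (Fin 3) ℚ K} (hB : IsPureBasis a b B) (hC : IsPureBasis a b C) :
    Nonempty (L ≃+* K) := by
  let f := B.equiv C (Equiv.refl _)
  have hf : ∀ x y z : ℚ, f (x • B 0 + y • B 1 + z • B 2) = x • C 0 + y • C 1 + z • C 2 := by
    intro x y z
    simp [f]
  refine ⟨{ f with map_mul' := fun α β => ?_ }⟩
  change f (α * β) = f α * f β
  rw [Module.Basis.eq_sum_three B α, Module.Basis.eq_sum_three B β, hB.mul, hf, hf, hf, hC.mul]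

theorem IsPureBasis.map_ringEquiv {a b : ℕ} {B : Module.Basis (Fin 3) ℚ L}
    (hB : IsPureBasis a b B) (f : L ≃+* K) :
    ∃ C : Module.Basis (Fin 3) ℚ K, IsPureBasis a b C := by
  let g : L ≃ₗ[ℚ] K := f.toAddEquiv.toLinearEquiv fun c x => by simp [Rat.smul_def]
  have e : ∀ i, B.map g i = f (B i) := fun i => by simp [g]
  refine ⟨B.map g, ?_, ?_, ?_, ?_⟩
  · rw [e, hB.zero, map_one]
  · rw [e, e, ← map_pow, hB.sq_one, map_mul, map_natCast]
  · rw [e, e, ← map_pow, hB.sq_two, map_mul, map_natCast]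
  · rw [e, e, ← map_mul, hB.one_mul_two, map_mul, map_natCast, map_natCast]

/-- The pure bases of a pure cubic field. -/
theorem IsPureBasis.eq_cube_mul {a b a' b' : ℕ} {B C : Module.Basis (Fin 3) ℚ L}
    (hB : IsPureBasis a b B) (hC : IsPureBasis a' b' C) (hab : (a * b : ℚ) ≠ 0) :
    ∃ y : ℚ, (a' * b' ^ 2 : ℚ) = y ^ 3 * (a * b ^ 2) ∨ (a' * b' ^ 2 : ℚ) = y ^ 3 * (a ^ 2 * b) := by
  have t1 : Algebra.trace ℚ L (C 1) = 0 := by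
    have := hC.trace 0 1 0
    simpa using this
  have t2 : Algebra.trace ℚ L (C 1 * C 1) = 0 := by
    have := hC.trace 0 0 b'
    rw [← sq, hC.sq_one]
    rw [hC.coe_smul, mul_zero] at this
    simpa using this
  have hcube : C 1 ^ 3 = (a' * b' ^ 2 : L) := by
    linear_combination C 1 * hC.sq_one + b' * hC.one_mul_two
  have hcubeB1 : B 1 ^ 3 = (a * b ^ 2 : L) := by
    linear_combination B 1 * hB.sq_one + b * hB.one_mul_two
  have hcubeB2 : B 2 ^ 3 = (a ^ 2 * b : L) := by
    linear_combination B 2 * hB.sq_two + a * hB.one_mul_two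
  have hφ := Module.Basis.eq_sum_three B (C 1)
  generalize B.repr (C 1) 0 = x at hφ
  generalize B.repr (C 1) 1 = y at hφ
  generalize B.repr (C 1) 2 = z at hφ
  rw [hφ, hB.trace] at t1
  -- Both `C 1` and its square have trace zero; the first kills `x`, the second gives `yz = 0`. So
  -- `C 1` is a rational multiple of one of the two cube roots in `B`.
  have hx : x = 0 := by linarith
  rw [hφ, hB.mul, hB.trace, hx] at t2
  have hyz : y * z = 0 := by
    apply mul_left_cancel₀ hab
    linear_combination t2 / 6
  rw [hφ, hB.coe_smul, hx] at hcube
  rcases mul_eq_zero.1 hyz with h | h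
  · refine ⟨z, Or.inr ?_⟩
    rw [h] at hcube
    have : ((a' * b' ^ 2 : ℚ) : L) = ((z ^ 3 * (a ^ 2 * b) : ℚ) : L) := by
      push_cast at hcube ⊢
      linear_combination -hcube + z ^ 3 * hcubeB2
    exact_mod_cast this
  · refine ⟨y, Or.inl ?_⟩
    rw [h] at hcube
    have : ((a' * b' ^ 2 : ℚ) : L) = ((y ^ 3 * (a * b ^ 2) : ℚ) : L) := by
      push_cast at hcube ⊢
      linear_combination -hcube + y ^ 3 * hcubeB1
    exact_mod_cast this

theorem IsPureBasis.not_cube {a b : ℕ} {B : Module.Basis (Fin 3) ℚ L}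
    (hB : IsPureBasis a b B) (hb : b ≠ 0) (r : ℚ) : r ^ 3 ≠ a * b ^ 2 := by
  intro h
  have hcubeB1 : B 1 ^ 3 = (a * b ^ 2 : L) := by
    linear_combination B 1 * hB.sq_one + b * hB.one_mul_two
  have h' : (r : L) ^ 3 = a * b ^ 2 := by exact_mod_cast congrArg (Rat.cast (K := L)) h
  -- The factorisation of `θ³ - r³` with `θ² = b * B 2`; linear independence of the basis makes both
  -- factors nonzero.
  have hprod : (B 1 - r) * (r ^ 2 + r * B 1 + b * B 2) = 0 := by
    rw [← hB.sq_one]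
    linear_combination hcubeB1 - h'
  rcases mul_eq_zero.1 hprod with h | h
  · have := repr_three B (-r) 1 0 1
    rw [hB.coe_smul] at this
    have e : ((-r : ℚ) : L) + ((1 : ℚ) : L) * B 1 + ((0 : ℚ) : L) * B 2 = 0 := by
      push_cast; linear_combination h
    rw [e] at this
    simp at this
  · have := repr_three B (r ^ 2) r b 2
    rw [hB.coe_smul] at this
    have e : ((r ^ 2 : ℚ) : L) + (r : L) * B 1 + ((b : ℚ) : L) * B 2 = 0 := by
      push_cast; linear_combination h
    rw [e] at this
    simp at this
    exact hb (by exact_mod_cast this.symm)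

/-- The pure cubic subfields of `ℝ`. -/
theorem cbrtField_exists_pureBasis {a b : ℕ} (hb : b ≠ 0)
    (hm : ∀ r : ℚ, r ^ 3 ≠ a * b ^ 2) :
    Module.finrank ℚ (cbrtField (a * b ^ 2)) = 3 ∧
      ∃ B : Module.Basis (Fin 3) ℚ (cbrtField (a * b ^ 2)), IsPureBasis a b B := by
  obtain ⟨m, hmdef⟩ : ∃ m, m = a * b ^ 2 := ⟨_, rfl⟩
  obtain ⟨x, hx⟩ : ∃ x : ℝ, x = (m : ℝ) ^ (1 / 3 : ℝ) := ⟨_, rfl⟩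
  have hx3 : x ^ 3 = m := by
    rw [hx, ← Real.rpow_natCast, ← Real.rpow_mul (Nat.cast_nonneg m)]
    norm_num
  have hm' : ∀ r : ℚ, r ^ 3 ≠ m := by
    intro r h
    apply hm r
    rw [h, hmdef]
    push_cast
    ring
  have hirr := X_pow_sub_C_irreducible_of_prime (K := ℚ) Nat.prime_three hm'
  have hmin : minpoly ℚ x = Polynomial.X ^ 3 - Polynomial.C (m : ℚ) := by
    refine (minpoly.eq_of_irreducible_of_monic hirr ?_ (by monicity!)).symm
    simp [hx3]
  have hint : IsIntegral ℚ x := by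
    refine IsIntegral.of_pow (n := 3) (by norm_num) ?_
    rw [hx3]
    exact isIntegral_algebraMap (R := ℚ) (x := (m : ℚ))
  have hfin : Module.finrank ℚ (cbrtField m) = 3 := by
    unfold cbrtField
    rw [← hx, IntermediateField.adjoin.finrank hint, hmin]
    exact Polynomial.natDegree_X_pow_sub_C
  rw [← hmdef]
  refine ⟨hfin, ?_⟩
  have hxmem : x ∈ cbrtField m := by
    unfold cbrtField
    rw [← hx]
    exact IntermediateField.mem_adjoin_simple_self ℚ x
  obtain ⟨B, hB, -⟩ := exists_isPureBasis (a := a) hfin hb (θ := (⟨x, hxmem⟩ : cbrtField m))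
    (by
      intro r h
      have h' : x = r := by
        have := congrArg (algebraMap (cbrtField m) ℝ) h
        rwa [map_ratCast] at this
      apply hm' r
      rw [h'] at hx3
      exact_mod_cast hx3)
    (by
      apply (algebraMap (cbrtField m) ℝ).injective
      rw [map_pow, map_mul, map_pow, map_natCast, map_natCast]
      change x ^ 3 = _
      rw [hx3, hmdef]
      push_cast
      ring)
  exact ⟨B, hB⟩

end Isomorphism
end PureCubic

end

noncomputable section
open NumberField IntermediateField
namespace PureCubic

/-! ### Exponent vectors modulo cubes -/

section Exponents

variable {m : ℕ} {q : Fin m → ℕ}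

/-- The cube collects the carries that appear when the lifts to `{0, 1, 2}` are added and reduced
modulo 3. -/
theorem exists_prod_add (hq : ∀ j, q j ≠ 0) (k l : Fin m → ZMod 3) :
    ∃ u : ℚ, u ≠ 0 ∧ (∏ j, (q j : ℚ) ^ ((k + l) j).val) * u ^ 3 =
      (∏ j, (q j : ℚ) ^ (k j).val) * ∏ j, (q j : ℚ) ^ (l j).val := by
  have hq' : ∀ j, (q j : ℚ) ≠ 0 := fun j => Nat.cast_ne_zero.2 (hq j)
  refine ⟨∏ j, (q j : ℚ) ^ (((k j).val + (l j).val) / 3),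
    Finset.prod_ne_zero_iff.2 fun j _ => pow_ne_zero _ (hq' j), ?_⟩
  rw [← Finset.prod_pow, ← Finset.prod_mul_distrib, ← Finset.prod_mul_distrib]
  refine Finset.prod_congr rfl fun j _ => ?_
  rw [← pow_mul, ← pow_add, ← pow_add, Pi.add_apply, ZMod.val_add, mul_comm, Nat.mod_add_div]

theorem exponents_eq_of_eq_cube_mul (hq : ∀ j, (q j).Prime) (hqi : Function.Injective q)
    {k l : Fin m → ZMod 3} {y : ℚ}
    (h : ∏ j, (q j : ℚ) ^ (k j).val = y ^ 3 * ∏ j, (q j : ℚ) ^ (l j).val) : k = l := by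
  obtain ⟨u, hu, hkl⟩ := exists_prod_add (fun j => (hq j).ne_zero) (k - l) l
  rw [sub_add_cancel, h] at hkl
  have hl : ∏ j, (q j : ℚ) ^ (l j).val ≠ 0 :=
    Finset.prod_ne_zero_iff.2 fun j _ => pow_ne_zero _ (Nat.cast_ne_zero.2 (hq j).ne_zero)
  refine sub_eq_zero.1 (exponents_eq_zero_of_cube hq hqi _ (y * u) ?_)
  apply mul_right_cancel₀ hl
  rw [← hkl]
  ring

end Exponents

/-! ### Admissible lines and pure cubic fields of discriminant `-3n²` -/

section Lines

variable {s : ℕ} (p : Fin s → ℕ) (lam : Fin (s + 1) → ZMod 3)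

/-- The product of the primes with exponent `1`. -/
def primesOne : ℕ := ∏ i : Fin s, if lam i.succ = 1 then p i else 1

/-- The product of the primes with exponent `2`. -/
def primesTwo : ℕ := ∏ i : Fin s, if lam i.succ = 2 then p i else 1

theorem primeProduct_eq : primeProduct p lam = primesOne p lam * primesTwo p lam ^ 2 := by
  unfold primeProduct primesOne primesTwo
  rw [← Finset.prod_pow, ← Finset.prod_mul_distrib]
  refine Finset.prod_congr rfl fun i _ => ?_
  generalize lam i.succ = x
  have : x = 0 ∨ x = 1 ∨ x = 2 := by revert x; decide
  rcases this with rfl | rfl | rfl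
  · rw [if_neg (by decide), if_neg (by decide)]; simp
  · rw [if_pos rfl, if_neg (by decide), show (1 : ZMod 3).val = 1 from rfl]; simp
  · rw [if_pos rfl, if_neg (by decide), show (2 : ZMod 3).val = 2 from rfl]; simp

theorem primesOne_neg : primesOne p (-lam) = primesTwo p lam := by
  unfold primesOne primesTwo
  refine Finset.prod_congr rfl fun i _ => if_congr ?_ rfl rfl
  rw [Pi.neg_apply]
  generalize lam i.succ = x
  revert x; decide

theorem primesTwo_neg : primesTwo p (-lam) = primesOne p lam := by
  rw [← primesOne_neg, neg_neg]

variable {p lam}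

theorem primesOne_mul_primesTwo (h : ∀ i : Fin s, lam i.succ ≠ 0) :
    primesOne p lam * primesTwo p lam = ∏ i, p i := by
  unfold primesOne primesTwo
  rw [← Finset.prod_mul_distrib]
  refine Finset.prod_congr rfl fun i _ => ?_
  have h := h i
  generalize lam i.succ = x at h
  have : x = 1 ∨ x = 2 := by revert x; decide
  rcases this with rfl | rfl
  · rw [if_pos rfl, if_neg (by decide), mul_one]
  · rw [if_pos rfl, if_neg (by decide), one_mul]

theorem prod_cons_three (k : Fin (s + 1) → ZMod 3) :
    ∏ j, (((Fin.cons 3 p : Fin (s + 1) → ℕ) j : ℕ) : ℚ) ^ (k j).val =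
      3 ^ (k 0).val * ∏ i, (p i : ℚ) ^ (k i.succ).val := by
  rw [Fin.prod_univ_succ]
  simp

theorem cast_primeProduct : (primeProduct p lam : ℚ) = ∏ i, (p i : ℚ) ^ (lam i.succ).val := by
  unfold primeProduct
  push_cast
  rfl

theorem primeProduct_eq_cube_mul {mu : Fin (s + 1) → ZMod 3} (hpp : ∀ i, (p i).Prime)
    (hpi : Function.Injective p) (hl : lam 0 = 0) (hm : mu 0 = 0) {y : ℚ}
    (h : (primeProduct p lam : ℚ) = y ^ 3 * primeProduct p mu) : lam = mu := by
  rw [cast_primeProduct, cast_primeProduct] at h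
  have := exponents_eq_of_eq_cube_mul (k := fun i => lam i.succ) (l := fun i => mu i.succ) hpp hpi h
  funext j
  refine Fin.cases ?_ (fun i => ?_) j
  · rw [hl, hm]
  · exact congrFun this i

theorem primeProduct_ne_cube (hpp : ∀ i, (p i).Prime) (hpi : Function.Injective p)
    (hl : lam 0 = 0) (h0 : lam ≠ 0) (r : ℚ) :
    r ^ 3 ≠ (primesOne p lam : ℚ) * (primesTwo p lam : ℚ) ^ 2 := by
  intro h
  apply h0
  refine primeProduct_eq_cube_mul (mu := 0) (y := r) hpp hpi hl rfl ?_
  rw [h, primeProduct_eq]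
  simp [primeProduct]

theorem mem_span_singleton_iff (mu : Fin (s + 1) → ZMod 3) :
    mu ∈ Submodule.span (ZMod 3) {lam} ↔ mu = 0 ∨ mu = lam ∨ mu = -lam := by
  rw [Submodule.mem_span_singleton]
  constructor
  · rintro ⟨x, rfl⟩
    have : x = 0 ∨ x = 1 ∨ x = -1 := by revert x; decide
    rcases this with rfl | rfl | rfl
    · simp
    · simp
    · simp
  · rintro (rfl | rfl | rfl)
    · exact ⟨0, by simp⟩
    · exact ⟨1, by simp⟩
    · exact ⟨-1, by simp⟩

theorem span_singleton_eq_iff {mu : Fin (s + 1) → ZMod 3} (hmu : mu ≠ 0) :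
    Submodule.span (ZMod 3) {mu} = Submodule.span (ZMod 3) {lam} ↔ mu = lam ∨ mu = -lam := by
  constructor
  · intro h
    have : mu ∈ Submodule.span (ZMod 3) {lam} := h ▸ Submodule.mem_span_singleton_self mu
    exact ((mem_span_singleton_iff mu).1 this).resolve_left hmu
  · rintro (rfl | rfl)
    · rfl
    · rw [← Set.neg_singleton, Submodule.span_neg]

variable {n : ℤ}

theorem prod_primes_eq (hn : Squarefree n) (hpi : Function.Injective p)
    (hp : ∀ q : ℕ, (∃ i, p i = q) ↔ q.Prime ∧ (q : ℤ) ∣ n) {a : ℕ} (ha : a ∣ n.natAbs) :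
    (∏ i, if p i ∣ a then p i else 1) = a := by
  have hn' : Squarefree n.natAbs := Int.squarefree_natAbs.2 hn
  have ha' : Squarefree a := hn'.squarefree_of_dvd ha
  conv_rhs => rw [← Nat.prod_primeFactors_of_squarefree ha']
  rw [← Finset.prod_filter]
  have : a.primeFactors = (Finset.univ.filter fun i => p i ∣ a).image p := by
    ext l
    simp only [Nat.mem_primeFactors, Finset.mem_image, Finset.mem_filter, Finset.mem_univ, true_and]
    constructor
    · rintro ⟨hl, hla, -⟩
      obtain ⟨i, rfl⟩ := (hp l).2 ⟨hl, Int.natCast_dvd.2 (hla.trans ha)⟩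
      exact ⟨i, hla, rfl⟩
    · rintro ⟨i, hi, rfl⟩
      exact ⟨((hp _).1 ⟨i, rfl⟩).1, hi, ha'.ne_zero⟩
  rw [this, Finset.prod_image hpi.injOn]

theorem prod_primes_eq_natAbs (hn : Squarefree n) (hpi : Function.Injective p)
    (hp : ∀ q : ℕ, (∃ i, p i = q) ↔ q.Prime ∧ (q : ℤ) ∣ n) : ∏ i, p i = n.natAbs := by
  conv_rhs => rw [← prod_primes_eq hn hpi hp dvd_rfl]
  refine Finset.prod_congr rfl fun i _ => (if_pos ?_).symm
  exact Int.natCast_dvd.1 ((hp _).1 ⟨i, rfl⟩).2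

/-- Every `p_i` divides exactly one of `a` and `b`, which determines whether `λ_i` is `1` or `2`. -/
theorem exists_exponents (hn : Squarefree n) (hpi : Function.Injective p)
    (hp : ∀ q : ℕ, (∃ i, p i = q) ↔ q.Prime ∧ (q : ℤ) ∣ n) {a b : ℕ} (hab : a * b = n.natAbs)
    (hcop : a.Coprime b) : ∃ lam : Fin (s + 1) → ZMod 3, lam 0 = 0 ∧ (∀ i : Fin s, lam i.succ ≠ 0) ∧
      primesOne p lam = a ∧ primesTwo p lam = b := by
  refine ⟨Fin.cons 0 fun i => if p i ∣ a then 1 else 2, rfl, fun i => ?_, ?_, ?_⟩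
  · rw [Fin.cons_succ]
    split_ifs <;> decide
  · rw [← prod_primes_eq hn hpi hp (Dvd.intro _ hab)]
    unfold primesOne
    refine Finset.prod_congr rfl fun i _ => if_congr ?_ rfl rfl
    rw [Fin.cons_succ, prod_primes_eq hn hpi hp (Dvd.intro _ hab)]
    split_ifs with h
    · simp [h]
    · simp only [h, iff_false]; decide
  · conv_rhs => rw [← prod_primes_eq hn hpi hp (Dvd.intro_left _ hab)]
    unfold primesTwo
    refine Finset.prod_congr rfl fun i _ => if_congr ?_ rfl rfl
    rw [Fin.cons_succ]
    have hprime := ((hp _).1 ⟨i, rfl⟩).1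
    have hdvd : p i ∣ a * b := hab ▸ Int.natCast_dvd.1 ((hp _).1 ⟨i, rfl⟩).2
    split_ifs with h
    · refine iff_of_false (by decide) fun h' => ?_
      exact hprime.one_lt.ne' (Nat.dvd_one.1 (hcop ▸ Nat.dvd_gcd h h'))
    · exact iff_of_true rfl ((hprime.dvd_mul.1 hdvd).resolve_left h)

theorem classOf_eq_iff {L K : Type} [Field L] [NumberField L] [Field K] [NumberField K] :
    classOf L = classOf K ↔ Nonempty (L ≃+* K) :=
  ⟨fun h => Quotient.exact h, fun h => Quotient.sound h⟩

/-- The facts about `a = ∏_{λ_i = 1} p_i` and `b = ∏_{λ_i = 2} p_i` for an admissible `λ`. -/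
theorem Admissible.facts (hlam : Admissible p lam) (hn : Squarefree n)
    (hpi : Function.Injective p)
    (hp : ∀ q : ℕ, (∃ i, p i = q) ↔ q.Prime ∧ (q : ℤ) ∣ n) :
    Squarefree (primesOne p lam : ℤ) ∧ Squarefree (primesTwo p lam : ℤ) ∧
      IsCoprime (primesOne p lam : ℤ) (primesTwo p lam) ∧
      primesOne p lam * primesTwo p lam = n.natAbs ∧
      IsPmOneModNine (primesOne p lam * primesTwo p lam ^ 2) := by
  have hab : primesOne p lam * primesTwo p lam = n.natAbs := by
    rw [primesOne_mul_primesTwo hlam.2.1, prod_primes_eq_natAbs hn hpi hp]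
  have hn' : Squarefree n.natAbs := Int.squarefree_natAbs.2 hn
  rw [← hab, Nat.squarefree_mul_iff] at hn'
  refine ⟨Int.squarefree_natCast.2 hn'.2.1, Int.squarefree_natCast.2 hn'.2.2,
    Nat.isCoprime_iff_coprime.2 hn'.1, hab, ?_⟩
  have := hlam.2.2
  rw [primeProduct_eq] at this
  push_cast at this
  exact this

/-- The pure cubic field attached to an admissible `λ`. -/
theorem Admissible.cbrtField_pureBasis (hlam : Admissible p lam) (h0 : lam ≠ 0)
    (hn : Squarefree n) (hpi : Function.Injective p)
    (hp : ∀ q : ℕ, (∃ i, p i = q) ↔ q.Prime ∧ (q : ℤ) ∣ n) :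
    Module.finrank ℚ (cbrtField (primeProduct p lam)) = 3 ∧
      ∃ B : Module.Basis (Fin 3) ℚ (cbrtField (primeProduct p lam)),
        IsPureBasis (primesOne p lam) (primesTwo p lam) B := by
  rw [primeProduct_eq]
  have hb : primesTwo p lam ≠ 0 := by
    have := (hlam.facts hn hpi hp).2.1.ne_zero
    exact_mod_cast this
  exact cbrtField_exists_pureBasis hb
    (primeProduct_ne_cube (fun i => ((hp _).1 ⟨i, rfl⟩).1) hpi hlam.1 h0)

/-- The correspondence between admissible lines and quasi-monogenic cubic fields, for a space `V`
in which the admissible vectors are described by the index forms. -/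
theorem exists_bijOn_admissibleLines (hn : Squarefree n) (hn3 : ¬ (3 : ℤ) ∣ n)
    (hpi : Function.Injective p) (hp : ∀ q : ℕ, (∃ i, p i = q) ↔ q.Prime ∧ (q : ℤ) ∣ n)
    (V : Submodule (ZMod 3) (Fin (s + 1) → ZMod 3))
    (hV : ∀ lam, lam ≠ 0 → Admissible p lam → (lam ∈ V ↔
      ∃ X Y : ℚ, 3 * (primesTwo p lam * X ^ 3 - primesOne p lam * Y ^ 3) = 1)) :
    ∃ Φ : Submodule (ZMod 3) (Fin (s + 1) → ZMod 3) → NumFldClass,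
      Set.BijOn Φ (admissibleLines p V) (quasiMonogenicCubicFields (-3 * n ^ 2)) ∧
      ∀ lam ∈ V, lam ≠ 0 → Admissible p lam →
        Φ (Submodule.span (ZMod 3) {lam}) = classOf (cbrtField (primeProduct p lam)) := by
  classical
  have hpp : ∀ i, (p i).Prime := fun i => ((hp _).1 ⟨i, rfl⟩).1
  have hsq : ∀ a b : ℕ, a * b = n.natAbs → ((a * b : ℤ)) ^ 2 = n ^ 2 := by
    intro a b h
    rw [← Nat.cast_mul, h, Int.natAbs_sq]
  -- A chosen admissible generator defines the value; `classOf ℚ` is a dummy off the admissible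
  -- lines. Another generator differs by a sign, which swaps the two cube roots and hence gives an
  -- isomorphic field.
  let Φ : Submodule (ZMod 3) (Fin (s + 1) → ZMod 3) → NumFldClass := fun l =>
    if h : ∃ lam ∈ V, lam ≠ 0 ∧ Admissible p lam ∧ l = Submodule.span (ZMod 3) {lam} then
      classOf (cbrtField (primeProduct p h.choose)) else classOf ℚ
  have hΦ : ∀ lam ∈ V, lam ≠ 0 → Admissible p lam →
      Φ (Submodule.span (ZMod 3) {lam}) = classOf (cbrtField (primeProduct p lam)) := by
    intro lam hlV h0 hlam
    have h : ∃ mu ∈ V, mu ≠ 0 ∧ Admissible p mu ∧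
      Submodule.span (ZMod 3) {lam} = Submodule.span (ZMod 3) {mu} := ⟨lam, hlV, h0, hlam, rfl⟩
    have e : Φ (Submodule.span (ZMod 3) {lam}) =
      classOf (cbrtField (primeProduct p h.choose)) := dif_pos h
    obtain ⟨-, hc0, hcA, hcs⟩ := h.choose_spec
    rw [e, classOf_eq_iff]
    obtain ⟨-, C, hC⟩ := hcA.cbrtField_pureBasis hc0 hn hpi hp
    obtain ⟨-, B, hB⟩ := hlam.cbrtField_pureBasis h0 hn hpi hp
    rcases (span_singleton_eq_iff hc0).1 hcs.symm with h' | h'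
    · rw [h']
      exact ⟨RingEquiv.refl _⟩
    · have hCs := hC.swap
      have h1 : primesOne p lam = primesTwo p h.choose := by rw [h', primesTwo_neg]
      have h2 : primesTwo p lam = primesOne p h.choose := by rw [h', primesOne_neg]
      rw [← h1, ← h2] at hCs
      exact hCs.nonempty_ringEquiv hB
  refine ⟨Φ, ⟨?_, ?_, ?_⟩, hΦ⟩
  · rintro l ⟨lam, hlV, h0, hlam, rfl⟩
    rw [hΦ lam hlV h0 hlam]
    obtain ⟨h3, B, hB⟩ := hlam.cbrtField_pureBasis h0 hn hpi hp
    obtain ⟨ha, hb, hab, hprod, hm⟩ := hlam.facts hn hpi hp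
    obtain ⟨β, hβ, hd⟩ := hB.exists_integralBasis ha hb hab hm
    refine ⟨⟨cbrtField (primeProduct p lam)⟩, rfl, h3, ?_, β, hβ, ?_⟩
    · rw [← hsq _ _ hprod]
      exact hd
    · refine (hB.exists_indexForm_iff hd ?_ β hβ).2 ((hV lam h0 hlam).1 hlV)
      exact mul_ne_zero (by exact_mod_cast ha.ne_zero) (by exact_mod_cast hb.ne_zero)
  · rintro l ⟨lam, hlV, h0, hlam, rfl⟩ l' ⟨mu, hmV, hm0, hmu, rfl⟩ heq
    rw [hΦ lam hlV h0 hlam, hΦ mu hmV hm0 hmu, classOf_eq_iff] at heq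
    obtain ⟨f⟩ := heq
    obtain ⟨-, B, hB⟩ := hlam.cbrtField_pureBasis h0 hn hpi hp
    obtain ⟨-, C, hC⟩ := hmu.cbrtField_pureBasis hm0 hn hpi hp
    obtain ⟨C', hC'⟩ := hC.map_ringEquiv f.symm
    obtain ⟨ha, hb, -⟩ := hlam.facts hn hpi hp
    obtain ⟨y, hy⟩ := hB.eq_cube_mul hC'
      (mul_ne_zero (by exact_mod_cast ha.ne_zero) (by exact_mod_cast hb.ne_zero))
    rw [eq_comm, span_singleton_eq_iff hm0]
    rcases hy with h | h
    · left
      refine primeProduct_eq_cube_mul (y := y) hpp hpi hmu.1 hlam.1 ?_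
      rw [primeProduct_eq, primeProduct_eq]
      push_cast
      exact h
    · right
      refine primeProduct_eq_cube_mul (y := y) hpp hpi hmu.1 (by simp [hlam.1]) ?_
      rw [primeProduct_eq, primeProduct_eq, primesOne_neg, primesTwo_neg]
      push_cast
      rw [h]
      ring
  · rintro C ⟨L, rfl, h3, hd, β, hβ, hq⟩
    have hn0 : n ≠ 0 := hn.ne_zero
    obtain ⟨a, b, B, ha, hb, hab, hB⟩ := exists_pureBasis_of_discr h3 hn0 hd
    have ha' := Int.squarefree_natCast.2 ha
    have hb' := Int.squarefree_natCast.2 hb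
    obtain ⟨hm, hprod⟩ := hB.of_discr_eq h3 ha' hb' (Nat.isCoprime_iff_coprime.2 hab) hn3 hd
    obtain ⟨lam, hl0, hls, rfl, rfl⟩ := exists_exponents hn hpi hp hprod hab
    -- A zero vector would mean `a = b = 1`, and `1` is a cube. This covers `n = ±1`, where there
    -- are no primes.
    have h0 : lam ≠ 0 := by
      rintro rfl
      refine hB.not_cube hb.ne_zero 1 ?_
      simp [primesOne, primesTwo, show ¬ ((0 : ZMod 3) = 2) by decide]
    have hlam : Admissible p lam := by
      refine ⟨hl0, hls, ?_⟩
      rw [primeProduct_eq]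
      push_cast
      exact hm
    have hd' : NumberField.discr L.carrier = -3 * (primesOne p lam * primesTwo p lam) ^ 2 := by
      rw [hd, hsq _ _ hprod]
    have hlV : lam ∈ V := by
      rw [hV lam h0 hlam]
      refine (hB.exists_indexForm_iff hd' ?_ β hβ).1 hq
      exact mul_ne_zero (by exact_mod_cast ha.ne_zero) (by exact_mod_cast hb.ne_zero)
    refine ⟨_, ⟨lam, hlV, h0, hlam, rfl⟩, ?_⟩
    rw [hΦ lam hlV h0 hlam, classOf_eq_iff]
    obtain ⟨-, C, hC⟩ := hlam.cbrtField_pureBasis h0 hn hpi hp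
    exact hC.nonempty_ringEquiv hB

end Lines
end PureCubic

end

noncomputable section
open NumberField IntermediateField
namespace PureCubic

/-! ### Rational points on `E^{-27D}` versus rational solutions of the index form equation -/

section Link

/-- Scalars of `𝔽₃` act as integer multiples, so the span of the images of generators is no larger
than the image of the group. -/
theorem mem_rowSpace_iff {G : Type*} [AddCommGroup G] {a b : ℕ} (Λ : G →+ (Fin b → ZMod 3))
    (P : Fin a → G) (hP : AddSubgroup.closure (Set.range P) = ⊤) (v : Fin b → ZMod 3) :
    v ∈ rowSpace (Matrix.of fun i => Λ (P i)) ↔ ∃ g, Λ g = v := by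
  have hrange : Set.range (Matrix.of fun i => Λ (P i)).row = Set.range fun i => Λ (P i) := rfl
  rw [rowSpace, hrange]
  constructor
  · intro hv
    induction hv using Submodule.span_induction with
    | mem x hx =>
      obtain ⟨i, rfl⟩ := hx
      exact ⟨P i, rfl⟩
    | zero => exact ⟨0, map_zero Λ⟩
    | add x y _ _ hx hy =>
      obtain ⟨g, rfl⟩ := hx
      obtain ⟨g', rfl⟩ := hy
      exact ⟨g + g', map_add Λ g g'⟩
    | smul c x _ hx =>
      obtain ⟨g, rfl⟩ := hx
      refine ⟨c.val • g, ?_⟩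
      rw [map_nsmul, ← Nat.cast_smul_eq_nsmul (ZMod 3), ZMod.natCast_zmod_val]
  · rintro ⟨g, rfl⟩
    have hg : g ∈ AddSubgroup.closure (Set.range P) := hP ▸ AddSubgroup.mem_top g
    induction hg using AddSubgroup.closure_induction with
    | mem x hx =>
      obtain ⟨i, rfl⟩ := hx
      exact Submodule.subset_span ⟨i, rfl⟩
    | zero =>
      rw [map_zero]
      exact Submodule.zero_mem _
    | add x y _ _ hx hy =>
      rw [map_add]
      exact Submodule.add_mem _ hx hy
    | neg x _ hx =>
      rw [map_neg]
      exact Submodule.neg_mem _ hx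

variable {a b e x y r : ℚ}

theorem exists_sub_eq_nine (ha : a ≠ 0) (hb : b ≠ 0) (hr : r ≠ 0) (he : e = 9 * (a * b))
    (hxy : y ^ 2 = x ^ 3 + e ^ 2 / 4) (hy : y + e / 2 = r ^ 3 * (a * b ^ 2)) :
    ∃ t, b * r ^ 3 - a * t ^ 3 = 9 := by
  -- From `x³ = r³ab²(r³ab² - 9ab)`, the cube of this quotient is `(br³ - 9)/a`.
  refine ⟨x / (a * b * r), ?_⟩
  obtain rfl : y = r ^ 3 * (a * b ^ 2) - e / 2 := by linear_combination hy
  have hx : x ^ 3 = r ^ 3 * (a * b ^ 2) * (r ^ 3 * (a * b ^ 2) - e) := by linear_combination -hxy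
  rw [div_pow, hx, he]
  field_simp
  ring

/-- Otherwise `-3aY³ = 1`, whose left side has 3-adic valuation congruent to 1 modulo 3. -/
theorem ne_zero_of_three_mul_eq_one {a b : ℕ} (ha : ¬ 3 ∣ a) {X Y : ℚ}
    (h : 3 * (b * X ^ 3 - a * Y ^ 3) = 1) : X ≠ 0 := by
  rintro rfl
  have ha0 : (a : ℚ) ≠ 0 := by
    intro h0
    rw [h0] at h
    norm_num at h
  have hY : Y ≠ 0 := by
    rintro rfl
    norm_num at h
  have h' : ((3 : ℕ) : ℚ) * (a * (-Y) ^ 3) = 1 := by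
    push_cast
    linear_combination h
  have hY' : -Y ≠ 0 := neg_ne_zero.2 hY
  have h3 := congrArg (padicValRat 3) h'
  rw [padicValRat.mul (by norm_num) (mul_ne_zero ha0 (pow_ne_zero _ hY')),
    padicValRat.mul ha0 (pow_ne_zero _ hY'), padicValRat.pow, padicValRat.one,
    padicValRat.of_nat, padicValRat.of_nat, padicValNat.self (by norm_num),
    padicValNat.eq_zero_of_not_dvd ha] at h3
  push_cast at h3
  omega

variable {s : ℕ} {p : Fin s → ℕ} {lam : Fin (s + 1) → ZMod 3} {D : ℚ} {η : ZMod 3} {n : ℤ}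

theorem prod_cons_three_of_zero {k : Fin (s + 1) → ZMod 3} (h0 : k 0 = 0) :
    ∏ j, (((Fin.cons 3 p : Fin (s + 1) → ℕ) j : ℕ) : ℚ) ^ (k j).val =
      primesOne p k * primesTwo p k ^ 2 := by
  rw [prod_cons_three, h0, ← cast_primeProduct, primeProduct_eq]
  simp

/-- An admissible `λ` is the coefficient vector of the Kummer class of a rational point if and only
if the index form of the corresponding pure cubic field represents `1` over `ℚ`. -/
theorem exists_kummerHom_eq_iff (hn : Squarefree n) (hn3 : ¬ (3 : ℤ) ∣ n)
    (hpi : Function.Injective p) (hp : ∀ q : ℕ, (∃ i, p i = q) ↔ q.Prime ∧ (q : ℤ) ∣ n)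
    (he : e ^ 2 = -27 * D) (hen : e = 9 * n.natAbs) (hη : η * η = 1)
    (hq : ∀ j, ((Fin.cons 3 p : Fin (s + 1) → ℕ) j).Prime)
    (hqi : Function.Injective (Fin.cons 3 p : Fin (s + 1) → ℕ))
    (hqe : ∀ l : ℕ, l.Prime → (∀ j, (Fin.cons 3 p : Fin (s + 1) → ℕ) j ≠ l) →
      padicValRat l e = 0)
    (Λ : Pts (-27 * D) ℚ →+ (Fin (s + 1) → ZMod 3))
    (hΛ : ∀ X Y h (k : Fin (s + 1) → ZMod 3) (r : ℚ), r ≠ 0 →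
      Y + e / 2 = r ^ 3 * ∏ j, (((Fin.cons 3 p : Fin (s + 1) → ℕ) j : ℕ) : ℚ) ^ (k j).val →
      Λ (.some X Y h) = fun j => η * k j)
    (h0 : lam ≠ 0) (hlam : Admissible p lam) :
    (∃ P, Λ P = lam) ↔
      ∃ X Y : ℚ, 3 * (primesTwo p lam * X ^ 3 - primesOne p lam * Y ^ 3) = 1 := by
  obtain ⟨ha, hb, -, hab, -⟩ := hlam.facts hn hpi hp
  have hη' : η = 1 ∨ η = -1 := by
    clear hΛ
    revert η
    decide
  have ha0 : (primesOne p lam : ℚ) ≠ 0 := by exact_mod_cast ha.ne_zero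
  have hb0 : (primesTwo p lam : ℚ) ≠ 0 := by exact_mod_cast hb.ne_zero
  have hen' : e = 9 * (primesOne p lam * primesTwo p lam) := by
    rw [hen, ← hab]
    push_cast
    rfl
  have he0 : e ≠ 0 := by
    rw [hen']
    positivity
  have heD : algebraMap ℚ ℚ (-27 * D) = e ^ 2 := he.symm
  constructor
  · rintro ⟨P, hP⟩
    rcases P with _ | ⟨x, y, h⟩
    · exact absurd (hP.symm.trans (map_zero Λ)) h0
    have hxy : y ^ 2 = x ^ 3 + e ^ 2 / 4 := by
      rw [← heD]
      exact ((nonsingular_iff _ _ _).1 h).1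
    have hy : y + e / 2 ≠ 0 := by
      intro hy
      -- If `y = -e/2`, the negative point has `y + e/2` replaced by `e = 3² p_1 ⋯ p_s`, so the
      -- coefficient at the prime 3 is nonzero, against `λ_0 = 0`.
      have h1 : Λ (-(.some x y h)) = fun j =>
          η * (Fin.cons 2 (fun _ => 1) : Fin (s + 1) → ZMod 3) j := by
        rw [neg_some_eq]
        refine hΛ _ _ _ _ 1 one_ne_zero ?_
        rw [prod_cons_three]
        simp only [Fin.cons_zero, Fin.cons_succ]
        have h2 : (2 : ZMod 3).val = 2 := rfl
        have h1' : (1 : ZMod 3).val = 1 := rfl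
        simp only [h2, h1', pow_one]
        rw [← Nat.cast_prod, prod_primes_eq_natAbs hn hpi hp]
        linear_combination hen - hy
      rw [map_neg, hP] at h1
      have h2 := congrFun h1 0
      simp only [Pi.neg_apply, hlam.1, neg_zero, Fin.cons_zero] at h2
      rcases hη' with rfl | rfl <;> revert h2 <;> decide
    obtain ⟨k, r, hr, hk⟩ := exists_eq_cube_mul he he0 hq hqi hqe h hy
    have hlk := hΛ x y h k r hr hk
    rw [hP] at hlk
    rcases hη' with rfl | rfl
    · obtain rfl : lam = k := by simpa using hlk
      rw [prod_cons_three_of_zero hlam.1] at hk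
      obtain ⟨t, ht⟩ := exists_sub_eq_nine ha0 hb0 hr hen' hxy hk
      refine ⟨r / 3, t / 3, ?_⟩
      linear_combination ht / 9
    -- For `η = -1` the cube class of `y + e/2` is that of `a²b`; the roles of `a` and `b` are
    -- exchanged, and the signs of the solution restore the equation.
    · obtain rfl : k = -lam := by
        rw [hlk]
        ext j
        simp
      rw [prod_cons_three_of_zero (by simp [hlam.1]), primesOne_neg, primesTwo_neg] at hk
      obtain ⟨t, ht⟩ := exists_sub_eq_nine hb0 ha0 hr (by rw [hen']; ring) hxy hk
      refine ⟨-t / 3, -r / 3, ?_⟩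
      linear_combination ht / 9
  · rintro ⟨X, Y, hXY⟩
    have ha3 : ¬ 3 ∣ primesOne p lam := by
      intro h
      apply hn3
      exact Int.natCast_dvd.2 ((h.mul_right _).trans hab.dvd)
    have hX := ne_zero_of_three_mul_eq_one ha3 hXY
    obtain ⟨a, ha'⟩ : ∃ a : ℚ, a = primesOne p lam := ⟨_, rfl⟩
    obtain ⟨b, hb'⟩ : ∃ b : ℚ, b = primesTwo p lam := ⟨_, rfl⟩
    rw [← ha', ← hb'] at hXY hen'
    -- The ordinate is chosen so that `y + e/2 = (3X)³ab²`; then `y - e/2 = 27a²bY³` by the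
    -- equation, and the abscissa is the cube root of the product.
    have hns : ((curve (-27 * D)).baseChange ℚ).toAffine.Nonsingular
        (9 * a * b * X * Y) (27 * X ^ 3 * (a * b ^ 2) - e / 2) := by
      rw [nonsingular_iff, heD]
      refine ⟨?_, ?_⟩
      · rw [hen']
        linear_combination (243 * a ^ 2 * b ^ 3 * X ^ 3) * hXY
      · by_contra! hc
        apply he0
        have h1 : (27 * X ^ 3 * (a * b ^ 2) - e / 2) ^ 2 = (9 * a * b * X * Y) ^ 3 + e ^ 2 / 4 := by
          rw [hen']
          linear_combination (243 * a ^ 2 * b ^ 3 * X ^ 3) * hXY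
        rw [hc.1, hc.2] at h1
        nlinarith
    have hΛP := hΛ _ _ hns lam (3 * X) (mul_ne_zero three_ne_zero hX) (by
      rw [prod_cons_three_of_zero hlam.1, ← ha', ← hb']
      ring)
    rcases hη' with rfl | rfl
    · exact ⟨_, hΛP.trans (by simp)⟩
    · refine ⟨-(.some _ _ hns), ?_⟩
      rw [map_neg, hΛP]
      ext j
      simp

end Link

end PureCubic

end

/-! ### Assembly of the two statements -/

theorem mainTheorem2 (n : ℤ) (hn : ¬ (3 : ℤ) ∣ n) (D : ℤ) (hD : D = -3 * n ^ 2)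
    -- the primes `p_1, …, p_s` dividing `n`
    (s : ℕ) (p : Fin s → ℕ) (hp_inj : Function.Injective p)
    (hp : ∀ q : ℕ, (∃ i, p i = q) ↔ q.Prime ∧ (q : ℤ) ∣ n)
    -- a primitive cube root of unity, a square root of `D`, and cube roots of `p_0 = 3, p_1, …, p_s`
    (ζ d : Qbar) (hζ : IsPrimitiveRoot ζ 3)
    (hd : d ^ 2 = algebraMap ℚ Qbar (D : ℚ)) (hd0 : d ≠ 0)
    (c : Fin (s + 1) → Qbar)
    (hc0 : c 0 ^ 3 = 3) (hc : ∀ i : Fin s, c i.succ ^ 3 = (p i : Qbar))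
    -- generators `P_0 = (0, √(-27D)), P_1, …, P_r` of `E^{-27D}(ℚ)`
    (r : ℕ) (P : Fin (r + 1) → Pts (-27 * (D : ℚ)) ℚ)
    (e : ℚ) (he : e ^ 2 = algebraMap ℚ ℚ (-27 * (D : ℚ))) (he0 : 0 < e)
    (hP0 : P 0 = zeroPt (-27 * (D : ℚ)) e he he0.ne')
    (hP : AddSubgroup.closure (Set.range P) = ⊤) :
    ∃ M : Matrix (Fin (r + 1)) (Fin (s + 1)) (ZMod 3),
      -- the `i`-th row of `M` is the coefficient vector of the cocycle of `P_i`
      (∀ (i : Fin (r + 1)) (lam : Fin (s + 1) → ZMod 3),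
        RepresentsKummerClass (D : ℚ) (P i) (cochain ζ c (zeroPt (D : ℚ) d hd hd0) lam) ↔
          lam = M.row i) ∧
      -- `φ_D` is a homomorphism, and `E^{-27D}(ℚ) / φ_D(E^D(ℚ))` is an `𝔽₃`-vector space
      -- isomorphic to the row space of `M`
      (∃ φ : Pts (D : ℚ) ℚ →+ Pts (-27 * (D : ℚ)) ℚ, (∀ Q, φ Q = isogeny (D : ℚ) Q) ∧
        ∃ _ : Module (ZMod 3) (Pts (-27 * (D : ℚ)) ℚ ⧸ φ.range),
          Nonempty ((Pts (-27 * (D : ℚ)) ℚ ⧸ φ.range) ≃ₗ[ZMod 3] rowSpace M)) ∧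
      -- the bijection `⟨λ⟩ ↦ ℚ(∛(∏ p_i ^ λ_i))`
      (Squarefree n →
        ∃ Φ : Submodule (ZMod 3) (Fin (s + 1) → ZMod 3) → NumFldClass,
          Set.BijOn Φ (admissibleLines p (rowSpace M)) (quasiMonogenicCubicFields D) ∧
          ∀ lam ∈ rowSpace M, lam ≠ 0 → Admissible p lam →
            Φ (Submodule.span (ZMod 3) {lam}) = classOf (cbrtField (primeProduct p lam))) := by
  have he' : e ^ 2 = -27 * (D : ℚ) := he
  have hD0 : (D : ℚ) ≠ 0 := by
    intro h
    rw [h] at he'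
    exact he0.ne' (by simpa using he')
  have hn0 : n.natAbs ≠ 0 := by
    rintro h
    rw [Int.natAbs_eq_zero] at h
    exact hn (h ▸ dvd_zero _)
  have hen : e = 9 * n.natAbs := by
    have h2 : ((n.natAbs : ℚ)) ^ 2 = (n : ℚ) ^ 2 := by
      rw [Nat.cast_natAbs]
      push_cast
      exact sq_abs _
    rw [← sq_eq_sq₀ he0.le (by positivity), he', hD]
    push_cast
    linear_combination -81 * h2
  have hpp : ∀ i, (p i).Prime := fun i => ((hp _).1 ⟨i, rfl⟩).1
  have hq : ∀ j, ((Fin.cons 3 p : Fin (s + 1) → ℕ) j).Prime :=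
    Fin.cases Nat.prime_three fun i => by simpa using hpp i
  have hqi : Function.Injective (Fin.cons 3 p : Fin (s + 1) → ℕ) := by
    rw [Fin.cons_injective_iff]
    refine ⟨?_, hp_inj⟩
    -- Here `3 ∤ n` ensures that `p_0 = 3` differs from the other primes.
    rintro ⟨i, hi⟩
    exact hn (by simpa [hi] using ((hp _).1 ⟨i, rfl⟩).2)
  have hqe : ∀ l : ℕ, l.Prime → (∀ j, (Fin.cons 3 p : Fin (s + 1) → ℕ) j ≠ l) →
      padicValRat l e = 0 := by
    intro l hl hlq
    have hl' : ¬ l ∣ 9 * n.natAbs := by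
      rw [hl.dvd_mul]
      rintro (h | h)
      · have h3 : l ∣ 3 := hl.dvd_of_dvd_pow (n := 2) (by norm_num; exact h)
        exact hlq 0 ((Nat.prime_dvd_prime_iff_eq hl Nat.prime_three).1 h3).symm
      · obtain ⟨i, hi⟩ := (hp l).2 ⟨hl, Int.natCast_dvd.2 h⟩
        exact hlq i.succ (by simpa using hi)
    have hcast : e = ((9 * n.natAbs : ℕ) : ℚ) := by rw [hen]; push_cast; rfl
    rw [hcast, padicValRat.of_nat, padicValNat.eq_zero_of_not_dvd hl', Nat.cast_zero]
  have hcq : ∀ j, c j ^ 3 = algebraMap ℚ Qbar ((Fin.cons 3 p : Fin (s + 1) → ℕ) j : ℕ) := by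
    refine Fin.cases ?_ fun i => ?_
    · rw [hc0]
      simp
    · rw [hc]
      simp
  obtain ⟨w, η, hw, hwd, hwζ, hη⟩ := exists_root_of_unity hζ hd he' he0.ne'
  obtain ⟨Λ, hrep, hker, hval⟩ := exists_kummerHom (hd := hd) (hd0 := hd0) hζ hD0 he' he0.ne'
    hw hwd hwζ hη hq hqi hcq hqe
  have hmem := mem_rowSpace_iff Λ P hP
  refine ⟨Matrix.of fun i => Λ (P i), fun i lam => hrep (P i) lam,
    ⟨isogenyHom hD0, fun _ => rfl, ?_⟩, ?_⟩
  · refine exists_zmodModule_linearEquiv (isogenyHom hD0) Λ ?_ _ hmem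
    ext Q
    exact hker Q
  · intro hsq
    subst hD
    refine exists_bijOn_admissibleLines hsq hn hp_inj hp _ fun lam h0 hlam => ?_
    rw [hmem]
    exact exists_kummerHom_eq_iff hsq hn hp_inj hp he' hen hη hq hqi hqe Λ hval h0 hlam
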